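/- Let $\Bbbk$ be a field of characteristic zero. All vector spaces are $\mathbb Z/2$-graded and $\Pi$ is parity reversion. Let $A=\Bbbk\oplus A_+$ be a formal cdga: $A_+$ is an inverse limit of finite-dimensional nilpotent non-unital commutative dg algebras $A_+/I$; let $d_A$ be its differential. Completed tensor products with $A_+$ are inverse limits over the quotients $A_+/I$. Let $(V,m)$ be an $L_\infty$-algebra over $\Bbbk$, that is, $V$ is a graded vector space and $m$ is a continuous odd derivation of $\hat S\Pi V^*$ with $m^2=0$ and without constant term; let $m^A$ be its $A$-linear extension to $\hat S\Pi V^*\hat\otimes A$. Let $\mathrm{CE}(V,V)$ be the dg Lie algebra of continuous derivations of $\hat S\Pi V^*$ with differential $[m,-]$, and $\overline{\mathrm{CE}}(V,V)$ its dg Lie subalgebra of derivations without constant term. A deformation of $V$ over $A$ as an $L_\infty$-algebra (respectively, as a curved $L_\infty$-algebra) is a Maurer–Cartan element of $\mathfrak g\hat\otimes A_+$ with $\mathfrak g=\overline{\mathrm{CE}}(V,V)$ (respectively $\mathfrak g=\mathrm{CE}(V,V)$), i.e. an odd $x$ with $[d_A+m^A,x]+\tfrac12[x,x]=0$. Two deformations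 $x_0,x_1$ are equivalent if there is a Maurer–Cartan element $X$ of $\mathfrak g[z,dz]\hat\otimes A_+$ with $X|_{z=0}=x_0$ and $X|_{z=1}=x_1$, where $\mathfrak g[z,dz]=\mathfrak g\otimes\Bbbk[z,dz]$. Let $\mathrm{MC}(V,A)$ be the set of even $\xi\in\Pi V\hat\otimes A_+$ satisfying the Maurer–Cartan equation $d_A\xi+\sum_{i\ge1}\frac1{i!}m_i^A(\xi,\dots,\xi)=0$; equivalently, the continuous algebra homomorphism $\hat S\Pi V^*\to A$ determined by $\xi$ commutes with the differentials $m$ and $d_A$. Regarding $\xi$ as a constant $A$-linear derivation of $\hat S\Pi V^*\hat\otimes A$, define the twisted structure $m^\xi$ by $d_A+m^\xi=e^{\xi}(d_A+m^A)e^{-\xi}$. Let $x$ be a deformation of $V$ over $A$ as an $L_\infty$-algebra which, viewed as a deformation of $V$ as a curved $L_\infty$-algebra, is equivalent to the zero deformation. Then there is $\xi\in\mathrm{MC}(V,A)$ such that $m^\xi-m^A$ is a deformation of $V$ over $A$ as an $L_\infty$-algebra and $x$ is equivalent to it (as a deformation of the $L_\infty$-algebra $V$). -/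

import Mathlib

namespace CurvedLInf

noncomputable section

/-! ### Coefficient superalgebras -/

/-- A grading by `ZMod 2` and a fundamental system of open subspaces (a linear topology) on a
`k`-algebra `C`.  It is only used for the two coefficient algebras built below: the ground field
and the unital algebra attached to a formal cdga. -/
structure Coeff (k C : Type*) [Field k] [Ring C] [Algebra k C] where
  /-- the even part `gr 0` and the odd part `gr 1` -/
  gr : ZMod 2 → Submodule k C
  isCompl : IsCompl (gr 0) (gr 1)
  /-- a fundamental system of open neighbourhoods of zero -/
  opens : Set (Submodule k C)

/-- The parity automorphism: `c ↦ c` on even elements and `c ↦ -c` on odd elements. -/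
def Coeff.parityAut {k C : Type*} [Field k] [Ring C] [Algebra k C] (S : Coeff k C) : C →ₗ[k] C :=
  Submodule.projection (S.gr 0) (S.gr 1) S.isCompl - Submodule.projection (S.gr 1) (S.gr 0) S.isCompl.symm

/-- The `s`-th power of the parity automorphism, that is `c ↦ (-1) ^ (s * |c|) c`. -/
def Coeff.twist {k C : Type*} [Field k] [Ring C] [Algebra k C] (S : Coeff k C)
    (s : ZMod 2) (c : C) : C :=
  if s = 0 then c else S.parityAut c

/-- The ground field: purely even and discrete. -/
def groundCoeff (k : Type*) [Field k] : Coeff k k where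
  gr s := if s = 0 then ⊤ else ⊥
  isCompl := by simpa using isCompl_top_bot
  opens := {⊥}

/-- The structure of a formal non-unital cdga on `R` (the maximal ideal `A₊` of a formal cdga `A`):
a `ZMod 2`-graded, graded commutative, non-unital dg algebra which is the inverse limit of
finite-dimensional nilpotent non-unital cdgas, namely of its quotients by a downward directed
family `opens` of dg ideals. -/
structure FormalCDGA (k R : Type*) [Field k] [NonUnitalRing R] [Module k R]
    [IsScalarTower k R R] [SMulCommClass k R R] where
  gr : ZMod 2 → Submodule k R
  isCompl : IsCompl (gr 0) (gr 1)
  mul_mem : ∀ s t a b, a ∈ gr s → b ∈ gr t → a * b ∈ gr (s + t)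
  graded_comm : ∀ s t a b, a ∈ gr s → b ∈ gr t → a * b = (-1 : ℤˣ) ^ (s * t) • (b * a)
  /-- the differential -/
  d : R →ₗ[k] R
  d_mem : ∀ s a, a ∈ gr s → d a ∈ gr (s + 1)
  d_mul : ∀ s a b, a ∈ gr s → d (a * b) = d a * b + (-1 : ℤˣ) ^ s • (a * d b)
  d_d : ∀ a, d (d a) = 0
  /-- the open dg ideals along which the inverse limit is taken -/
  opens : Set (Submodule k R)
  opens_nonempty : opens.Nonempty
  opens_directed : ∀ I ∈ opens, ∀ J ∈ opens, ∃ K ∈ opens, K ≤ I ⊓ J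
  mul_mem_left : ∀ I ∈ opens, ∀ a b, b ∈ I → a * b ∈ I
  mul_mem_right : ∀ I ∈ opens, ∀ a b, b ∈ I → b * a ∈ I
  homogeneous : ∀ I ∈ opens, ∀ a ∈ gr 0, ∀ b ∈ gr 1, a + b ∈ I → a ∈ I ∧ b ∈ I
  d_mem_opens : ∀ I ∈ opens, ∀ a ∈ I, d a ∈ I
  finite_quotient : ∀ I ∈ opens, Module.Finite k (R ⧸ I)
  /-- the quotient by an open ideal is nilpotent: all products of length `n + 1` lie in `I` -/
  nilpotent_quotient : ∀ I ∈ opens, ∃ n : ℕ, ∀ l : List R, l.length = n →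
    ∀ r : R, l.foldr (· * ·) r ∈ I
  separated : ∀ r : R, (∀ I ∈ opens, r ∈ I) → r = 0
  complete : ∀ r : (∀ I : opens, R ⧸ I.1),
    (∀ (I J : opens) (h : I.1 ≤ J.1), Submodule.factor h (r I) = r J) →
    ∃ s : R, ∀ I : opens, I.1.mkQ s = r I

section Formal

variable {k R : Type*} [Field k] [NonUnitalRing R] [Module k R]
  [IsScalarTower k R R] [SMulCommClass k R R]

/-- The formal cdga `A = k ⊕ A₊` as a coefficient superalgebra: the unit is even, and the open
ideals of `A₊` form a fundamental system of neighbourhoods of zero. -/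
def FormalCDGA.unital (F : FormalCDGA k R) : Coeff k (Unitization k R) where
  gr s := if s = 0 then (F.gr 0).comap (Unitization.sndHom k k R)
    else (F.gr 1).map (Unitization.inrHom k k R)
  isCompl := by
    have h := F.isCompl
    simp only [if_true, one_ne_zero, if_false]
    constructor
    · rw [Submodule.disjoint_def]
      rintro x hx ⟨r, hr, rfl⟩
      have h0 : r = 0 := (Submodule.disjoint_def.mp h.disjoint) r (by simpa using hx) hr
      simp [h0]
    · rw [codisjoint_iff, eq_top_iff]
      intro x _
      obtain ⟨a, ha, b, hb, hab⟩ :=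
        Submodule.mem_sup.mp (h.codisjoint.eq_top.ge (Submodule.mem_top (x := x.snd)))
      refine Submodule.mem_sup.mpr ⟨Unitization.inl x.fst + Unitization.inr a, ?_,
        Unitization.inr b, ⟨b, hb, rfl⟩, ?_⟩
      · simpa using ha
      · ext <;> simp [hab]
  opens := (fun I => I.map (Unitization.inrHom k k R)) '' F.opens

/-- The completed tensor product `V ⊗̂ A₊`, the inverse limit of `V ⊗ (A₊ / I)` over the open
ideals `I`, for a discrete vector space `V`. -/
structure CompletedTensor (F : FormalCDGA k R) (V : Type*) [AddCommGroup V] [Module k V] where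
  val : ∀ I : F.opens, TensorProduct k V (R ⧸ I.1)
  compat : ∀ (I J : F.opens) (h : I.1 ≤ J.1),
    LinearMap.lTensor V (Submodule.factor h) (val I) = val J

variable {V : Type*} [AddCommGroup V] [Module k V] {B : Type*}

theorem CompletedTensor.exists_coord {F : FormalCDGA k R} (ξ : CompletedTensor F V)
    (b : Module.Basis B k V) (i : B) :
    ∃ s : R, ∀ I : F.opens, I.1.mkQ s =
      TensorProduct.lid k (R ⧸ I.1) (LinearMap.rTensor (R ⧸ I.1) (b.coord i) (ξ.val I)) := by
  apply F.complete
  intro I J h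
  rw [← ξ.compat I J h]
  generalize ξ.val I = t
  induction t using TensorProduct.induction_on with
  | zero => simp
  | tmul v r => simp
  | add x y hx hy => simp only [map_add, hx, hy]

/-- The coordinates `ξ^i ∈ A₊` of `ξ = ∑ b_i ⊗ ξ^i` with respect to a basis of `V`. -/
def CompletedTensor.coord {F : FormalCDGA k R} (ξ : CompletedTensor F V)
    (b : Module.Basis B k V) (i : B) : R :=
  (ξ.exists_coord b i).choose

end Formal

/-! ### The formal algebra of a graded vector space

For a graded vector space with an ordered homogeneous basis whose dual coordinates `x_i` have
parities `p i`, the completed symmetric algebra on the dual space with coefficients in `C` consists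
of all formal power series `∑ f_ν x^ν`, `f_ν ∈ C`, in the supercommuting coordinates; here `x^ν` is
the ordered product of the `x_i ^ (ν i)`, where `ν i ≤ 1` if `x_i` is odd. -/

section Series

variable {B : Type*} [LinearOrder B]

/-- Exponents of the nonzero monomials: odd variables occur at most once. -/
def Admissible (p : B → ZMod 2) (ν : B →₀ ℕ) : Prop := ∀ i, p i = 1 → ν i ≤ 1

/-- The monomials `x^ν`. -/
abbrev Mono (p : B → ZMod 2) : Type _ := {ν : B →₀ ℕ // Admissible p ν}

theorem Admissible.of_le {B : Type*} {p : B → ZMod 2} {ν α : B →₀ ℕ} (h : Admissible p ν) (hα : α ≤ ν) :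
    Admissible p α := fun i hi => (hα i).trans (h i hi)

/-- The constant monomial. -/
def Mono.one (p : B → ZMod 2) : Mono p := ⟨0, fun _ _ => Nat.zero_le 1⟩

/-- The monomial `x_i`. -/
def Mono.var (p : B → ZMod 2) (i : B) : Mono p :=
  ⟨Finsupp.single i 1, fun j _ => by rw [Finsupp.single_apply]; split_ifs <;> simp⟩

/-- The parity of `x^ν`. -/
def monoParity (p : B → ZMod 2) (ν : B →₀ ℕ) : ZMod 2 := ν.sum fun i n => (n : ZMod 2) * p i

/-- The exponent `e` of the Koszul sign in `x^α x^β = (-1)^e x^(α+β)`: every factor `x_j` of `x^β`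
passes every factor `x_i` of `x^α` with `j < i`. -/
def koszulExp (p : B → ZMod 2) (α β : B →₀ ℕ) : ZMod 2 :=
  α.sum fun i a => β.sum fun j b =>
    if j < i then ((a : ZMod 2) * p i) * ((b : ZMod 2) * p j) else 0

/-- Formal power series with coefficients in `C`. -/
abbrev Ser (p : B → ZMod 2) (C : Type*) : Type _ := Mono p → C

variable {k C : Type*} [Field k] [Ring C] [Algebra k C]

/-- The product of formal power series, determined by `x^α c = (-1)^(|α| |c|) c x^α` for `c ∈ C` and
`x^α x^β = ± x^(α+β)`. -/
def Ser.mul (S : Coeff k C) {p : B → ZMod 2} (f g : Ser p C) : Ser p C := fun ν =>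
  ∑ ab ∈ (Finset.HasAntidiagonal.antidiagonal ν.1).attach,
    (-1 : ℤˣ) ^ koszulExp p ab.1.1 ab.1.2 •
      (f ⟨ab.1.1, ν.2.of_le (Finset.HasAntidiagonal.antidiagonal.fst_le ab.2)⟩ *
        S.twist (monoParity p ab.1.1)
          (g ⟨ab.1.2, ν.2.of_le (Finset.HasAntidiagonal.antidiagonal.snd_le ab.2)⟩))

/-- The series `c x^ν`. -/
def Ser.monomial {p : B → ZMod 2} (ν : Mono p) (c : C) : Ser p C := Pi.single ν c

/-- The coordinate function `x_i`. -/
def Ser.X {p : B → ZMod 2} (C : Type*) [Ring C] (i : B) : Ser p C :=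
  Ser.monomial (Mono.var p i) 1

/-- `f` is homogeneous of parity `s`. -/
def Ser.IsHomogeneous (S : Coeff k C) {p : B → ZMod 2} (s : ZMod 2) (f : Ser p C) : Prop :=
  ∀ ν, f ν ∈ S.gr (s + monoParity p ν.1)

/-- Continuity for the product topology on series of a `k`-linear operator. -/
def IsContinuousOp (S : Coeff k C) {p : B → ZMod 2} (D : Ser p C →ₗ[k] Ser p C) : Prop :=
  ∀ ν, ∀ I ∈ S.opens, ∃ J ∈ S.opens, ∃ T : Finset (Mono p),
    ∀ f : Ser p C, (∀ α ∈ T, f α ∈ J) → D f ν ∈ I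

/-- `D` is a continuous `C`-linear derivation of parity `s` of the algebra of formal power series
with coefficients in `C`. -/
structure IsDerivation (S : Coeff k C) {p : B → ZMod 2} (s : ZMod 2)
    (D : Ser p C →ₗ[k] Ser p C) : Prop where
  parity : ∀ t f, Ser.IsHomogeneous S t f → Ser.IsHomogeneous S (s + t) (D f)
  leibniz : ∀ t f g, Ser.IsHomogeneous S t f →
    D (Ser.mul S f g) = Ser.mul S (D f) g + (-1 : ℤˣ) ^ (s * t) • Ser.mul S f (D g)
  linear : ∀ t, ∀ c ∈ S.gr t, ∀ f : Ser p C,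
    D (fun ν => c * f ν) = (-1 : ℤˣ) ^ (s * t) • fun ν => c * D f ν
  continuous : IsContinuousOp S D

/-- The derivation `D = ∑ D(x_i) ∂_i` has vanishing constant term. -/
def NoConstantTerm {p : B → ZMod 2} (D : Ser p C →ₗ[k] Ser p C) : Prop :=
  ∀ i, D (Ser.X C i) (Mono.one p) = 0

/-- An `L_∞`-structure, in terms of the parities `p` of the coordinates on `ΠV`: a continuous odd
derivation of square zero and without constant term of the formal power series over `k`. -/
structure LInfinityStructure (k : Type*) [Field k] (p : B → ZMod 2) where
  m : Ser p k →ₗ[k] Ser p k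
  isDerivation : IsDerivation (groundCoeff k) 1 m
  square_zero : m ∘ₗ m = 0
  noConstantTerm : NoConstantTerm m

theorem LInfinityStructure.finite_row {p : B → ZMod 2} (L : LInfinityStructure k p) (ν : Mono p) :
    {α : Mono p | L.m (Ser.monomial α 1) ν ≠ 0}.Finite := by
  classical
  obtain ⟨J, hJ, T, hT⟩ := L.isDerivation.continuous ν ⊥ rfl
  refine T.finite_toSet.subset fun α hα => ?_
  by_contra hαT
  refine hα ((Submodule.mem_bot k).mp (hT _ fun β hβ => ?_))
  have hne : β ≠ α := fun h => hαT (h ▸ hβ)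
  simp [Ser.monomial, Pi.single_eq_of_ne hne]

end Series

/-! ### Deformations over a formal cdga -/

section Deformations

variable {k R : Type*} [Field k] [NonUnitalRing R] [Module k R]
  [IsScalarTower k R R] [SMulCommClass k R R] {B : Type*} [LinearOrder B]

/-- Operators on the formal power series with coefficients in `A = k ⊕ A₊`. -/
abbrev Op (k R : Type*) [Field k] [NonUnitalRing R] [Module k R]
    [IsScalarTower k R R] [SMulCommClass k R R] (p : B → ZMod 2) : Type _ :=
  Module.End k (Ser p (Unitization k R))

/-- The extension of scalars `m^A` of `m`, acting by
`m^A (∑ f_α x^α) = ∑ (-1)^|f_α| f_α m(x^α)`; each coefficient of the result is a finite sum. -/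
def extendScalars (F : FormalCDGA k R) {p : B → ZMod 2} (L : LInfinityStructure k p) :
    Op k R p where
  toFun f ν := ∑ᶠ α : Mono p, L.m (Ser.monomial α 1) ν • F.unital.parityAut (f α)
  map_add' f g := by
    funext ν
    simp only [Pi.add_apply, map_add, smul_add]
    refine finsum_add_distrib ?_ ?_ <;>
      exact (L.finite_row ν).subset fun α hα h => hα (by simp [h])
  map_smul' c f := by
    funext ν
    simp only [Pi.smul_apply, map_smul, RingHom.id_apply]
    rw [smul_finsum' c ((L.finite_row ν).subset fun α hα h => hα (by simp [h]))]
    exact finsum_congr fun α => smul_comm _ _ _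

/-- The differential `d_A` of `A` acting on coefficients. -/
def coeffDifferential (F : FormalCDGA k R) (p : B → ZMod 2) : Op k R p :=
  LinearMap.pi fun ν =>
    (Unitization.inrHom k k R ∘ₗ F.d ∘ₗ Unitization.sndHom k k R) ∘ₗ LinearMap.proj ν

/-- The total differential `d_A + m^A`. -/
def totalDifferential (F : FormalCDGA k R) {p : B → ZMod 2} (L : LInfinityStructure k p) :
    Op k R p :=
  coeffDifferential F p + extendScalars F L

/-- The parity `s` part of `CE(V,V) ⊗̂ A₊`: continuous `A`-linear derivations of parity `s`
which vanish modulo `A₊`. -/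
def CE (F : FormalCDGA k R) (p : B → ZMod 2) (s : ZMod 2) : Set (Op k R p) :=
  {D | IsDerivation F.unital s D ∧ ∀ f ν, (D f ν).fst = 0}

/-- The parity `s` part of the truncated complex `CEbar(V,V) ⊗̂ A₊`: derivations as above with
vanishing constant term. -/
def CEbar (F : FormalCDGA k R) (p : B → ZMod 2) (s : ZMod 2) : Set (Op k R p) :=
  {D | D ∈ CE F p s ∧ NoConstantTerm D}

/-- The Maurer-Cartan elements of `g ⊗̂ A₊` for `g = CE(V,V)` or `g = CEbar(V,V)`: odd elements `x`
with `[Q, x] + (1/2) [x, x] = 0`, where `Q = d_A + m^A` and `[,]` is the supercommutator.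
For `g = CEbar(V,V)` these are the deformations over `A` of the `L_∞`-algebra, for `g = CE(V,V)`
its deformations as a curved `L_∞`-algebra. -/
def IsMaurerCartan (F : FormalCDGA k R) {p : B → ZMod 2} (L : LInfinityStructure k p)
    (g : ZMod 2 → Set (Op k R p)) (x : Op k R p) : Prop :=
  x ∈ g 1 ∧ totalDifferential F L * x + x * totalDifferential F L + x * x = 0

/-- All values of the operator `D` have coefficients in the subspace `I` of `A₊`. -/
def IsValuedIn (I : Submodule k R) {p : B → ZMod 2} (D : Op k R p) : Prop :=
  ∀ f ν, D f ν ∈ I.map (Unitization.inrHom k k R)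

/-- The coefficients of a polynomial in `z` with values in the completed tensor product: modulo
every open ideal only finitely many are nonzero. -/
def TendsToZero (F : FormalCDGA k R) {p : B → ZMod 2} (x : ℕ → Op k R p) : Prop :=
  ∀ I ∈ F.opens, ∃ N, ∀ n ≥ N, IsValuedIn I (x n)

/-- The series `∑ x_n` converges to `y`. -/
def SumsTo (F : FormalCDGA k R) {p : B → ZMod 2} (x : ℕ → Op k R p) (y : Op k R p) : Prop :=
  ∀ I ∈ F.opens, ∃ N, ∀ n ≥ N, IsValuedIn I ((∑ j ∈ Finset.range n, x j) - y)

/-- `X = ∑ x_n z^n + ∑ h_n z^n dz` is a Maurer-Cartan element of `g[z,dz] ⊗̂ A₊`, which is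
the inverse limit of `g ⊗ k[z,dz] ⊗ A₊/I`.  Writing `X = x(z) + h(z) dz` the equation
`dX + (1/2) [X, X] = 0` has the components `[Q, x] + (1/2) [x, x] = 0` and
`[Q, h] - ∂x/∂z + [x, h] = 0`. -/
structure IsMaurerCartanPath (F : FormalCDGA k R) {p : B → ZMod 2} (L : LInfinityStructure k p)
    (g : ZMod 2 → Set (Op k R p)) (x h : ℕ → Op k R p) : Prop where
  odd : ∀ n, x n ∈ g 1
  even : ∀ n, h n ∈ g 0
  x_tendsto : TendsToZero F x
  h_tendsto : TendsToZero F h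
  curvature : ∀ n, totalDifferential F L * x n + x n * totalDifferential F L +
    ∑ ab ∈ Finset.HasAntidiagonal.antidiagonal n, x ab.1 * x ab.2 = 0
  transport : ∀ n, totalDifferential F L * h n - h n * totalDifferential F L -
    ((n : k) + 1) • x (n + 1) +
    ∑ ab ∈ Finset.HasAntidiagonal.antidiagonal n, (x ab.1 * h ab.2 - h ab.2 * x ab.1) = 0

/-- Gauge equivalence (homotopy) of `y₀` and `y₁`: there is a Maurer-Cartan element of
`g[z,dz] ⊗̂ A₊` with restrictions `y₀` at `z = 0` and `y₁` at `z = 1`. -/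
def GaugeEquivalent (F : FormalCDGA k R) {p : B → ZMod 2} (L : LInfinityStructure k p)
    (g : ZMod 2 → Set (Op k R p)) (y₀ y₁ : Op k R p) : Prop :=
  ∃ x h : ℕ → Op k R p, IsMaurerCartanPath F L g x h ∧ x 0 = y₀ ∧ SumsTo F x y₁

/-! ### Maurer-Cartan elements of an `L_∞`-algebra and twisting -/

/-- The value `ξ^ν ∈ A` of the monomial `x^ν` at the point with coordinates `ξ`. -/
def evalMono {p : B → ZMod 2} (ξ : B → R) (ν : Mono p) : Unitization k R :=
  ((ν.1.support.sort (· ≤ ·)).map fun i => (Unitization.inr (ξ i) : Unitization k R) ^ ν.1 i).prod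

/-- The point with coordinates `ξ^i ∈ A₊` is an even solution of the Maurer-Cartan equation.  In
coordinates, if `m = ∑ m^i ∂_i`, then `∑_n (1/n!) m_n^A(ξ,…,ξ)` has the components `m^i(ξ)`, and the
equation says that the convergent series `m^i(ξ)` equals `d_A ξ^i` for every `i`; equivalently, the
homomorphism to `A` given by `x_i ↦ ξ^i` commutes with the differentials. -/
def IsMaurerCartanPoint (F : FormalCDGA k R) {p : B → ZMod 2} (L : LInfinityStructure k p)
    (ξ : B → R) : Prop :=
  (∀ i, ξ i ∈ F.gr (p i)) ∧
  ∀ i, ∀ I ∈ F.opens, ∃ T₀ : Finset (Mono p), ∀ T ⊇ T₀,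
    (∑ ν ∈ T, L.m (Ser.X k i) ν • (evalMono ξ ν : Unitization k R)) -
      Unitization.inr (F.d (ξ i)) ∈ I.map (Unitization.inrHom k k R)

/-- `D` is `ξ` regarded as a constant derivation: the continuous even `A`-linear derivation with
`D(x_i) = ξ^i`. -/
def IsConstantDerivation (F : FormalCDGA k R) {p : B → ZMod 2} (ξ : B → R) (D : Op k R p) : Prop :=
  IsDerivation F.unital 0 D ∧
    ∀ i, D (Ser.X (Unitization k R) i) =
      Ser.monomial (Mono.one p) (Unitization.inr (ξ i) : Unitization k R)

/-- `E = e^D = ∑ D^j / j!`, with convergence of every coefficient. -/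
def IsExponential (F : FormalCDGA k R) {p : B → ZMod 2} (D E : Op k R p) : Prop :=
  ∀ f ν, ∀ I ∈ F.opens, ∃ N, ∀ n ≥ N,
    (∑ j ∈ Finset.range n, ((j.factorial : k)⁻¹ • (D ^ j) f ν)) - E f ν ∈
      I.map (Unitization.inrHom k k R)

/-- `y` is the deformation `m^ξ - m^A` given by twisting with `ξ`, where the twisted structure
`m^ξ` is defined by `d_A + m^ξ = e^ξ (d_A + m^A) e^(-ξ)`. -/
def IsTwistingDeformation (F : FormalCDGA k R) {p : B → ZMod 2} (L : LInfinityStructure k p)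
    (ξ : B → R) (y : Op k R p) : Prop :=
  ∃ D E E' : Op k R p, IsConstantDerivation F ξ D ∧ IsExponential F D E ∧ IsExponential F (-D) E' ∧
    y = E * totalDifferential F L * E' - totalDifferential F L

end Deformations

/-- The parities of the coordinates on `ΠV` dual to a homogeneous basis of `V` with parities
`deg`. -/
def shiftedParity {B : Type*} (deg : B → ZMod 2) : B → ZMod 2 := fun i => deg i + 1

end

end CurvedLInf

/-! Put `Q = d_A + m^A`, so that `Q² = 0`. A Maurer–Cartan path `X(z) + H(z) dz` amounts to `(Q +
X)² = 0` together with the Lax equation `X' = [Q + X, H]`. The given path runs from `x` to `0` in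
`CE`; it leaves `CEbar` only because `H` may have a constant part. That part is removed by a gauge
transformation through constant derivations.

Let `D(z)` be the path of even constant derivations with `D(0) = 0` and `D' =` constant part of `W =
e^D H e^{-D}`. Constant derivations commute, so `(e^D)' = D' e^D`, and `G = e^D (Q + X) e^{-D}`
satisfies `G² = 0` and `G' = [G, W - D']`. By the choice of `D`, the derivation `W - D'` has no
constant term. Thus `Y = G - Q` solves a differential equation inside `CEbar` with `Y(0) = x`, and
all its coefficients stay in `CEbar`. Since `X(1) = 0`, its endpoint is `e^ξ Q e^{-ξ} - Q` with `ξ =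
D(1)`, which is the twisting deformation. The constant term of this operator on `x_i` is `m^i(ξ) -
d_A ξ^i`; as it vanishes, `ξ` is a Maurer–Cartan point.

The analytic content is the equation for `D`, solved by Picard iteration (`exists_constant_path`).
The iteration contracts in two ways: each step gains an order in `z`, which gives a formal solution,
and each step gains a power of `A₊`, which is nilpotent modulo an open ideal, so the solution is
polynomial in `z` modulo every open ideal and can be evaluated at `z = 1`. The other main
ingredients are `e^D h e^{-D} = e^{ad D} h` (`eqBelow_expS_conj`), which shows that conjugates of
derivations are derivations; `IsDerivation.constPart`, the splitting off of the constant part; and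
`IsExponential.apply_monomial_apply_one`, Taylor's formula at the origin. -/

namespace CurvedLInf

open Finset PowerSeries

set_option linter.unusedSectionVars false

/-! ### Derivatives and exponentials of power series over a noncommutative ring. -/

section FormalExp

variable {A : Type*} [Ring A]

/-- The derivative of a power series with coefficients in a possibly noncommutative ring. -/
noncomputable def dz : A⟦X⟧ →+ A⟦X⟧ where
  toFun a := PowerSeries.mk fun n => (n + 1) • coeff (n + 1) a
  map_zero' := by ext n; simp
  map_add' a b := by ext n; simp

@[simp] theorem coeff_dz (a : A⟦X⟧) (n : ℕ) : coeff n (dz a) = (n + 1) • coeff (n + 1) a := by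
  simp [dz]

theorem dz_mul (a b : A⟦X⟧) : dz (a * b) = dz a * b + a * dz b := by
  ext n
  -- The factor `n + 1` is written as `p.1 + p.2` on the antidiagonal. In each half the term with
  -- zero weight drops out, and an index shift yields the derivative of one factor.
  have h1 : (n + 1) • coeff (n + 1) (a * b) =
      ∑ p ∈ antidiagonal (n + 1), p.1 • (coeff p.1 a * coeff p.2 b) +
      ∑ p ∈ antidiagonal (n + 1), p.2 • (coeff p.1 a * coeff p.2 b) := by
    rw [coeff_mul, smul_sum, ← sum_add_distrib]
    refine sum_congr rfl fun p hp => ?_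
    rw [← add_smul, mem_antidiagonal.mp hp]
  rw [coeff_dz, h1, Finset.Nat.sum_antidiagonal_succ, Finset.Nat.sum_antidiagonal_succ', map_add,
    coeff_mul, coeff_mul]
  simp only [coeff_dz, smul_mul_assoc, mul_smul_comm, zero_smul, zero_add]

theorem dz_C (a : A) : dz (C a : A⟦X⟧) = 0 := by
  ext n; simp

/-- Two power series agree in all degrees below `N`. -/
def EqBelow (N : ℕ) (a b : A⟦X⟧) : Prop := ∀ n < N, coeff n a = coeff n b

theorem EqBelow.mul {N : ℕ} {a a' b b' : A⟦X⟧} (h : EqBelow N a a') (h' : EqBelow N b b') :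
    EqBelow N (a * b) (a' * b') := fun n hn => by
  rw [coeff_mul, coeff_mul]
  refine sum_congr rfl fun p hp => ?_
  have := mem_antidiagonal.mp hp
  rw [h _ (by omega), h' _ (by omega)]

theorem EqBelow.refl (N : ℕ) (a : A⟦X⟧) : EqBelow N a a := fun _ _ => rfl

theorem EqBelow.symm {N : ℕ} {a b : A⟦X⟧} (h : EqBelow N a b) : EqBelow N b a :=
  fun n hn => (h n hn).symm

theorem EqBelow.trans {N : ℕ} {a b c : A⟦X⟧} (h : EqBelow N a b) (h' : EqBelow N b c) :
    EqBelow N a c := fun n hn => (h n hn).trans (h' n hn)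

theorem eqBelow_zero_mul {M N : ℕ} {a b : A⟦X⟧} (ha : EqBelow M a 0) (hb : EqBelow N b 0) :
    EqBelow (M + N) (a * b) 0 := fun n hn => by
  rw [coeff_mul, map_zero]
  refine sum_eq_zero fun p hp => ?_
  have := mem_antidiagonal.mp hp
  rcases lt_or_ge p.1 M with h | h
  · rw [ha _ h, map_zero, zero_mul]
  · rw [hb p.2 (by omega), map_zero, mul_zero]

theorem eqBelow_zero_pow {D : A⟦X⟧} (hD : coeff 0 D = 0) (j : ℕ) : EqBelow j (D ^ j) 0 := by
  induction j with
  | zero => exact fun n hn => absurd hn (by omega)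
  | succ j ih =>
    rw [pow_succ]
    refine eqBelow_zero_mul ih fun n hn => ?_
    obtain rfl : n = 0 := by omega
    simp [hD]

/-- The triangle `i + j < N` and the square `i, j < N` differ only by products with `i + j ≥ N`.
This serves twice: for vanishing below a power of `z`, and for values in an open ideal. -/
theorem sum_antidiagonal_sub_mul_mem {G : Type*} [SetLike G A] [AddSubgroupClass G A] (v : G)
    (e g : ℕ → A) (N : ℕ) (h : ∀ i j, N ≤ i + j → e i * g j ∈ v) :
    (∑ n ∈ range N, ∑ p ∈ antidiagonal n, e p.1 * g p.2) -
      (∑ i ∈ range N, e i) * (∑ j ∈ range N, g j) ∈ v := by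
  have h1 : (∑ n ∈ range N, ∑ p ∈ antidiagonal n, e p.1 * g p.2) =
      ∑ p ∈ range N ×ˢ range N, if p.1 + p.2 < N then e p.1 * g p.2 else 0 := by
    have : ∀ n ∈ range N, ∑ p ∈ antidiagonal n, e p.1 * g p.2 =
        ∑ p ∈ range N ×ˢ range N, if p.1 + p.2 = n then e p.1 * g p.2 else 0 := by
      intro n hn
      rw [← sum_filter]
      refine sum_congr ?_ fun _ _ => rfl
      ext p
      simp only [HasAntidiagonal.mem_antidiagonal, mem_filter, mem_product, mem_range] at hn ⊢
      exact ⟨fun h => ⟨⟨by omega, by omega⟩, h⟩, fun h => h.2⟩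
    rw [sum_congr rfl this, sum_comm]
    refine sum_congr rfl fun p _ => ?_
    simp [sum_ite_eq]
  rw [h1, sum_mul_sum, ← sum_product', ← sum_sub_distrib]
  refine sum_mem fun p _ => ?_
  split_ifs with hp
  · simp [zero_mem]
  · rw [zero_sub]
    exact neg_mem (h _ _ (by omega))

/-- The commutator with `D`. -/
def ad (D y : A) : A := D * y - y * D

variable (k : Type*) [Field k] [Algebra k A]

/-- The formal exponential `∑ D ^ j / j! t ^ j`. -/
noncomputable def expSeries (D : A) : A⟦X⟧ :=
  PowerSeries.mk fun j => ((j.factorial : k)⁻¹ • D ^ j)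

/-- The exponential of a power series without constant term. -/
noncomputable def expS (D : A⟦X⟧) : A⟦X⟧ :=
  PowerSeries.mk fun n => coeff n (∑ j ∈ range (n + 1), ((j.factorial : k)⁻¹ • D ^ j))

theorem coeff_smul' (c : k) (a : A⟦X⟧) (n : ℕ) : coeff n (c • a) = c • coeff n a := rfl

theorem coeff_zero_expS (D : A⟦X⟧) : coeff 0 (expS k D) = 1 := by
  simp [expS]

theorem dz_smul (c : k) (a : A⟦X⟧) : dz (c • a) = c • dz a := by
  ext n
  simp only [coeff_dz, coeff_smul', smul_comm c]

variable {k} in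
theorem EqBelow.smul {N : ℕ} {a b : A⟦X⟧} (c : k) (h : EqBelow N a b) :
    EqBelow N (c • a) (c • b) := fun n hn => by rw [coeff_smul', coeff_smul', h n hn]

theorem eqBelow_sum_range {c : ℕ → A⟦X⟧} (hc : ∀ j, EqBelow j (c j) 0) {M N : ℕ} (h : M ≤ N) :
    EqBelow M (∑ j ∈ range N, c j) (∑ j ∈ range M, c j) := fun n hn => by
  obtain ⟨d, rfl⟩ := Nat.exists_eq_add_of_le h
  rw [sum_range_add, map_add, add_eq_left, map_sum]
  exact sum_eq_zero fun j _ => hc _ n (by omega)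

/-- `D ^ j` starts in degree `j`, so the cut at `n + 1` in `expS` loses nothing and any longer cut
gives the same coefficient. -/
theorem eqBelow_expS {D : A⟦X⟧} (hD : coeff 0 D = 0) (N : ℕ) :
    EqBelow N (expS k D) (∑ j ∈ range N, ((j.factorial : k)⁻¹ • D ^ j)) := fun n hn => by
  rw [expS, coeff_mk]
  refine (eqBelow_sum_range (fun j => ?_) (Nat.succ_le_of_lt hn) n (Nat.lt_succ_self n)).symm
  simpa using (eqBelow_zero_pow hD j).smul ((j.factorial : k)⁻¹)

theorem commute_expS {a D : A⟦X⟧} (hD : coeff 0 D = 0) (h : Commute a D) :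
    Commute a (expS k D) := by
  have h2 : ∀ N, Commute a (∑ j ∈ range N, ((j.factorial : k)⁻¹ • D ^ j)) := fun N =>
    Commute.sum_right _ _ _ fun j _ => (h.pow_right j).smul_right _
  ext n
  have h1 := eqBelow_expS k hD (n + 1)
  rw [((EqBelow.refl (n + 1) a).mul h1) n (by omega), (h2 _).eq,
    (h1.mul (EqBelow.refl (n + 1) a)) n (by omega)]

variable [CharZero k]

theorem factorial_inv_smul_succ {M : Type*} [AddCommGroup M] [Module k M] (n : ℕ) (y : M) :
    (n + 1) • (((n + 1).factorial : k)⁻¹ • y) = ((n.factorial : k)⁻¹ • y) := by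
  rw [← Nat.cast_smul_eq_nsmul k, smul_smul]
  congr 1
  have : ((n + 1 : ℕ) : k) ≠ 0 := by exact_mod_cast Nat.succ_ne_zero n
  rw [Nat.factorial_succ, Nat.cast_mul, mul_inv, ← mul_assoc, mul_inv_cancel₀ this, one_mul]

theorem dz_expSeries (D : A) : dz (expSeries k D) = C D * expSeries k D := by
  ext n
  rw [coeff_dz, coeff_C_mul, expSeries, coeff_mk, coeff_mk, factorial_inv_smul_succ, pow_succ',
    mul_smul_comm]

theorem dz_expSeries' (D : A) : dz (expSeries k D) = expSeries k D * C D := by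
  ext n
  rw [coeff_dz, coeff_mul_C, expSeries, coeff_mk, coeff_mk, factorial_inv_smul_succ, pow_succ,
    smul_mul_assoc]

/-- This is `e^{tD} h e^{-tD} = e^{t ad D} h`: both sides solve `y' = [D, y]` with `y(0) = h`, and
characteristic zero makes the solution unique coefficient by coefficient. -/
theorem coeff_expSeries_conj (D h : A) (n : ℕ) :
    coeff n (expSeries k D * C h * expSeries k (-D)) =
      ((n.factorial : k)⁻¹ • (ad D)^[n] h) := by
  have key : dz (expSeries k D * C h * expSeries k (-D)) =
      C D * (expSeries k D * C h * expSeries k (-D)) -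
        (expSeries k D * C h * expSeries k (-D)) * C D := by
    rw [dz_mul, dz_mul, dz_C, dz_expSeries, dz_expSeries' k (-D), map_neg]
    noncomm_ring
  induction n with
  | zero => simp [expSeries]
  | succ n ih =>
    have h1 := congrArg (coeff n) key
    rw [coeff_dz, map_sub, coeff_C_mul, coeff_mul_C, ih] at h1
    have h2 : (n + 1) • (((n + 1).factorial : k)⁻¹ • (ad D)^[n + 1] h) =
        ((n.factorial : k)⁻¹ • (ad D)^[n + 1] h) := factorial_inv_smul_succ k n _
    have h3 : ((n.factorial : k)⁻¹ • (ad D)^[n + 1] h) =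
        D * ((n.factorial : k)⁻¹ • (ad D)^[n] h) - ((n.factorial : k)⁻¹ • (ad D)^[n] h) * D := by
      rw [Function.iterate_succ_apply', ad, smul_sub, mul_smul_comm, smul_mul_assoc]
    rw [← h3, ← h2] at h1
    have hn : ((n + 1 : ℕ) : k) ≠ 0 := by exact_mod_cast Nat.succ_ne_zero n
    rw [← Nat.cast_smul_eq_nsmul k, ← Nat.cast_smul_eq_nsmul k] at h1
    exact smul_right_injective A hn h1

theorem dz_pow_succ {D : A⟦X⟧} (h : Commute (dz D) D) (j : ℕ) :
    dz (D ^ (j + 1)) = (j + 1) • (dz D * D ^ j) := by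
  induction j with
  | zero => simp
  | succ j ih =>
    rw [pow_succ, dz_mul, ih, smul_mul_assoc, mul_assoc, ← pow_succ, ← (h.pow_right (j + 1)).eq,
      ← succ_nsmul]

/-- In a noncommutative ring the formula needs `[D', D] = 0`. It is applied to series of constant
derivations, which commute with each other. -/
theorem dz_expS {D : A⟦X⟧} (hD : coeff 0 D = 0) (h : Commute (dz D) D) :
    dz (expS k D) = dz D * expS k D := by
  ext n
  have h1 : dz (∑ j ∈ range (n + 2), ((j.factorial : k)⁻¹ • D ^ j)) =
      dz D * ∑ j ∈ range (n + 1), ((j.factorial : k)⁻¹ • D ^ j) := by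
    rw [sum_range_succ', map_add, map_sum, mul_sum]
    have h0 : dz (((Nat.factorial 0 : k)⁻¹ • D ^ 0)) = 0 := by
      have := dz_C (1 : A)
      simpa using this
    rw [h0, add_zero]
    refine sum_congr rfl fun j _ => ?_
    rw [dz_smul, dz_pow_succ h, smul_comm, factorial_inv_smul_succ, mul_smul_comm]
  rw [coeff_dz, eqBelow_expS k hD (n + 2) (n + 1) (by omega), ← coeff_dz, h1]
  exact ((EqBelow.refl (n + 1) _).mul (eqBelow_expS k hD (n + 1))).symm n (by omega)

/-- Vanishing of the coefficients in degrees below `N`. -/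
def belowZero (A : Type*) [Ring A] (N : ℕ) : AddSubgroup A⟦X⟧ where
  carrier := {a | EqBelow N a 0}
  zero_mem' := EqBelow.refl N 0
  add_mem' {a b} ha hb n hn := by rw [map_add, ha n hn, hb n hn, map_zero, add_zero]
  neg_mem' {a} ha n hn := by rw [map_neg, ha n hn, map_zero, neg_zero]

/-- The auxiliary variable `t` of `coeff_expSeries_conj` is specialised to `1`. This is legitimate
because a word with `j` letters `D` vanishes below `z^j`, so only finitely many words matter in each
degree. -/
theorem eqBelow_expS_conj {D : A⟦X⟧} (hD : coeff 0 D = 0) (h : A⟦X⟧) (N : ℕ) :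
    EqBelow N (expS k D * h * expS k (-D))
      (∑ n ∈ range N, ((n.factorial : k)⁻¹ • (ad D)^[n] h)) := by
  have hD' : coeff 0 (-D) = 0 := by rw [map_neg, hD, neg_zero]
  have h1 := ((eqBelow_expS k hD N).mul (EqBelow.refl N h)).mul (eqBelow_expS k hD' N)
  refine h1.trans ?_
  have h2 := sum_antidiagonal_sub_mul_mem (belowZero A N)
    (fun i => ((i.factorial : k)⁻¹ • D ^ i) * h) (fun j => ((j.factorial : k)⁻¹ • (-D) ^ j)) N
    (fun i j hij n hn => by
      have h3 : EqBelow i (((i.factorial : k)⁻¹ • D ^ i) * h) 0 := by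
        have h6 := (eqBelow_zero_pow hD i).smul ((i.factorial : k)⁻¹)
        rw [smul_zero] at h6
        exact eqBelow_zero_mul (N := 0) h6 fun n hn => absurd hn (by omega)
      have h4 : EqBelow j ((j.factorial : k)⁻¹ • (-D) ^ j) 0 := by
        simpa using (eqBelow_zero_pow hD' j).smul ((j.factorial : k)⁻¹)
      exact eqBelow_zero_mul h3 h4 n (by omega))
  -- Here `coeff_expSeries_conj` is used over the ring `A⟦X⟧`, with `n` the degree in the auxiliary
  -- variable.
  have h5 : ∀ n, ∑ p ∈ antidiagonal n, ((p.1.factorial : k)⁻¹ • D ^ p.1) * h *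
      ((p.2.factorial : k)⁻¹ • (-D) ^ p.2) = ((n.factorial : k)⁻¹ • (ad D)^[n] h) := by
    intro n
    rw [← coeff_expSeries_conj k D h n, coeff_mul]
    simp [expSeries]
  simp only [h5] at h2
  rw [← sum_mul] at h2
  intro n hn
  have := h2 n hn
  rw [map_sub, map_zero, sub_eq_zero] at this
  exact this.symm

/-- This is the conjugation formula for `h = 1`, where every bracket vanishes. -/
theorem expS_mul_expS_neg {D : A⟦X⟧} (hD : coeff 0 D = 0) :
    expS k D * expS k (-D) = 1 := by
  ext n
  have h1 := eqBelow_expS_conj k hD 1 (n + 1) n (by omega)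
  rw [mul_one] at h1
  rw [h1, sum_range_succ', sum_eq_zero fun j _ => ?_]
  · simp
  · have h2 : ∀ j, (ad D)^[j + 1] 1 = 0 := by
      intro j
      induction j with
      | zero => simp [ad]
      | succ j ih => rw [Function.iterate_succ_apply', ih]; simp [ad]
    rw [h2, smul_zero]

theorem expS_neg_mul_expS {D : A⟦X⟧} (hD : coeff 0 D = 0) :
    expS k (-D) * expS k D = 1 := by
  simpa using expS_mul_expS_neg k (D := -D) (by rw [map_neg, hD, neg_zero])

theorem dz_expS_neg {D : A⟦X⟧} (hD : coeff 0 D = 0) (h : Commute (dz D) D) :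
    dz (expS k (-D)) = -(expS k (-D) * dz D) := by
  have h' : Commute (dz (-D)) (-D) := by rw [map_neg]; exact h.neg_left.neg_right
  have hD' : coeff 0 (-D) = 0 := by rw [map_neg, hD, neg_zero]
  rw [dz_expS k hD' h', map_neg, neg_mul, (commute_expS k hD' h.neg_right).eq]

theorem dz_conj {D E E' : A⟦X⟧} (hE : dz E = dz D * E) (hE' : dz E' = -(E' * dz D)) (Y : A⟦X⟧) :
    dz (E * Y * E') = dz D * (E * Y * E') + E * dz Y * E' - E * Y * E' * dz D := by
  rw [dz_mul, dz_mul, hE, hE', mul_neg, add_mul]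
  simp only [mul_assoc]
  abel

end FormalExp

/-! ### The algebra of supercommuting series, its derivations and their constant parts. -/

section SeriesAlgebra

variable {B : Type*} [LinearOrder B] {k C : Type*} [Field k] [Ring C] [Algebra k C]
  {p : B → ZMod 2} (S : Coeff k C)

theorem zmod_two_cases (s : ZMod 2) : s = 0 ∨ s = 1 := by
  revert s; decide

theorem Coeff.parityAut_of_mem {t : ZMod 2} {c : C} (hc : c ∈ S.gr t) :
    S.parityAut c = (-1 : ℤˣ) ^ t • c := by
  rcases zmod_two_cases t with rfl | rfl
  · have h1 : Submodule.projection (S.gr 0) (S.gr 1) S.isCompl c = c :=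
      Submodule.projection_apply_of_mem_left S.isCompl hc
    have h2 : Submodule.projection (S.gr 1) (S.gr 0) S.isCompl.symm c = 0 :=
      Submodule.projection_apply_of_mem_right S.isCompl.symm hc
    simp [Coeff.parityAut, h1, h2]
  · have h1 : Submodule.projection (S.gr 0) (S.gr 1) S.isCompl c = 0 :=
      Submodule.projection_apply_of_mem_right S.isCompl hc
    have h2 : Submodule.projection (S.gr 1) (S.gr 0) S.isCompl.symm c = c :=
      Submodule.projection_apply_of_mem_left S.isCompl.symm hc
    simp [Coeff.parityAut, h1, h2]

/-- `Coeff.twist` as a linear map. -/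
noncomputable def Coeff.twistLin (s : ZMod 2) : C →ₗ[k] C :=
  if s = 0 then LinearMap.id else S.parityAut

theorem Coeff.twist_eq (s : ZMod 2) (c : C) : S.twist s c = S.twistLin s c := by
  unfold Coeff.twist Coeff.twistLin; split_ifs <;> rfl

theorem Coeff.twist_of_mem (s : ZMod 2) {t : ZMod 2} {c : C} (hc : c ∈ S.gr t) :
    S.twist s c = (-1 : ℤˣ) ^ (s * t) • c := by
  rcases zmod_two_cases s with rfl | rfl
  · simp [Coeff.twist]
  · simp [Coeff.twist, S.parityAut_of_mem hc]

@[simp] theorem Coeff.twist_zero_left (c : C) : S.twist 0 c = c := by simp [Coeff.twist]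

@[simp] theorem Coeff.twist_zero (s : ZMod 2) : S.twist s 0 = 0 := by simp [S.twist_eq]

theorem Coeff.twist_one (h1 : (1 : C) ∈ S.gr 0) (s : ZMod 2) : S.twist s 1 = 1 := by
  rw [S.twist_of_mem s h1]; simp

theorem units_smul_map {M N : Type*} [AddCommGroup M] [AddCommGroup N] [Module k M] [Module k N]
    (D : M →ₗ[k] N) (u : ℤˣ) (x : M) : D (u • x) = u • D x := by
  simp only [Units.smul_def, map_zsmul]

theorem units_smul_mem {M : Type*} [AddCommGroup M] [Module k M] (P : Submodule k M) (u : ℤˣ)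
    {x : M} (hx : x ∈ P) : u • x ∈ P := by
  rw [Units.smul_def]; exact zsmul_mem hx _

theorem Coeff.exists_add (c : C) : ∃ a ∈ S.gr 0, ∃ b ∈ S.gr 1, a + b = c :=
  Submodule.mem_sup.mp (S.isCompl.codisjoint.eq_top.ge (Submodule.mem_top (x := c)))

/-- The product of formal power series as a bilinear map. -/
noncomputable def Ser.mulLin (S : Coeff k C) : Ser p C →ₗ[k] Ser p C →ₗ[k] Ser p C :=
  LinearMap.mk₂ k (Ser.mul S)
    (fun f f' g => by
      funext ν
      simp only [Ser.mul, Pi.add_apply, add_mul, smul_add, sum_add_distrib])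
    (fun c f g => by
      funext ν
      simp only [Ser.mul, Pi.smul_apply, smul_mul_assoc, smul_sum]
      exact sum_congr rfl fun _ _ => smul_comm _ _ _)
    (fun f g g' => by
      funext ν
      simp only [Ser.mul, Pi.add_apply, S.twist_eq, map_add, mul_add, smul_add, sum_add_distrib])
    (fun c f g => by
      funext ν
      simp only [Ser.mul, Pi.smul_apply, S.twist_eq, map_smul, mul_smul_comm, smul_sum]
      exact sum_congr rfl fun _ _ => smul_comm _ _ _)

theorem Ser.add_mul (f f' g : Ser p C) :
    Ser.mul S (f + f') g = Ser.mul S f g + Ser.mul S f' g :=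
  LinearMap.map_add₂ (Ser.mulLin S) f f' g

theorem Ser.mul_add (f g g' : Ser p C) :
    Ser.mul S f (g + g') = Ser.mul S f g + Ser.mul S f g' := map_add (Ser.mulLin S f) g g'

theorem Ser.sub_mul (f f' g : Ser p C) :
    Ser.mul S (f - f') g = Ser.mul S f g - Ser.mul S f' g :=
  LinearMap.map_sub₂ (Ser.mulLin S) f f' g

theorem Ser.mul_sub (f g g' : Ser p C) :
    Ser.mul S f (g - g') = Ser.mul S f g - Ser.mul S f g' := map_sub (Ser.mulLin S f) g g'

theorem Ser.zero_mul (g : Ser p C) : Ser.mul S 0 g = 0 := LinearMap.map_zero₂ (Ser.mulLin S) g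

theorem Ser.mul_zero (f : Ser p C) : Ser.mul S f 0 = 0 := map_zero (Ser.mulLin S f)

theorem Ser.smul_mul (c : k) (f g : Ser p C) : Ser.mul S (c • f) g = c • Ser.mul S f g :=
  LinearMap.map_smul₂ (Ser.mulLin S) c f g

theorem Ser.mul_smul (c : k) (f g : Ser p C) : Ser.mul S f (c • g) = c • Ser.mul S f g :=
  map_smul (Ser.mulLin S f) c g

theorem Ser.units_smul_mul (u : ℤˣ) (f g : Ser p C) :
    Ser.mul S (u • f) g = u • Ser.mul S f g :=
  units_smul_map ((Ser.mulLin S).flip g) u f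

theorem Ser.mul_units_smul (u : ℤˣ) (f g : Ser p C) :
    Ser.mul S f (u • g) = u • Ser.mul S f g :=
  units_smul_map (Ser.mulLin S f) u g

theorem Ser.mul_apply_one (f g : Ser p C) :
    Ser.mul S f g (Mono.one p) = f (Mono.one p) * g (Mono.one p) := by
  have h : (HasAntidiagonal.antidiagonal (0 : B →₀ ℕ)) = {(0, 0)} := by
    ext x; simp [Prod.ext_iff]
  unfold Ser.mul
  rw [sum_eq_single ⟨((0 : B →₀ ℕ), (0 : B →₀ ℕ)), by simp [Mono.one]⟩]
  · simp [koszulExp, monoParity, Mono.one]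
  · rintro ⟨x, hx⟩ _ hne
    refine absurd (Subtype.ext ?_) hne
    simpa [Mono.one, h] using hx
  · intro h; exact absurd (mem_attach _ _) h

theorem Ser.monomial_one_mul (c : C) (g : Ser p C) :
    Ser.mul S (Ser.monomial (Mono.one p) c) g = fun ν => c * g ν := by
  funext ν
  unfold Ser.mul
  rw [sum_eq_single ⟨((0 : B →₀ ℕ), ν.1), by simp⟩]
  · have : (Ser.monomial (Mono.one p) c) ⟨0, ν.2.of_le (by simp)⟩ = c := Pi.single_eq_same _ _
    simp [koszulExp, monoParity, this]
  · rintro ⟨⟨α, β⟩, hx⟩ _ hne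
    have h0 : α ≠ 0 := by
      rintro rfl
      refine hne (Subtype.ext (Prod.ext rfl ?_))
      simpa using hx
    have : (Ser.monomial (Mono.one p) c) ⟨α, ν.2.of_le (HasAntidiagonal.antidiagonal.fst_le hx)⟩ = 0 :=
      Pi.single_eq_of_ne (fun h => h0 (congrArg Subtype.val h)) _
    simp [this]
  · intro h; exact absurd (mem_attach _ _) h

theorem Ser.monomial_eq (ν : Mono p) (c : C) :
    (Ser.monomial ν c : Ser p C) = fun κ => c * (Ser.monomial ν 1 : Ser p C) κ := by
  funext κ
  by_cases h : κ = ν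
  · subst h; simp [Ser.monomial]
  · simp [Ser.monomial, h]

/-- Dividing a nonconstant monomial by a variable. -/
noncomputable def Mono.erase (ν : Mono p) (i : B) : Mono p :=
  ⟨ν.1 - Finsupp.single i 1, ν.2.of_le tsub_le_self⟩

/-- Splitting off the smallest variable on the left costs no sign, since the Koszul exponent counts
only variables of the right factor that are strictly smaller than one on the left. -/
theorem Ser.X_mul_monomial (h1 : (1 : C) ∈ S.gr 0) {ν : Mono p} {i : B} (hi : i ∈ ν.1.support)
    (hmin : ∀ j ∈ ν.1.support, i ≤ j) :
    Ser.mul S (Ser.X C i) (Ser.monomial (ν.erase i) 1) = Ser.monomial ν 1 := by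
  have hsum : Finsupp.single i 1 + (ν.erase i).1 = ν.1 :=
    add_tsub_cancel_of_le (by
      rw [Finsupp.single_le_iff]; exact Nat.one_le_iff_ne_zero.mpr (Finsupp.mem_support_iff.mp hi))
  have hk : koszulExp p (Finsupp.single i 1) (ν.erase i).1 = 0 := by
    unfold koszulExp
    rw [Finsupp.sum_single_index]
    · refine sum_eq_zero fun j hj => if_neg (not_lt.mpr (hmin j ?_))
      rw [Finsupp.mem_support_iff] at hj ⊢
      intro h0
      refine hj ?_
      simp [Mono.erase, h0]
    · simp [Finsupp.sum]
  funext κ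
  by_cases hκ : κ = ν
  · subst hκ
    unfold Ser.mul
    rw [sum_eq_single ⟨(Finsupp.single i 1, (κ.erase i).1), by simpa using hsum⟩]
    · have e1 : (Ser.X C i : Ser p C) (Mono.var p i) = 1 := Pi.single_eq_same _ _
      have e2 : (Ser.monomial (κ.erase i) 1 : Ser p C) (κ.erase i) = 1 := Pi.single_eq_same _ _
      have e3 : (Ser.monomial κ 1 : Ser p C) κ = 1 := Pi.single_eq_same _ _
      rw [e3]
      simp only [hk, uzpow_zero, one_smul]
      erw [e1, e2]
      rw [S.twist_one h1, mul_one]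
    · rintro ⟨⟨α, β⟩, hx⟩ _ hne
      by_cases hα : α = Finsupp.single i 1
      · have hβ : β ≠ (κ.erase i).1 := by
          rintro rfl; exact hne (Subtype.ext (Prod.ext hα rfl))
        have : (Ser.monomial (κ.erase i) 1 : Ser p C)
            ⟨β, κ.2.of_le (HasAntidiagonal.antidiagonal.snd_le hx)⟩ = 0 :=
          Pi.single_eq_of_ne (fun h => hβ (congrArg Subtype.val h)) _
        simp [this]
      · have : (Ser.X C i : Ser p C)
            ⟨α, κ.2.of_le (HasAntidiagonal.antidiagonal.fst_le hx)⟩ = 0 :=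
          Pi.single_eq_of_ne (fun h => hα (congrArg Subtype.val h)) _
        simp [this]
    · intro h; exact absurd (mem_attach _ _) h
  · have e3 : (Ser.monomial ν 1 : Ser p C) κ = 0 := Pi.single_eq_of_ne hκ _
    rw [e3]
    unfold Ser.mul
    refine sum_eq_zero ?_
    rintro ⟨⟨α, β⟩, hx⟩ _
    by_cases hα : α = Finsupp.single i 1
    · have hβ : β ≠ (ν.erase i).1 := by
        rintro rfl
        refine hκ (Subtype.ext ?_)
        rw [← hsum, ← hα]
        exact (HasAntidiagonal.mem_antidiagonal.mp hx).symm
      have : (Ser.monomial (ν.erase i) 1 : Ser p C)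
          ⟨β, κ.2.of_le (HasAntidiagonal.antidiagonal.snd_le hx)⟩ = 0 :=
        Pi.single_eq_of_ne (fun h => hβ (congrArg Subtype.val h)) _
      simp [this]
    · have : (Ser.X C i : Ser p C)
          ⟨α, κ.2.of_le (HasAntidiagonal.antidiagonal.fst_le hx)⟩ = 0 :=
        Pi.single_eq_of_ne (fun h => hα (congrArg Subtype.val h)) _
      simp [this]

/-- Induction on the degree that always strips the smallest variable, so that `Ser.X_mul_monomial`
and the Leibniz rule apply at each step. -/
theorem Mono.induction {P : Mono p → Prop} (one : P (Mono.one p))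
    (step : ∀ (ν : Mono p) (i : B), i ∈ ν.1.support → (∀ j ∈ ν.1.support, i ≤ j) →
      P (ν.erase i) → P ν) (ν : Mono p) : P ν := by
  induction h : ν.1.degree using Nat.strong_induction_on generalizing ν with
  | _ n ih =>
    by_cases h0 : ν.1 = 0
    · have : ν = Mono.one p := Subtype.ext h0
      rw [this]; exact one
    · have hne : ν.1.support.Nonempty := Finsupp.support_nonempty_iff.mpr h0
      refine step ν (ν.1.support.min' hne) (min'_mem _ _) (fun j hj => min'_le _ _ hj) ?_
      refine ih _ ?_ _ rfl
      have hi := min'_mem ν.1.support hne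
      set i := ν.1.support.min' hne
      have hsum : (ν.erase i).1 + Finsupp.single i 1 = ν.1 :=
        tsub_add_cancel_of_le (by
          rw [Finsupp.single_le_iff]
          exact Nat.one_le_iff_ne_zero.mpr (Finsupp.mem_support_iff.mp hi))
      rw [← h, ← hsum, map_add, Finsupp.degree_single]
      omega

/-! ### Derivations -/

theorem Ser.isHomogeneous_X (h1 : (1 : C) ∈ S.gr 0) (i : B) :
    Ser.IsHomogeneous S (p i) (Ser.X C i : Ser p C) := by
  intro ν
  by_cases h : ν = Mono.var p i
  · subst h
    have : (Ser.X C i : Ser p C) (Mono.var p i) = 1 := Pi.single_eq_same _ _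
    rw [this]
    have h2 : monoParity p (Mono.var p i).1 = p i := by
      simp [monoParity, Mono.var]
    rw [h2, CharTwo.add_self_eq_zero]
    exact h1
  · have : (Ser.X C i : Ser p C) ν = 0 := Pi.single_eq_of_ne h _
    rw [this]; exact zero_mem _

/-- A homogeneous operator satisfying the Leibniz rule which is linear over the coefficients up to
an operator `δ` on the coefficients. -/
structure IsDifferential (S : Coeff k C) (s : ZMod 2) (δ : C → C)
    (D : Ser p C →ₗ[k] Ser p C) : Prop where
  parity : ∀ t f, Ser.IsHomogeneous S t f → Ser.IsHomogeneous S (s + t) (D f)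
  leibniz : ∀ t f g, Ser.IsHomogeneous S t f →
    D (Ser.mul S f g) = Ser.mul S (D f) g + (-1 : ℤˣ) ^ (s * t) • Ser.mul S f (D g)
  linear : ∀ t, ∀ c ∈ S.gr t, ∀ f : Ser p C,
    D (fun ν => c * f ν) = (fun ν => δ c * f ν) + (-1 : ℤˣ) ^ (s * t) • fun ν => c * D f ν

variable {S} {s : ZMod 2}

theorem IsDerivation.isDifferential {D : Ser p C →ₗ[k] Ser p C} (h : IsDerivation S s D) :
    IsDifferential S s (fun _ => 0) D where
  parity := h.parity
  leibniz := h.leibniz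
  linear t c hc f := by
    rw [h.linear t c hc f]
    funext ν
    simp

theorem IsDerivation.apply_mul {D : Ser p C →ₗ[k] Ser p C} (h : IsDerivation S 0 D) (c : C)
    (f : Ser p C) : D (fun ν => c * f ν) = fun ν => c * D f ν := by
  obtain ⟨a, ha, b, hb, rfl⟩ := S.exists_add c
  have : (fun ν => (a + b) * f ν) = (fun ν => a * f ν) + fun ν => b * f ν := by
    funext ν; simp [_root_.add_mul]
  rw [this, map_add, h.linear 0 a ha f, h.linear 1 b hb f]
  funext ν
  simp [_root_.add_mul]

theorem IsDerivation.leibniz_even {D : Ser p C →ₗ[k] Ser p C} (h : IsDerivation S 0 D)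
    {t : ZMod 2} {f : Ser p C} (hf : Ser.IsHomogeneous S t f) (g : Ser p C) :
    D (Ser.mul S f g) = Ser.mul S (D f) g + Ser.mul S f (D g) := by
  rw [h.leibniz t f g hf]; simp

/-- `D₁` need not be `C`-linear, but since `D₂` is even and `C`-linear the two terms with `δ c`
cancel. Hence `[d_A + m^A, D₂]` is an honest derivation. Continuity is supplied separately because
`IsDifferential` does not contain it. -/
theorem IsDifferential.commutator {δ : C → C} {D₁ D₂ : Module.End k (Ser p C)}
    (h₁ : IsDifferential S s δ D₁) (h₂ : IsDerivation S 0 D₂)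
    (hc : IsContinuousOp S (D₁ * D₂ - D₂ * D₁)) : IsDerivation S s (D₁ * D₂ - D₂ * D₁) where
  parity t f hf ν := by
    have e1 := h₁.parity _ _ (h₂.parity t f hf) ν
    have e2 := h₂.parity _ _ (h₁.parity t f hf) ν
    rw [zero_add] at e1 e2
    exact sub_mem e1 e2
  leibniz t f g hf := by
    have hf2 := h₂.parity t f hf
    have hf1 := h₁.parity t f hf
    rw [zero_add] at hf2
    simp only [LinearMap.sub_apply, Module.End.mul_apply]
    rw [h₂.leibniz_even hf, h₁.leibniz t f g hf, map_add, map_add, h₁.leibniz t _ _ hf2,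
      h₁.leibniz t _ _ hf, units_smul_map, h₂.leibniz_even hf1, h₂.leibniz_even hf,
      Ser.sub_mul, Ser.mul_sub, smul_sub, smul_add]
    abel
  linear t c hc f := by
    simp only [LinearMap.sub_apply, Module.End.mul_apply]
    rw [h₂.apply_mul, h₁.linear t c hc, h₁.linear t c hc, map_add, units_smul_map,
      h₂.apply_mul, h₂.apply_mul]
    funext ν
    simp only [Pi.add_apply, Pi.sub_apply, Pi.smul_apply, _root_.mul_sub, smul_sub]
    abel
  continuous := hc

theorem IsDerivation.monomial_eq_zero (h1 : (1 : C) ∈ S.gr 0) {D : Ser p C →ₗ[k] Ser p C}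
    (h : IsDerivation S s D) (hX : ∀ i, D (Ser.X C i) = 0)
    (hone : D (Ser.monomial (Mono.one p) 1) = 0) (ν : Mono p) :
    D (Ser.monomial ν 1) = 0 := by
  induction ν using Mono.induction with
  | one => exact hone
  | step ν i hi hmin ih =>
    rw [← Ser.X_mul_monomial S h1 hi hmin, h.leibniz _ _ _ (Ser.isHomogeneous_X S h1 i), hX, ih,
      Ser.zero_mul, Ser.mul_zero, smul_zero, add_zero]

theorem Ser.X_apply_one (i : B) : (Ser.X C i : Ser p C) (Mono.one p) = 0 := by
  refine Pi.single_eq_of_ne (fun h => ?_) _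
  have := DFunLike.congr_fun (congrArg Subtype.val h) i
  simp [Mono.one, Mono.var] at this

/-- Write the monomial as `x_i` times another one. At the origin both Leibniz terms contain a
vanishing factor, `D(x_i)(0)` or `x_i(0)`. -/
theorem IsDerivation.monomial_apply_one (h1 : (1 : C) ∈ S.gr 0) {D : Ser p C →ₗ[k] Ser p C}
    (h : IsDerivation S s D) (hX : NoConstantTerm D) {ν : Mono p} (hν : ν ≠ Mono.one p) :
    D (Ser.monomial ν 1) (Mono.one p) = 0 := by
  have h0 : ν.1 ≠ 0 := fun h => hν (Subtype.ext h)
  have hne : ν.1.support.Nonempty := Finsupp.support_nonempty_iff.mpr h0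
  rw [← Ser.X_mul_monomial S h1 (min'_mem _ hne) (fun j hj => min'_le _ _ hj),
    h.leibniz _ _ _ (Ser.isHomogeneous_X S h1 _), Pi.add_apply, Pi.smul_apply,
    Ser.mul_apply_one, Ser.mul_apply_one, hX, Ser.X_apply_one, MulZeroClass.zero_mul,
    MulZeroClass.zero_mul, smul_zero, add_zero]

/-! ### The constant part of a derivation -/

/-- The homogeneous component of degree `d` of a series. -/
noncomputable def Ser.component (d : ℕ) : Ser p C →ₗ[k] Ser p C where
  toFun f ν := if ν.1.degree = d then f ν else 0
  map_add' f g := by funext ν; simp only [Pi.add_apply]; split_ifs <;> simp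
  map_smul' c f := by funext ν; simp only [Pi.smul_apply, RingHom.id_apply]; split_ifs <;> simp

theorem Ser.component_apply (d : ℕ) (f : Ser p C) (ν : Mono p) :
    Ser.component (k := k) d f ν = if ν.1.degree = d then f ν else 0 := rfl

variable (S) in
theorem Ser.component_mul (d : ℕ) (f g : Ser p C) :
    Ser.component (k := k) d (Ser.mul S f g) =
      ∑ a ∈ range (d + 1), Ser.mul S (Ser.component (k := k) a f)
        (Ser.component (k := k) (d - a) g) := by
  funext ν
  rw [Finset.sum_apply, Ser.component_apply]
  unfold Ser.mul
  rw [sum_comm]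
  split_ifs with hν
  · refine sum_congr rfl fun x _ => ?_
    have hx : x.1.1.degree + x.1.2.degree = d := by
      rw [← map_add, HasAntidiagonal.mem_antidiagonal.mp x.2, hν]
    rw [sum_eq_single x.1.1.degree]
    · rw [Ser.component_apply, Ser.component_apply, if_pos rfl, if_pos (by simp; omega)]
    · intro a _ ha
      rw [Ser.component_apply, if_neg (fun h => ha h.symm)]; simp
    · intro ha; simp at ha; omega
  · symm
    refine sum_eq_zero fun x _ => sum_eq_zero fun a ha => ?_
    have hx : x.1.1.degree + x.1.2.degree ≠ d := by
      rw [← map_add, HasAntidiagonal.mem_antidiagonal.mp x.2]; exact hν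
    rw [Ser.component_apply, Ser.component_apply]
    by_cases h : x.1.1.degree = a
    · rw [if_neg (c := Finsupp.degree _ = d - a) (by simp at ha ⊢; omega)]; simp
    · rw [if_neg h]; simp

/-- The constant part of an operator, of degree `-1` for the grading of series by degree. -/
noncomputable def constPart : Module.End k (Ser p C) →ₗ[k] Module.End k (Ser p C) where
  toFun D :=
    { toFun := fun f ν => D (Ser.component (k := k) (ν.1.degree + 1) f) ν
      map_add' := fun f g => by funext ν; simp
      map_smul' := fun c f => by funext ν; simp }
  map_add' D D' := rfl
  map_smul' c D := rfl

theorem constPart_apply (D : Module.End k (Ser p C)) (f : Ser p C) (ν : Mono p) :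
    constPart D f ν = D (Ser.component (k := k) (ν.1.degree + 1) f) ν := rfl

theorem component_component (d e : ℕ) (f : Ser p C) :
    Ser.component (k := k) d (Ser.component (k := k) e f) =
      if d = e then Ser.component (k := k) d f else 0 := by
  funext ν
  simp only [Ser.component_apply]
  split_ifs with h1 h2 h3 h4
  · rw [Ser.component_apply, if_pos h1]
  · omega
  · omega
  · rfl
  · rw [Ser.component_apply, if_neg h1]
  · rfl

theorem constPart_constPart (D : Module.End k (Ser p C)) :
    constPart (constPart D) = constPart D := by
  ext f ν
  simp [constPart_apply, component_component]

theorem Ser.IsHomogeneous.component {t : ZMod 2} {f : Ser p C} (hf : Ser.IsHomogeneous S t f)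
    (d : ℕ) : Ser.IsHomogeneous S t (Ser.component (k := k) d f) := fun ν => by
  rw [Ser.component_apply]; split_ifs
  · exact hf ν
  · exact zero_mem _

/-- The product respects the degree of monomials, so each homogeneous piece of a derivation is a
derivation. This is the piece of degree `-1`. -/
theorem IsDerivation.constPart {D : Module.End k (Ser p C)} (h : IsDerivation S s D) :
    IsDerivation S s (constPart D) where
  parity t f hf ν := h.parity t _ (hf.component _) ν
  leibniz t f g hf := by
    funext ν
    rw [constPart_apply, Ser.component_mul S, map_sum,
      sum_congr rfl fun a _ => h.leibniz t _ _ (hf.component a), Finset.sum_apply, Pi.add_apply,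
      Pi.smul_apply]
    simp only [Pi.add_apply, Pi.smul_apply]
    rw [sum_add_distrib, ← smul_sum]
    unfold Ser.mul
    congr 1
    · rw [sum_comm]
      refine sum_congr rfl fun x _ => ?_
      have hx : x.1.1.degree + x.1.2.degree = ν.1.degree := by
        rw [← map_add, HasAntidiagonal.mem_antidiagonal.mp x.2]
      -- When the left factor is differentiated it loses one degree, so its original degree is one
      -- more than that of the resulting monomial. In the second summand the left factor keeps its
      -- degree.
      rw [sum_eq_single (x.1.1.degree + 1)]
      · rw [Ser.component_apply (ν.1.degree + 1 - _), if_pos (by simp; omega)]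
        rfl
      · intro a ha hne
        rw [Ser.component_apply (ν.1.degree + 1 - _), if_neg (by simp at ha ⊢; omega)]; simp
      · intro ha; simp at ha; omega
    · congr 1
      rw [sum_comm]
      refine sum_congr rfl fun x _ => ?_
      have hx : x.1.1.degree + x.1.2.degree = ν.1.degree := by
        rw [← map_add, HasAntidiagonal.mem_antidiagonal.mp x.2]
      rw [sum_eq_single x.1.1.degree]
      · rw [Ser.component_apply x.1.1.degree, if_pos rfl, constPart_apply,
          show ν.1.degree + 1 - x.1.1.degree = x.1.2.degree + 1 by omega]
      · intro a ha hne
        rw [Ser.component_apply a, if_neg (fun h => hne h.symm)]; simp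
      · intro ha; simp at ha; omega
  linear t c hc f := by
    funext ν
    have : Ser.component (k := k) (ν.1.degree + 1) (fun ν => c * f ν) =
        fun κ => c * Ser.component (k := k) (ν.1.degree + 1) f κ := by
      funext κ; simp only [Ser.component_apply]; split_ifs <;> simp
    rw [constPart_apply, this, h.linear t c hc]
    rfl
  continuous ν I hI := by
    obtain ⟨J, hJ, T, hT⟩ := h.continuous ν I hI
    refine ⟨J, hJ, T, fun f hf => hT _ fun α hα => ?_⟩
    rw [Ser.component_apply]; split_ifs
    · exact hf α hα
    · exact zero_mem _

end SeriesAlgebra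

/-! ### Open ideals, uniformly continuous operators, and evaluation of operator series at `z = 1`.
-/

section Topology

variable {k R : Type*} [Field k] [NonUnitalRing R] [Module k R]
  [IsScalarTower k R R] [SMulCommClass k R R] {B : Type*} [LinearOrder B]

/-- A subspace of `A₊` as a subspace of `A = k ⊕ A₊`. -/
abbrev bar (I : Submodule k R) : Submodule k (Unitization k R) :=
  I.map (Unitization.inrHom k k R)

theorem fst_sub (c d : Unitization k R) : (c - d).fst = c.fst - d.fst := by
  rw [sub_eq_add_neg, Unitization.fst_add, Unitization.fst_neg, ← sub_eq_add_neg]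

theorem snd_sub (c d : Unitization k R) : (c - d).snd = c.snd - d.snd := by
  rw [sub_eq_add_neg, Unitization.snd_add, Unitization.snd_neg, ← sub_eq_add_neg]

theorem mem_bar {I : Submodule k R} {c : Unitization k R} :
    c ∈ bar I ↔ c.fst = 0 ∧ c.snd ∈ I := by
  constructor
  · rintro ⟨r, hr, rfl⟩
    exact ⟨rfl, hr⟩
  · rintro ⟨h, h'⟩
    exact ⟨c.snd, h', by ext <;> simp [h]⟩

theorem bar_mono {I J : Submodule k R} (h : I ≤ J) : bar I ≤ bar J := Submodule.map_mono h

theorem mul_mem_bar_of_mem {I J K : Submodule k R} (h : ∀ a ∈ I, ∀ b ∈ J, a * b ∈ K)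
    {c d : Unitization k R} (hc : c ∈ bar I) (hd : d ∈ bar J) : c * d ∈ bar K := by
  rw [mem_bar] at *
  simp only [Unitization.fst_mul, Unitization.snd_mul, hc.1, hd.1, zero_mul, zero_smul, zero_add]
  exact ⟨trivial, h _ hc.2 _ hd.2⟩

variable (F : FormalCDGA k R) {p : B → ZMod 2}

theorem mul_mem_bar {I : Submodule k R} (hI : I ∈ F.opens) (a : Unitization k R)
    {c : Unitization k R} (hc : c ∈ bar I) : a * c ∈ bar I := by
  rw [mem_bar] at *
  simp only [Unitization.fst_mul, Unitization.snd_mul, hc.1, mul_zero, zero_smul, add_zero]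
  exact ⟨trivial, add_mem (I.smul_mem _ hc.2) (F.mul_mem_left I hI _ _ hc.2)⟩

theorem mem_bar_mul {I : Submodule k R} (hI : I ∈ F.opens) (a : Unitization k R)
    {c : Unitization k R} (hc : c ∈ bar I) : c * a ∈ bar I := by
  rw [mem_bar] at *
  simp only [Unitization.fst_mul, Unitization.snd_mul, hc.1, zero_mul, zero_smul, zero_add]
  exact ⟨trivial, add_mem (I.smul_mem _ hc.2) (F.mul_mem_right I hI _ _ hc.2)⟩

theorem mem_unital_gr_zero {c : Unitization k R} :
    c ∈ F.unital.gr 0 ↔ c.snd ∈ F.gr 0 := by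
  simp [FormalCDGA.unital]

theorem mem_unital_gr_one {c : Unitization k R} :
    c ∈ F.unital.gr 1 ↔ c.fst = 0 ∧ c.snd ∈ F.gr 1 := by
  have : F.unital.gr 1 = bar (F.gr 1) := by simp [FormalCDGA.unital]
  rw [this, mem_bar]

theorem one_mem_unital_gr : (1 : Unitization k R) ∈ F.unital.gr 0 := by
  rw [mem_unital_gr_zero]; simp

theorem snd_mem_of_mem_unital_gr {s : ZMod 2} {c : Unitization k R} (hc : c ∈ F.unital.gr s) :
    c.snd ∈ F.gr s := by
  rcases zmod_two_cases s with rfl | rfl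
  · exact (mem_unital_gr_zero F).mp hc
  · exact ((mem_unital_gr_one F).mp hc).2

theorem inr_mem_unital_gr {s : ZMod 2} {r : R} (hr : r ∈ F.gr s) :
    (Unitization.inr r : Unitization k R) ∈ F.unital.gr s := by
  rcases zmod_two_cases s with rfl | rfl
  · exact (mem_unital_gr_zero F).mpr hr
  · exact (mem_unital_gr_one F).mpr ⟨rfl, hr⟩

theorem mem_bar_of_add_mem_bar {I : Submodule k R} (hI : I ∈ F.opens) {a b : Unitization k R}
    (ha : a ∈ F.unital.gr 0) (hb : b ∈ F.unital.gr 1) (h : a + b ∈ bar I) :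
    a ∈ bar I ∧ b ∈ bar I := by
  rw [mem_unital_gr_zero] at ha
  rw [mem_unital_gr_one] at hb
  rw [mem_bar] at h
  have := F.homogeneous I hI _ ha _ hb.2 h.2
  rw [mem_bar, mem_bar]
  refine ⟨⟨?_, this.1⟩, hb.1, this.2⟩
  simpa [hb.1] using h.1

theorem twist_mem_bar {I : Submodule k R} (hI : I ∈ F.opens) (s : ZMod 2) {c : Unitization k R}
    (hc : c ∈ bar I) : F.unital.twist s c ∈ bar I := by
  obtain ⟨a, ha, b, hb, rfl⟩ := F.unital.exists_add c
  obtain ⟨h1, h2⟩ := mem_bar_of_add_mem_bar F hI ha hb hc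
  rw [F.unital.twist_eq, map_add, ← F.unital.twist_eq, ← F.unital.twist_eq,
    F.unital.twist_of_mem s ha, F.unital.twist_of_mem s hb]
  exact add_mem (units_smul_mem _ _ h1) (units_smul_mem _ _ h2)

theorem parityAut_mem_bar {I : Submodule k R} (hI : I ∈ F.opens) {c : Unitization k R}
    (hc : c ∈ bar I) : F.unital.parityAut c ∈ bar I := by
  simpa [Coeff.twist] using twist_mem_bar F hI 1 hc

theorem eq_zero_of_mem_bar {c : Unitization k R} (h : ∀ I ∈ F.opens, c ∈ bar I) : c = 0 := by
  obtain ⟨I, hI⟩ := F.opens_nonempty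
  ext
  · exact (mem_bar.mp (h I hI)).1
  · exact F.separated _ fun J hJ => (mem_bar.mp (h J hJ)).2

/-- The graded pieces are closed: open ideals are homogeneous, so the component of the wrong parity
lies in all of them and vanishes by separatedness. -/
theorem mem_unital_gr_of_approx {s : ZMod 2} {c : Unitization k R}
    (h : ∀ I ∈ F.opens, ∃ g ∈ F.unital.gr s, g - c ∈ bar I) : c ∈ F.unital.gr s := by
  obtain ⟨a, ha, b, hb, rfl⟩ := F.unital.exists_add c
  rcases zmod_two_cases s with rfl | rfl
  · have : b = 0 := eq_zero_of_mem_bar F fun I hI => by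
      obtain ⟨g, hg, hgI⟩ := h I hI
      have e : g - (a + b) = (g - a) + (-b) := by abel
      rw [e] at hgI
      simpa using (mem_bar_of_add_mem_bar F hI (sub_mem hg ha) (neg_mem hb) hgI).2
    rw [this, add_zero]; exact ha
  · have : a = 0 := eq_zero_of_mem_bar F fun I hI => by
      obtain ⟨g, hg, hgI⟩ := h I hI
      have e : g - (a + b) = (-a) + (g - b) := by abel
      rw [e] at hgI
      simpa using (mem_bar_of_add_mem_bar F hI (neg_mem ha) (sub_mem hg hb) hgI).1
    rw [this, zero_add]; exact hb

/-- The operators with values in a subspace of `A₊`. -/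
def valued (p : B → ZMod 2) (I : Submodule k R) : Submodule k (Op k R p) where
  carrier := {D | IsValuedIn I D}
  zero_mem' := fun _ _ => zero_mem (bar I)
  add_mem' ha hb f ν := add_mem (ha f ν) (hb f ν)
  smul_mem' c _ ha f ν := (bar I).smul_mem c (ha f ν)

theorem mem_valued {I : Submodule k R} {D : Op k R p} : D ∈ valued p I ↔ ∀ f ν, D f ν ∈ bar I :=
  Iff.rfl

theorem valued_mono {I J : Submodule k R} (h : I ≤ J) : valued p I ≤ valued p J :=
  fun _ hD f ν => bar_mono h (hD f ν)

theorem mem_valued_top {D : Op k R p} : D ∈ valued p ⊤ ↔ ∀ f ν, (D f ν).fst = 0 := by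
  simp only [mem_valued, mem_bar, Submodule.mem_top, and_true]

/-- The algebra of operators which are continuous uniformly in the open ideals. -/
def strong (p : B → ZMod 2) : Subalgebra k (Op k R p) where
  carrier := {T | ∀ ν, ∀ I ∈ F.opens, ∃ s : Finset (Mono p), ∀ f : Ser p (Unitization k R),
    (∀ α ∈ s, f α ∈ bar I) → T f ν ∈ bar I}
  mul_mem' {T U} hT hU ν I hI := by
    classical
    obtain ⟨s, hs⟩ := hT ν I hI
    choose t ht using fun α => hU α I hI
    exact ⟨s.biUnion t, fun f hf => hs _ fun α hα => ht α f fun β hβ =>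
      hf β (mem_biUnion.mpr ⟨α, hα, hβ⟩)⟩
  add_mem' {T U} hT hU ν I hI := by
    classical
    obtain ⟨s, hs⟩ := hT ν I hI
    obtain ⟨t, ht⟩ := hU ν I hI
    exact ⟨s ∪ t, fun f hf => add_mem (hs f fun α hα => hf α (mem_union_left _ hα))
      (ht f fun α hα => hf α (mem_union_right _ hα))⟩
  algebraMap_mem' c ν I hI := ⟨{ν}, fun f hf => (bar I).smul_mem c (hf ν (mem_singleton_self ν))⟩

variable {F}

theorem strong.isContinuousOp {T : Op k R p} (hT : T ∈ strong F p) :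
    IsContinuousOp F.unital T := by
  rintro ν _ ⟨I, hI, rfl⟩
  obtain ⟨s, hs⟩ := hT ν I hI
  exact ⟨_, ⟨I, hI, rfl⟩, s, hs⟩

theorem strong.apply_mem {T : Op k R p} (hT : T ∈ strong F p) {I : Submodule k R}
    (hI : I ∈ F.opens) {f : Ser p (Unitization k R)} (hf : ∀ α, f α ∈ bar I) (ν : Mono p) :
    T f ν ∈ bar I := by
  obtain ⟨s, hs⟩ := hT ν I hI
  exact hs f fun α _ => hf α

theorem mul_mem_valued {T U : Op k R p} (hT : T ∈ strong F p) {I : Submodule k R}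
    (hI : I ∈ F.opens) (hU : U ∈ valued p I) : T * U ∈ valued p I :=
  fun f ν => strong.apply_mem hT hI (hU f) ν

theorem valued_mul_mem {T U : Op k R p} {I : Submodule k R} (hT : T ∈ valued p I) :
    T * U ∈ valued p I := fun f ν => hT (U f) ν

/-- The difference of a series and one of its partial sums. -/
theorem sub_sum_monomial_apply (f : Ser p (Unitization k R)) (s : Finset (Mono p)) {α : Mono p}
    (hα : α ∈ s) : (f - ∑ β ∈ s, Ser.monomial β (f β)) α = 0 := by
  classical
  rw [Pi.sub_apply, Finset.sum_apply, sum_eq_single α, Ser.monomial, Pi.single_eq_same, sub_self]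
  · intro β _ h
    exact Pi.single_eq_of_ne (fun e => h e.symm) _
  · exact fun h => absurd hα h

theorem apply_mem_of_monomials {T : Op k R p} (hT : IsContinuousOp F.unital T)
    {I J : Submodule k R} (hI : I ∈ F.opens) (hIJ : I ≤ J) {f : Ser p (Unitization k R)} {ν : Mono p}
    (h : ∀ α, T (Ser.monomial α (f α)) ν ∈ bar J) : T f ν ∈ bar J := by
  obtain ⟨_, _, s, hs⟩ := hT ν _ ⟨I, hI, rfl⟩
  have h1 := hs (f - ∑ β ∈ s, Ser.monomial β (f β)) fun α hα => by
    rw [sub_sum_monomial_apply f s hα]; exact zero_mem _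
  rw [map_sub, Pi.sub_apply, map_sum, Finset.sum_apply] at h1
  rw [← sub_add_cancel (T f ν) (∑ c ∈ s, T (Ser.monomial c (f c)) ν)]
  exact add_mem (bar_mono hIJ h1) (sum_mem fun α _ => h α)

/-- Monomials with homogeneous coefficients do not span the series, but by continuity they detect
equality. Operator identities below are checked in this way. -/
theorem ext_monomial {T U : Op k R p} (hT : T ∈ strong F p) (hU : U ∈ strong F p)
    (h : ∀ α t, ∀ c ∈ F.unital.gr t, T (Ser.monomial α c) = U (Ser.monomial α c)) : T = U := by
  have h' : ∀ α c, (T - U) (Ser.monomial α c) = 0 := fun α c => by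
    obtain ⟨a, ha, b, hb, rfl⟩ := F.unital.exists_add c
    have : (Ser.monomial α (a + b) : Ser p _) = Ser.monomial α a + Ser.monomial α b :=
      Pi.single_add _ _ _
    rw [this, map_add, LinearMap.sub_apply, LinearMap.sub_apply, h α 0 a ha, h α 1 b hb, sub_self,
      sub_self, add_zero]
  rw [← sub_eq_zero]
  ext f ν : 2
  exact eq_zero_of_mem_bar F fun I hI =>
    apply_mem_of_monomials (strong.isContinuousOp (sub_mem hT hU)) hI le_rfl fun α => by
      rw [h']; exact zero_mem _

theorem IsDerivation.apply_monomial_mem {s : ZMod 2} {D : Op k R p}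
    (h : IsDerivation F.unital s D) {I : Submodule k R} (α : Mono p)
    {c : Unitization k R} {ν : Mono p}
    (hc : ∀ a ∈ F.unital.gr 0, ∀ b ∈ F.unital.gr 1, a + b = c →
      a * D (Ser.monomial α 1) ν ∈ bar I ∧ b * D (Ser.monomial α 1) ν ∈ bar I) :
    D (Ser.monomial α c) ν ∈ bar I := by
  obtain ⟨a, ha, b, hb, rfl⟩ := F.unital.exists_add c
  obtain ⟨h1, h2⟩ := hc a ha b hb rfl
  have e : (Ser.monomial α (a + b) : Ser p _) = Ser.monomial α a + Ser.monomial α b :=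
    Pi.single_add _ _ _
  rw [e, Ser.monomial_eq α a, Ser.monomial_eq α b, map_add, h.linear _ a ha, h.linear _ b hb]
  exact add_mem (units_smul_mem _ _ h1) (units_smul_mem _ _ h2)

/-- Continuity alone allows the neighbourhood `J` of the input to depend on `I`. Subtracting
finitely many monomials makes the controlled coefficients zero, and on those monomials linearity
over `A` puts the value in the ideal `I`. -/
theorem IsDerivation.mem_strong {s : ZMod 2} {D : Op k R p} (h : IsDerivation F.unital s D) :
    D ∈ strong F p := by
  intro ν I hI
  obtain ⟨_, _, s, hs⟩ := h.continuous ν _ ⟨I, hI, rfl⟩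
  refine ⟨s, fun f hf => ?_⟩
  have h1 := hs (f - ∑ β ∈ s, Ser.monomial β (f β)) fun α hα => by
    rw [sub_sum_monomial_apply f s hα]; exact zero_mem _
  rw [map_sub, Pi.sub_apply, map_sum, Finset.sum_apply] at h1
  rw [← sub_add_cancel (D f ν) (∑ c ∈ s, D (Ser.monomial c (f c)) ν)]
  refine add_mem h1 (sum_mem fun α hα => h.apply_monomial_mem α ?_)
  intro a ha b hb hab
  have := mem_bar_of_add_mem_bar F hI ha hb (hab ▸ hf α hα)
  exact ⟨mem_bar_mul F hI _ this.1, mem_bar_mul F hI _ this.2⟩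

/-- Expanding `U f` in monomials, the outer derivation passes the coefficients through by linearity:
`T(c x^α) = c T(x^α)`. So composition multiplies the ideals of values, which is the source of
nilpotency. -/
theorem IsDerivation.mul_mem_valued {T U : Op k R p} (hT : IsDerivation F.unital 0 T)
    {I I₁ I₂ K : Submodule k R} (hI : I ∈ F.opens) (hIK : I ≤ K) (hT' : T ∈ valued p I₁)
    (hU : U ∈ valued p I₂) (h : ∀ a ∈ I₂, ∀ b ∈ I₁, a * b ∈ K) : T * U ∈ valued p K := fun f ν => by
  refine apply_mem_of_monomials hT.continuous hI hIK fun α => ?_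
  rw [Ser.monomial_eq, hT.apply_mul]
  exact mul_mem_bar_of_mem h (hU f α) (hT' _ ν)

/-- An operator which is approximated by elements of `X`. -/
def Approx (F : FormalCDGA k R) (X : Set (Op k R p)) (T : Op k R p) : Prop :=
  ∀ I ∈ F.opens, ∃ U ∈ X, U - T ∈ valued p I

theorem Approx.mem_strong {T : Op k R p} (h : Approx F (strong F p : Set (Op k R p)) T) :
    T ∈ strong F p := by
  intro ν I hI
  obtain ⟨U, hU, hUT⟩ := h I hI
  obtain ⟨s, hs⟩ := hU ν I hI
  refine ⟨s, fun f hf => ?_⟩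
  have := sub_mem (hs f hf) (hUT f ν)
  simpa using this

/-- Parity, Leibniz rule and linearity are closed conditions: the defect for `T` is expressed
through `U - T`, hence lies in every open ideal. -/
theorem Approx.isDerivation {s : ZMod 2} {T : Op k R p}
    (h : Approx F {D | IsDerivation F.unital s D} T) : IsDerivation F.unital s T where
  parity t f hf ν := mem_unital_gr_of_approx F fun I hI => by
    obtain ⟨U, hU, hUT⟩ := h I hI
    exact ⟨U f ν, hU.parity t f hf ν, hUT f ν⟩
  leibniz t f g hf := by
    rw [← sub_eq_zero]
    funext ν
    refine eq_zero_of_mem_bar F fun I hI => ?_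
    obtain ⟨U, hU, hUT⟩ := h I hI
    have e : (T (Ser.mul F.unital f g) - (Ser.mul F.unital (T f) g +
        (-1 : ℤˣ) ^ (s * t) • Ser.mul F.unital f (T g))) =
        Ser.mul F.unital ((U - T) f) g + (-1 : ℤˣ) ^ (s * t) • Ser.mul F.unital f ((U - T) g) -
          (U - T) (Ser.mul F.unital f g) := by
      simp only [LinearMap.sub_apply]
      rw [hU.leibniz t f g hf, Ser.sub_mul, Ser.mul_sub, smul_sub]
      abel
    rw [e]
    refine sub_mem (add_mem ?_ ?_) (hUT _ ν)
    · exact sum_mem fun x _ => units_smul_mem _ _ (mem_bar_mul F hI _ (hUT f _))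
    · exact units_smul_mem _ _ (sum_mem fun x _ => units_smul_mem _ _
        (mul_mem_bar F hI _ (twist_mem_bar F hI _ (hUT g _))))
  linear t c hc f := by
    rw [← sub_eq_zero]
    funext ν
    refine eq_zero_of_mem_bar F fun I hI => ?_
    obtain ⟨U, hU, hUT⟩ := h I hI
    have e : (T (fun ν => c * f ν) - (-1 : ℤˣ) ^ (s * t) • fun ν => c * T f ν) =
        ((-1 : ℤˣ) ^ (s * t) • fun ν => c * (U - T) f ν) - (U - T) (fun ν => c * f ν) := by
      simp only [LinearMap.sub_apply]
      rw [hU.linear t c hc f]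
      funext κ
      simp only [Pi.sub_apply, Pi.smul_apply, mul_sub, smul_sub]
      abel
    rw [e]
    exact sub_mem (units_smul_mem _ _ (mul_mem_bar F hI _ (hUT f _))) (hUT _ ν)
  continuous := strong.isContinuousOp (Approx.mem_strong fun I hI => by
    obtain ⟨U, hU, hUT⟩ := h I hI
    exact ⟨U, IsDerivation.mem_strong hU, hUT⟩)

theorem Approx.mem_CE {s : ZMod 2} {T : Op k R p} (h : Approx F (CE F p s) T) : T ∈ CE F p s := by
  refine ⟨Approx.isDerivation fun I hI => ?_, fun f ν => ?_⟩
  · obtain ⟨U, hU, hUT⟩ := h I hI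
    exact ⟨U, hU.1, hUT⟩
  · obtain ⟨I, hI⟩ := F.opens_nonempty
    obtain ⟨U, hU, hUT⟩ := h I hI
    have := (mem_bar.mp (hUT f ν)).1
    simpa [fst_sub, hU.2 f ν] using this

theorem Approx.mem_CEbar {s : ZMod 2} {T : Op k R p} (h : Approx F (CEbar F p s) T) :
    T ∈ CEbar F p s := by
  refine ⟨Approx.mem_CE fun I hI => ?_, fun i => eq_zero_of_mem_bar F fun I hI => ?_⟩
  · obtain ⟨U, hU, hUT⟩ := h I hI
    exact ⟨U, hU.1, hUT⟩
  · obtain ⟨U, hU, hUT⟩ := h I hI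
    have h1 := hUT (Ser.X _ i) (Mono.one p)
    rw [LinearMap.sub_apply, Pi.sub_apply, hU.2 i, zero_sub] at h1
    simpa using h1

theorem eq_of_sub_mem_valued {T U : Op k R p} (h : ∀ I ∈ F.opens, T - U ∈ valued p I) : T = U := by
  rw [← sub_eq_zero]
  ext f ν : 2
  exact eq_zero_of_mem_bar F fun I hI => h I hI f ν

/-! ### Convergence -/

theorem exists_sumsTo {x : ℕ → Op k R p} (hx : TendsToZero F x) : ∃ y, SumsTo F x y := by
  have key : ∀ I : F.opens, ∃ N, ∀ n ≥ N, ∀ m ≥ N,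
      (∑ j ∈ range n, x j) - (∑ j ∈ range m, x j) ∈ valued p I.1 := by
    intro I
    obtain ⟨N, hN⟩ := hx I.1 I.2
    have h1 : ∀ n ≥ N, (∑ j ∈ range n, x j) - (∑ j ∈ range N, x j) ∈ valued p I.1 := by
      intro n hn
      rw [← sum_Ico_eq_sub _ hn]
      exact sum_mem fun j hj => hN j (mem_Ico.mp hj).1
    refine ⟨N, fun n hn m hm => ?_⟩
    have := sub_mem (h1 n hn) (h1 m hm)
    simpa using this
  choose N hN using key
  obtain ⟨I₀, hI₀⟩ := F.opens_nonempty
  have lim : ∀ f ν, ∃ c : Unitization k R, ∀ I : F.opens, ∀ n ≥ N I,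
      (∑ j ∈ range n, x j) f ν - c ∈ bar I.1 := by
    intro f ν
    obtain ⟨r, hr⟩ := F.complete (fun I => I.1.mkQ ((∑ j ∈ range (N I), x j) f ν).snd) (by
      intro I J h
      have h1 := hN I (N I) le_rfl (max (N I) (N J)) (le_max_left _ _) f ν
      have h2 := hN J (N J) le_rfl (max (N I) (N J)) (le_max_right _ _) f ν
      have h3 := sub_mem (bar_mono h h1) h2
      change Submodule.Quotient.mk _ = Submodule.Quotient.mk _
      rw [Submodule.Quotient.eq]
      have h4 := (mem_bar.mp h3).2
      simp only [LinearMap.sub_apply, Pi.sub_apply, sub_sub_sub_cancel_right, snd_sub] at h4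
      exact h4)
    -- The scalar part of the partial sums is constant beyond `N I`, because elements of `bar I`
    -- have scalar part zero. It is read off at the fixed ideal `I₀`; completeness of `A₊` provides
    -- the rest.
    refine ⟨Unitization.inl ((∑ j ∈ range (N ⟨I₀, hI₀⟩), x j) f ν).fst + Unitization.inr r,
      fun I n hn => mem_bar.mpr ⟨?_, ?_⟩⟩
    · have h1 := (mem_bar.mp (hN I n hn (max (N I) (N ⟨I₀, hI₀⟩)) (le_max_left _ _) f ν)).1
      have h2 := (mem_bar.mp (hN ⟨I₀, hI₀⟩ (N ⟨I₀, hI₀⟩) le_rfl (max (N I) (N ⟨I₀, hI₀⟩))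
        (le_max_right _ _) f ν)).1
      simp only [LinearMap.sub_apply, Pi.sub_apply, fst_sub, sub_eq_zero] at h1 h2
      rw [fst_sub, Unitization.fst_add, Unitization.fst_inl, Unitization.fst_inr, h1, h2]
      simp
    · have h1 := (mem_bar.mp (hN I n hn (N I) le_rfl f ν)).2
      have h2 := hr I
      rw [Submodule.mkQ_apply, Submodule.mkQ_apply, Submodule.Quotient.eq] at h2
      rw [LinearMap.sub_apply, Pi.sub_apply, snd_sub] at h1
      rw [snd_sub, Unitization.snd_add, Unitization.snd_inl, Unitization.snd_inr, zero_add]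
      have h3 := sub_mem h1 h2
      convert h3 using 1
      abel
  choose c hc using lim
  refine ⟨{ toFun := c, map_add' := fun f g => ?_, map_smul' := fun a f => ?_ }, fun I hI =>
    ⟨N ⟨I, hI⟩, fun n hn f ν => hc f ν ⟨I, hI⟩ n hn⟩⟩
  · funext ν
    rw [← sub_eq_zero]
    refine eq_zero_of_mem_bar F fun I hI => ?_
    have h := sub_mem (add_mem (hc f ν ⟨I, hI⟩ _ le_rfl) (hc g ν ⟨I, hI⟩ _ le_rfl))
      (hc (f + g) ν ⟨I, hI⟩ _ le_rfl)
    rw [map_add, Pi.add_apply] at h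
    convert h using 1
    rw [Pi.add_apply]; abel
  · funext ν
    rw [← sub_eq_zero]
    refine eq_zero_of_mem_bar F fun I hI => ?_
    have h := sub_mem ((bar I).smul_mem a (hc f ν ⟨I, hI⟩ _ le_rfl))
      (hc (a • f) ν ⟨I, hI⟩ _ le_rfl)
    rw [map_smul, Pi.smul_apply] at h
    convert h using 1
    rw [RingHom.id_apply, Pi.smul_apply, smul_sub]; abel

theorem SumsTo.tendsToZero {x : ℕ → Op k R p} {y : Op k R p} (h : SumsTo F x y) :
    TendsToZero F x := fun I hI => by
  obtain ⟨N, hN⟩ := h I hI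
  refine ⟨N, fun n hn => ?_⟩
  have h1 : _ ∈ valued p I := sub_mem (hN (n + 1) (by omega) : _ ∈ valued p I) (hN n hn)
  rwa [sum_range_succ, sub_sub_sub_cancel_right, add_sub_cancel_left] at h1

theorem SumsTo.approx {x : ℕ → Op k R p} {y : Op k R p} (h : SumsTo F x y)
    {X : Set (Op k R p)} (hX : ∀ n, ∑ j ∈ range n, x j ∈ X) : Approx F X y := fun I hI => by
  obtain ⟨N, hN⟩ := h I hI
  exact ⟨_, hX N, hN N le_rfl⟩

theorem SumsTo.unique {x : ℕ → Op k R p} {y z : Op k R p} (h : SumsTo F x y) (h' : SumsTo F x z) :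
    y = z := eq_of_sub_mem_valued fun I hI => by
  obtain ⟨N, hN⟩ := h I hI
  obtain ⟨M, hM⟩ := h' I hI
  have h1 : _ ∈ valued p I := sub_mem (hM (max N M) (le_max_right _ _) : _ ∈ valued p I)
    (hN (max N M) (le_max_left _ _))
  rwa [sub_sub_sub_cancel_left] at h1

/-- Convergence at `z = 1` of a power series of operators. -/
abbrev EvalsTo (F : FormalCDGA k R) (a : (Op k R p)⟦X⟧) (y : Op k R p) : Prop :=
  SumsTo F (fun n => coeff n a) y

theorem EvalsTo.add {a b : (Op k R p)⟦X⟧} {y z : Op k R p} (ha : EvalsTo F a y)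
    (hb : EvalsTo F b z) : EvalsTo F (a + b) (y + z) := fun I hI => by
  obtain ⟨N, hN⟩ := ha I hI
  obtain ⟨M, hM⟩ := hb I hI
  refine ⟨max N M, fun n hn => ?_⟩
  have h1 : _ ∈ valued p I := add_mem (hN n (le_of_max_le_left hn) : _ ∈ valued p I)
    (hM n (le_of_max_le_right hn))
  simp only [map_add, sum_add_distrib]
  rwa [add_sub_add_comm]

theorem EvalsTo.smul {a : (Op k R p)⟦X⟧} {y : Op k R p} (c : k) (ha : EvalsTo F a y) :
    EvalsTo F (c • a) (c • y) := fun I hI => by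
  obtain ⟨N, hN⟩ := ha I hI
  refine ⟨N, fun n hn => ?_⟩
  have h1 := (valued p I).smul_mem c (hN n hn)
  simp only [coeff_smul']
  rwa [← smul_sum, ← smul_sub]

theorem EvalsTo.sub {a b : (Op k R p)⟦X⟧} {y z : Op k R p} (ha : EvalsTo F a y)
    (hb : EvalsTo F b z) : EvalsTo F (a - b) (y - z) := fun I hI => by
  obtain ⟨N, hN⟩ := ha I hI
  obtain ⟨M, hM⟩ := hb I hI
  refine ⟨max N M, fun n hn => ?_⟩
  have h1 : _ ∈ valued p I := sub_mem (hN n (le_of_max_le_left hn) : _ ∈ valued p I)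
    (hM n (le_of_max_le_right hn))
  simp only [map_sub, sum_sub_distrib]
  rwa [sub_sub_sub_comm]

theorem evalsTo_C (T : Op k R p) : EvalsTo F (C T) T := fun I _ => by
  refine ⟨1, fun n hn => ?_⟩
  have h : ∑ j ∈ range n, coeff j (C T : (Op k R p)⟦X⟧) = T := by
    rw [sum_eq_single 0]
    · simp
    · intro j _ hj; simp [coeff_C, hj]
    · intro h; simp at h; omega
  rw [h, sub_self]
  exact zero_mem (valued p I)

theorem evalsTo_zero : EvalsTo F (0 : (Op k R p)⟦X⟧) 0 := by
  simpa using evalsTo_C (F := F) (0 : Op k R p)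

theorem evalsTo_one : EvalsTo F (1 : (Op k R p)⟦X⟧) 1 := by
  simpa using evalsTo_C (F := F) (1 : Op k R p)

theorem EvalsTo.sum {ι : Type*} (s : Finset ι) {a : ι → (Op k R p)⟦X⟧} {y : ι → Op k R p}
    (h : ∀ i, EvalsTo F (a i) (y i)) : EvalsTo F (∑ i ∈ s, a i) (∑ i ∈ s, y i) := by
  classical
  induction s using Finset.induction_on with
  | empty => simpa using evalsTo_zero
  | insert i s hi ih => rw [sum_insert hi, sum_insert hi]; exact (h i).add ih

theorem EvalsTo.mem_strong {a : (Op k R p)⟦X⟧} {y : Op k R p} (ha : EvalsTo F a y)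
    (hs : ∀ n, coeff n a ∈ strong F p) : y ∈ strong F p :=
  Approx.mem_strong (SumsTo.approx ha fun _ => sum_mem fun j _ => hs j)

/-- Evaluation at `z = 1` is multiplicative. Right multiplication always preserves values in `I`;
left multiplication does so for operators in `strong`, whence the condition on `a` only. -/
theorem EvalsTo.mul {a b : (Op k R p)⟦X⟧} {y z : Op k R p} (ha : EvalsTo F a y)
    (hb : EvalsTo F b z) (hs : ∀ n, coeff n a ∈ strong F p) : EvalsTo F (a * b) (y * z) :=
  fun I hI => by
  obtain ⟨N₁, hN₁⟩ := SumsTo.tendsToZero ha I hI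
  obtain ⟨N₂, hN₂⟩ := SumsTo.tendsToZero hb I hI
  obtain ⟨N₃, hN₃⟩ := ha I hI
  obtain ⟨N₄, hN₄⟩ := hb I hI
  refine ⟨N₁ + N₂ + N₃ + N₄, fun n hn => ?_⟩
  have h1 := sum_antidiagonal_sub_mul_mem (valued p I) (fun n => coeff n a) (fun n => coeff n b) n
    (fun i j hij => by
      rcases le_or_gt N₁ i with h | h
      · exact valued_mul_mem (hN₁ i h)
      · exact mul_mem_valued (hs i) hI (hN₂ j (by omega)))
  have h2 : ((∑ i ∈ range n, coeff i a) - y) * (∑ i ∈ range n, coeff i b) ∈ valued p I :=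
    valued_mul_mem (hN₃ n (by omega))
  have h3 : y * ((∑ i ∈ range n, coeff i b) - z) ∈ valued p I :=
    mul_mem_valued (ha.mem_strong hs) hI (hN₄ n (by omega))
  have h4 := add_mem (add_mem h1 h2) h3
  have h5 : ∑ j ∈ range n, coeff j (a * b) =
    ∑ n ∈ range n, ∑ p ∈ HasAntidiagonal.antidiagonal n, coeff p.1 a * coeff p.2 b :=
    sum_congr rfl fun j _ => coeff_mul _ _ _
  change (∑ j ∈ range n, coeff j (a * b)) - y * z ∈ valued p I
  rw [h5]
  convert h4 using 1
  rw [sub_mul, mul_sub]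
  abel

variable (F p) in
/-- Power series of operators which are polynomial modulo every open ideal. -/
def good : Subalgebra k (Op k R p)⟦X⟧ where
  carrier := {a | (∀ n, coeff n a ∈ strong F p) ∧ TendsToZero F fun n => coeff n a}
  mul_mem' {a b} ha hb := by
    have hs : ∀ n, coeff n (a * b) ∈ strong F p := fun n => by
      rw [coeff_mul]; exact sum_mem fun q _ => mul_mem (ha.1 _) (hb.1 _)
    refine ⟨hs, fun I hI => ?_⟩
    obtain ⟨N₁, hN₁⟩ := ha.2 I hI
    obtain ⟨N₂, hN₂⟩ := hb.2 I hI
    refine ⟨N₁ + N₂, fun n hn => ?_⟩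
    change coeff n (a * b) ∈ valued p I
    rw [coeff_mul]
    refine sum_mem fun q hq => ?_
    have := HasAntidiagonal.mem_antidiagonal.mp hq
    rcases le_or_gt N₁ q.1 with h | h
    · exact valued_mul_mem (hN₁ _ h)
    · exact mul_mem_valued (ha.1 _) hI (hN₂ _ (by omega))
  add_mem' {a b} ha hb := by
    refine ⟨fun n => by rw [map_add]; exact add_mem (ha.1 n) (hb.1 n), fun I hI => ?_⟩
    obtain ⟨N₁, hN₁⟩ := ha.2 I hI
    obtain ⟨N₂, hN₂⟩ := hb.2 I hI
    refine ⟨N₁ + N₂, fun n hn => ?_⟩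
    change coeff n (a + b) ∈ valued p I
    rw [map_add]
    exact add_mem (hN₁ n (by omega)) (hN₂ n (by omega))
  algebraMap_mem' c := by
    have e : (algebraMap k (Op k R p)⟦X⟧ c) = C (algebraMap k (Op k R p) c) := by
      rw [PowerSeries.algebraMap_apply]
    rw [e]
    constructor
    · intro n
      rw [coeff_C]
      split_ifs
      · exact algebraMap_mem _ c
      · exact zero_mem _
    · exact SumsTo.tendsToZero (evalsTo_C _)

theorem C_mem_good {T : Op k R p} (hT : T ∈ strong F p) : C T ∈ good F p :=
  ⟨fun n => by
    rw [coeff_C]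
    split_ifs
    · exact hT
    · exact zero_mem _, SumsTo.tendsToZero (evalsTo_C _)⟩

theorem dz_mem_good {a : (Op k R p)⟦X⟧} (ha : a ∈ good F p) : dz a ∈ good F p := by
  refine ⟨fun n => by rw [coeff_dz]; exact nsmul_mem (ha.1 _) _, fun I hI => ?_⟩
  obtain ⟨N, hN⟩ := ha.2 I hI
  refine ⟨N, fun n hn => ?_⟩
  change coeff n (dz a) ∈ valued p I
  rw [coeff_dz]
  exact nsmul_mem (show coeff (n + 1) a ∈ valued p I from hN (n + 1) (by omega)) _

end Topology

/-! ### The total differential `d_A + m^A` and its compatibility with products and the origin. -/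

section Differential

variable {k R : Type*} [Field k] [NonUnitalRing R] [Module k R]
  [IsScalarTower k R R] [SMulCommClass k R R] {B : Type*} [LinearOrder B]

theorem groundCoeff_parityAut (c : k) : (groundCoeff k).parityAut c = c := by
  rw [Coeff.parityAut_of_mem (groundCoeff k) (t := 0) (by simp [groundCoeff])]
  simp

theorem groundCoeff_twist (s : ZMod 2) (c : k) : (groundCoeff k).twist s c = c := by
  unfold Coeff.twist; split_ifs
  · rfl
  · exact groundCoeff_parityAut c

theorem one_mem_groundCoeff_gr : (1 : k) ∈ (groundCoeff k).gr 0 := by simp [groundCoeff]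

theorem eq_zero_or_eq_of_isHomogeneous {p : B → ZMod 2} {t : ZMod 2} {g : Ser p k}
    (hg : Ser.IsHomogeneous (groundCoeff k) t g) (ν : Mono p) :
    g ν = 0 ∨ t = monoParity p ν.1 := by
  have h := hg ν
  by_cases h0 : t + monoParity p ν.1 = 0
  · exact Or.inr (CharTwo.add_eq_zero.mp h0)
  · left
    simpa [groundCoeff, h0] using h

theorem Ser.isHomogeneous_monomial {C : Type*} [Ring C] [Algebra k C] (S : Coeff k C)
    {p : B → ZMod 2} (α : Mono p) {c : C} {t : ZMod 2} (hc : c ∈ S.gr t) :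
    Ser.IsHomogeneous S (t + monoParity p α.1) (Ser.monomial α c) := fun ν => by
  by_cases h : ν = α
  · subst h
    have : (Ser.monomial ν c : Ser p C) ν = c := Pi.single_eq_same _ _
    rw [this, add_assoc, CharTwo.add_self_eq_zero, add_zero]
    exact hc
  · have : (Ser.monomial α c : Ser p C) ν = 0 := Pi.single_eq_of_ne h _
    rw [this]; exact zero_mem _

variable (F : FormalCDGA k R) {p : B → ZMod 2}

theorem mul_mem_unital_gr {s t : ZMod 2} {a b : Unitization k R} (ha : a ∈ F.unital.gr s)
    (hb : b ∈ F.unital.gr t) : a * b ∈ F.unital.gr (s + t) := by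
  have ha' := snd_mem_of_mem_unital_gr F ha
  have hb' := snd_mem_of_mem_unital_gr F hb
  have hm := F.mul_mem s t _ _ ha' hb'
  have h11 : (1 + 1 : ZMod 2) = 0 := rfl
  rcases zmod_two_cases s with rfl | rfl <;> rcases zmod_two_cases t with rfl | rfl
  · rw [add_zero] at hm ⊢
    rw [mem_unital_gr_zero, Unitization.snd_mul]
    exact add_mem (add_mem (Submodule.smul_mem _ _ hb') (Submodule.smul_mem _ _ ha')) hm
  · rw [zero_add] at hm ⊢
    rw [mem_unital_gr_one] at hb ⊢
    rw [Unitization.snd_mul, Unitization.fst_mul, hb.1, mul_zero, zero_smul, add_zero]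
    exact ⟨rfl, add_mem (Submodule.smul_mem _ _ hb') hm⟩
  · rw [add_zero] at hm ⊢
    rw [mem_unital_gr_one] at ha ⊢
    rw [Unitization.snd_mul, Unitization.fst_mul, ha.1, zero_mul, zero_smul, zero_add]
    exact ⟨rfl, add_mem (Submodule.smul_mem _ _ ha') hm⟩
  · rw [h11] at hm ⊢
    rw [mem_unital_gr_one] at ha hb
    rw [mem_unital_gr_zero, Unitization.snd_mul, ha.1, hb.1, zero_smul, zero_smul, zero_add,
      zero_add]
    exact hm

theorem parityAut_mul {t : ZMod 2} {a : Unitization k R} (ha : a ∈ F.unital.gr t)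
    (c : Unitization k R) :
    F.unital.parityAut (a * c) = (-1 : ℤˣ) ^ t • (a * F.unital.parityAut c) := by
  obtain ⟨x, hx, y, hy, rfl⟩ := F.unital.exists_add c
  rw [mul_add, map_add, map_add, Coeff.parityAut_of_mem _ (mul_mem_unital_gr F ha hx),
    Coeff.parityAut_of_mem _ (mul_mem_unital_gr F ha hy), Coeff.parityAut_of_mem _ hx,
    Coeff.parityAut_of_mem _ hy, mul_add, smul_add, mul_smul_comm, mul_smul_comm, smul_smul,
    smul_smul, uzpow_add, uzpow_add]

/-- The differential of `A = k ⊕ A₊`. -/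
def unitalD : Unitization k R →ₗ[k] Unitization k R :=
  Unitization.inrHom k k R ∘ₗ F.d ∘ₗ Unitization.sndHom k k R

theorem unitalD_apply (c : Unitization k R) :
    unitalD F c = (Unitization.inr (F.d c.snd) : Unitization k R) := rfl

theorem unitalD_mem {s : ZMod 2} {c : Unitization k R} (hc : c ∈ F.unital.gr s) :
    unitalD F c ∈ F.unital.gr (s + 1) :=
  inr_mem_unital_gr F (F.d_mem s _ (snd_mem_of_mem_unital_gr F hc))

theorem unitalD_mem_bar {I : Submodule k R} (hI : I ∈ F.opens) {c : Unitization k R}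
    (hc : c ∈ bar I) : unitalD F c ∈ bar I :=
  mem_bar.mpr ⟨rfl, F.d_mem_opens I hI _ (mem_bar.mp hc).2⟩

theorem unitalD_unitalD (c : Unitization k R) : unitalD F (unitalD F c) = 0 := by
  rw [unitalD_apply, unitalD_apply, Unitization.snd_inr, F.d_d, Unitization.inr_zero]

theorem unitalD_mul {s : ZMod 2} {a : Unitization k R} (ha : a ∈ F.unital.gr s)
    (b : Unitization k R) :
    unitalD F (a * b) = unitalD F a * b + (-1 : ℤˣ) ^ s • (a * unitalD F b) := by
  have ha' := snd_mem_of_mem_unital_gr F ha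
  have h0 : s = 1 → a.fst = 0 := by
    rintro rfl; exact ((mem_unital_gr_one F).mp ha).1
  ext
  · rcases zmod_two_cases s with rfl | rfl <;> simp [unitalD_apply]
  · rcases zmod_two_cases s with rfl | rfl
    · simp [unitalD_apply, F.d_mul 0 _ _ ha']
      abel
    · simp [unitalD_apply, F.d_mul 1 _ _ ha', h0 rfl]
      abel

theorem unitalD_parityAut (c : Unitization k R) :
    unitalD F (F.unital.parityAut c) = -F.unital.parityAut (unitalD F c) := by
  obtain ⟨x, hx, y, hy, rfl⟩ := F.unital.exists_add c
  simp only [map_add]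
  rw [Coeff.parityAut_of_mem _ hx, Coeff.parityAut_of_mem _ hy,
    Coeff.parityAut_of_mem _ (unitalD_mem F hx), Coeff.parityAut_of_mem _ (unitalD_mem F hy),
    units_smul_map, units_smul_map, uzpow_add, uzpow_add]
  simp [add_comm]

theorem unitalD_twist (s : ZMod 2) (c : Unitization k R) :
    unitalD F (F.unital.twist s c) = (-1 : ℤˣ) ^ s • F.unital.twist s (unitalD F c) := by
  rcases zmod_two_cases s with rfl | rfl
  · simp
  · simp [Coeff.twist, unitalD_parityAut]

theorem coeffDifferential_apply (f : Ser p (Unitization k R)) (ν : Mono p) :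
    coeffDifferential F p f ν = unitalD F (f ν) := rfl

theorem coeffDifferential_mem_strong : coeffDifferential F p ∈ strong F p := fun ν _ hI =>
  ⟨{ν}, fun _ hf => unitalD_mem_bar F hI (hf ν (mem_singleton_self ν))⟩

theorem isDifferential_coeffDifferential :
    IsDifferential F.unital 1 (unitalD F) (coeffDifferential F p) where
  parity t f hf ν := by
    rw [coeffDifferential_apply, add_assoc, add_comm]
    exact unitalD_mem F (hf ν)
  leibniz t f g hf := by
    funext ν
    rw [coeffDifferential_apply, Pi.add_apply, Pi.smul_apply]
    unfold Ser.mul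
    rw [map_sum, smul_sum, ← sum_add_distrib]
    refine sum_congr rfl fun x _ => ?_
    rw [units_smul_map, unitalD_mul F (hf _), smul_add, unitalD_twist, mul_smul_comm,
      smul_smul ((-1 : ℤˣ) ^ (t + _)), one_mul, uzpow_add]
    dsimp only
    rw [mul_assoc, Int.units_mul_self, mul_one, smul_comm ((-1 : ℤˣ) ^ t)]
    rfl
  linear t c hc f := by
    funext ν
    rw [coeffDifferential_apply, unitalD_mul F hc, one_mul]
    rfl

/-- The series `c g` for a series `g` over the ground field. -/
def Ser.scale (c : Unitization k R) (g : Ser p k) : Ser p (Unitization k R) := fun ν => g ν • c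

theorem Ser.monomial_eq_scale (α : Mono p) (c : Unitization k R) :
    Ser.monomial α c = Ser.scale c (Ser.monomial α (1 : k)) := by
  funext ν
  by_cases h : ν = α
  · subst h; simp [Ser.monomial, Ser.scale]
  · simp [Ser.monomial, Ser.scale, h]

theorem Ser.scale_add (c : Unitization k R) (f g : Ser p k) :
    Ser.scale c (f + g) = Ser.scale c f + Ser.scale c g := funext fun _ => add_smul _ _ _

theorem Ser.scale_units_smul (u : ℤˣ) (c : Unitization k R) (g : Ser p k) :
    Ser.scale c (u • g) = u • Ser.scale c g := by
  funext ν
  simp only [Ser.scale, Units.smul_def, Pi.smul_apply, smul_assoc]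

theorem Ser.units_smul_scale (u : ℤˣ) (c : Unitization k R) (g : Ser p k) :
    Ser.scale (u • c) g = u • Ser.scale c g := by
  funext ν
  simp only [Ser.scale, Pi.smul_apply, smul_comm u]

theorem Ser.scale_mul_scale (a : Unitization k R) {b : Unitization k R} {t u : ZMod 2}
    (hb : b ∈ F.unital.gr u) {f : Ser p k} (hf : Ser.IsHomogeneous (groundCoeff k) t f)
    (g : Ser p k) :
    Ser.mul F.unital (Ser.scale a f) (Ser.scale b g) =
      (-1 : ℤˣ) ^ (t * u) • Ser.scale (a * b) (Ser.mul (groundCoeff k) f g) := by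
  funext ν
  rw [Pi.smul_apply]
  simp only [Ser.scale, Ser.mul]
  rw [sum_smul, smul_sum]
  refine sum_congr rfl fun x _ => ?_
  rw [groundCoeff_twist, F.unital.twist_eq, map_smul, ← F.unital.twist_eq,
    F.unital.twist_of_mem _ hb]
  rcases eq_zero_or_eq_of_isHomogeneous hf
    ⟨x.1.1, ν.2.of_le (HasAntidiagonal.antidiagonal.fst_le x.2)⟩ with h | h
  · rw [h]; simp
  · rw [h, smul_comm (_ : k) ((-1 : ℤˣ) ^ _), mul_smul_comm, smul_mul_smul_comm,
      smul_comm ((-1 : ℤˣ) ^ koszulExp _ _ _)]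
    simp only [Units.smul_def, smul_assoc]

variable (L : LInfinityStructure k p)

/-- The ground field is discrete, so continuity for the zero ideal makes each coefficient of `m g`
depend on finitely many coefficients of `g`. -/
theorem LInfinityStructure.exists_finset (ν : Mono p) : ∃ s : Finset (Mono p),
    (∀ α, L.m (Ser.monomial α 1) ν ≠ 0 → α ∈ s) ∧
    ∀ g : Ser p k, L.m g ν = ∑ α ∈ s, L.m (Ser.monomial α 1) ν * g α := by
  classical
  obtain ⟨J, hJ, T, hT⟩ := L.isDerivation.continuous ν ⊥ rfl
  refine ⟨T, fun α hα => ?_, fun g => ?_⟩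
  · by_contra hαT
    refine hα ((Submodule.mem_bot k).mp (hT _ fun β hβ => ?_))
    have hne : β ≠ α := fun h => hαT (h ▸ hβ)
    simp [Ser.monomial, Pi.single_eq_of_ne hne]
  · have h := (Submodule.mem_bot k).mp (hT (g - ∑ α ∈ T, g α • Ser.monomial α 1) fun β hβ => by
      rw [Pi.sub_apply, Finset.sum_apply, sum_eq_single β, Pi.smul_apply,
        Ser.monomial, Pi.single_eq_same, smul_eq_mul, mul_one, sub_self]
      · exact zero_mem J
      · intro α _ hne
        rw [Pi.smul_apply, Ser.monomial, Pi.single_eq_of_ne (fun e => hne e.symm), smul_zero]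
      · exact fun h => absurd hβ h)
    rw [map_sub, Pi.sub_apply, sub_eq_zero, map_sum, Finset.sum_apply] at h
    rw [h]
    refine sum_congr rfl fun α _ => ?_
    rw [map_smul, Pi.smul_apply, smul_eq_mul, mul_comm]

theorem extendScalars_apply (f : Ser p (Unitization k R)) (ν : Mono p) {s : Finset (Mono p)}
    (hs : ∀ α, L.m (Ser.monomial α 1) ν ≠ 0 → α ∈ s) :
    extendScalars F L f ν = ∑ α ∈ s, L.m (Ser.monomial α 1) ν • F.unital.parityAut (f α) := by
  refine finsum_eq_sum_of_support_subset _ fun α hα => hs α fun h => hα ?_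
  simp [h]

theorem extendScalars_scale (c : Unitization k R) (g : Ser p k) :
    extendScalars F L (Ser.scale c g) = Ser.scale (F.unital.parityAut c) (L.m g) := by
  funext ν
  obtain ⟨s, hs, hs'⟩ := L.exists_finset ν
  rw [extendScalars_apply F L _ ν hs, Ser.scale, hs' g, sum_smul]
  refine sum_congr rfl fun α _ => ?_
  rw [Ser.scale, map_smul, smul_smul]

theorem extendScalars_mem_strong : extendScalars F L ∈ strong F p := fun ν I hI => by
  obtain ⟨s, hs, -⟩ := L.exists_finset ν
  refine ⟨s, fun f hf => ?_⟩
  rw [extendScalars_apply F L _ ν hs]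
  exact sum_mem fun α hα => Submodule.smul_mem _ _ (parityAut_mem_bar F hI (hf α hα))

/-- The parity operator on series. -/
noncomputable def parityOp (p : B → ZMod 2) : Op k R p where
  toFun f ν := (-1 : ℤˣ) ^ monoParity p ν.1 • F.unital.parityAut (f ν)
  map_add' f g := by funext ν; simp
  map_smul' c f := by funext ν; simp [smul_comm c]

theorem parityOp_apply (f : Ser p (Unitization k R)) (ν : Mono p) :
    parityOp F p f ν = (-1 : ℤˣ) ^ monoParity p ν.1 • F.unital.parityAut (f ν) := rfl

theorem parityOp_of_isHomogeneous {t : ZMod 2} {f : Ser p (Unitization k R)}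
    (hf : Ser.IsHomogeneous F.unital t f) : parityOp F p f = (-1 : ℤˣ) ^ t • f := by
  funext ν
  rw [parityOp_apply, Coeff.parityAut_of_mem _ (hf ν), smul_smul, uzpow_add, mul_comm, mul_assoc,
    Int.units_mul_self, mul_one]
  rfl

theorem parityOp_mem_strong : parityOp F p ∈ strong F p := fun ν _ hI =>
  ⟨{ν}, fun _ hf => units_smul_mem _ _ (parityAut_mem_bar F hI (hf ν (mem_singleton_self ν)))⟩

theorem mulLeft_mem_strong (f : Ser p (Unitization k R)) :
    (Ser.mulLin F.unital f : Op k R p) ∈ strong F p := fun ν I hI => by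
  classical
  refine ⟨(HasAntidiagonal.antidiagonal ν.1).attach.image fun x =>
    ⟨x.1.2, ν.2.of_le (HasAntidiagonal.antidiagonal.snd_le x.2)⟩, fun g hg => ?_⟩
  exact sum_mem fun x hx => units_smul_mem _ _ (mul_mem_bar F hI _ (twist_mem_bar F hI _
    (hg _ (mem_image_of_mem _ hx))))

theorem mulRight_mem_strong (g : Ser p (Unitization k R)) :
    ((Ser.mulLin F.unital).flip g : Op k R p) ∈ strong F p := fun ν I hI => by
  classical
  refine ⟨(HasAntidiagonal.antidiagonal ν.1).attach.image fun x =>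
    ⟨x.1.1, ν.2.of_le (HasAntidiagonal.antidiagonal.fst_le x.2)⟩, fun f hf => ?_⟩
  exact sum_mem fun x hx => units_smul_mem _ _ (mem_bar_mul F hI _
    (hf _ (mem_image_of_mem _ hx)))

/-- The sign is carried by `parityOp` instead of a power of `-1`, so both sides are continuous
operators in each factor and extend from monomials by `ext_monomial`. -/
theorem extendScalars_mul_monomial (α β : Mono p) {u w : ZMod 2} {a b : Unitization k R}
    (ha : a ∈ F.unital.gr u) (hb : b ∈ F.unital.gr w) :
    extendScalars F L (Ser.mul F.unital (Ser.monomial α a) (Ser.monomial β b)) =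
      Ser.mul F.unital (extendScalars F L (Ser.monomial α a)) (Ser.monomial β b) +
      Ser.mul F.unital (parityOp F p (Ser.monomial α a)) (extendScalars F L (Ser.monomial β b)) := by
  have hα : Ser.IsHomogeneous (groundCoeff k) (monoParity p α.1) (Ser.monomial α 1) := by
    simpa using Ser.isHomogeneous_monomial (groundCoeff k) α one_mem_groundCoeff_gr
  rw [parityOp_of_isHomogeneous F (Ser.isHomogeneous_monomial F.unital α ha)]
  simp only [Ser.monomial_eq_scale]
  have hmα := L.isDerivation.parity _ _ hα
  rw [Ser.scale_mul_scale F a hb hα, units_smul_map, extendScalars_scale, extendScalars_scale,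
    extendScalars_scale, L.isDerivation.leibniz _ _ _ hα,
    Coeff.parityAut_of_mem _ (mul_mem_unital_gr F ha hb), Coeff.parityAut_of_mem _ ha,
    Coeff.parityAut_of_mem _ hb]
  simp only [Ser.units_smul_scale, Ser.units_smul_mul, Ser.mul_units_smul]
  rw [Ser.scale_mul_scale F a hb hα, Ser.scale_mul_scale F a hb hmα, Ser.scale_add,
    Ser.scale_units_smul]
  simp only [smul_add, smul_smul, uzpow_add, one_mul, add_mul]
  congr 2 <;> ac_rfl

theorem isDifferential_extendScalars :
    IsDifferential F.unital 1 (fun _ => 0) (extendScalars F L) where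
  parity t f hf ν := by
    obtain ⟨s, hs, -⟩ := L.exists_finset ν
    rw [extendScalars_apply F L _ ν hs]
    refine sum_mem fun α _ => ?_
    have hα := L.isDerivation.parity _ _ (Ser.isHomogeneous_monomial (groundCoeff k) α
      one_mem_groundCoeff_gr)
    rcases eq_zero_or_eq_of_isHomogeneous hα ν with h | h
    · rw [h, zero_smul]; exact zero_mem _
    · rw [Coeff.parityAut_of_mem _ (hf α)]
      refine Submodule.smul_mem _ _ (units_smul_mem _ _ ?_)
      have e : 1 + t + monoParity p ν.1 = t + monoParity p α.1 := by
        rw [← h, zero_add, add_comm 1 t, add_assoc, ← add_assoc 1 1, CharTwo.add_self_eq_zero,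
          zero_add]
      rw [e]
      exact hf α
  leibniz t f g hf := by
    rw [one_mul, ← Ser.units_smul_mul, ← parityOp_of_isHomogeneous F hf]
    -- The product rule is extended in two stages: `key2` frees the left factor while the right one
    -- is a monomial, and then `key` frees the right factor.
    have key : extendScalars F L * (Ser.mulLin F.unital f : Op k R p) =
        (Ser.mulLin F.unital (extendScalars F L f) : Op k R p) +
        (Ser.mulLin F.unital (parityOp F p f) : Op k R p) * extendScalars F L := by
      refine ext_monomial (mul_mem (extendScalars_mem_strong F L) (mulLeft_mem_strong F f))
        (add_mem (mulLeft_mem_strong F _) (mul_mem (mulLeft_mem_strong F _)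
          (extendScalars_mem_strong F L))) fun β w b hb => ?_
      have key2 : extendScalars F L *
            ((Ser.mulLin F.unital).flip (Ser.monomial β b) : Op k R p) =
          ((Ser.mulLin F.unital).flip (Ser.monomial β b) : Op k R p) * extendScalars F L +
          ((Ser.mulLin F.unital).flip (extendScalars F L (Ser.monomial β b)) : Op k R p) *
            parityOp F p :=
        ext_monomial (mul_mem (extendScalars_mem_strong F L) (mulRight_mem_strong F _))
          (add_mem (mul_mem (mulRight_mem_strong F _) (extendScalars_mem_strong F L))
            (mul_mem (mulRight_mem_strong F _) (parityOp_mem_strong F)))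
          fun α u a ha => extendScalars_mul_monomial F L α β ha hb
      exact LinearMap.congr_fun key2 f
    exact LinearMap.congr_fun key g
  linear t c hc f := by
    funext ν
    obtain ⟨s, hs, -⟩ := L.exists_finset ν
    rw [Pi.add_apply, Pi.smul_apply, extendScalars_apply F L _ ν hs,
      extendScalars_apply F L f ν hs, zero_mul, zero_add, one_mul, mul_sum, smul_sum]
    refine sum_congr rfl fun α _ => ?_
    rw [parityAut_mul F hc, smul_comm, mul_smul_comm]

theorem totalDifferential_mem_strong : totalDifferential F L ∈ strong F p :=
  add_mem (coeffDifferential_mem_strong F) (extendScalars_mem_strong F L)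

theorem isDifferential_totalDifferential :
    IsDifferential F.unital 1 (unitalD F) (totalDifferential F L) where
  parity t f hf ν := add_mem ((isDifferential_coeffDifferential F).parity t f hf ν)
    ((isDifferential_extendScalars F L).parity t f hf ν)
  leibniz t f g hf := by
    rw [totalDifferential, LinearMap.add_apply, LinearMap.add_apply, LinearMap.add_apply,
      (isDifferential_coeffDifferential F).leibniz t f g hf,
      (isDifferential_extendScalars F L).leibniz t f g hf, Ser.add_mul, Ser.mul_add, smul_add]
    abel
  linear t c hc f := by
    rw [totalDifferential, LinearMap.add_apply, LinearMap.add_apply,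
      (isDifferential_coeffDifferential F).linear t c hc,
      (isDifferential_extendScalars F L).linear t c hc]
    funext ν
    simp only [Pi.add_apply, Pi.smul_apply, mul_add, smul_add, zero_mul, zero_add]
    abel

theorem totalDifferential_scale (c : Unitization k R) (g : Ser p k) :
    totalDifferential F L (Ser.scale c g) =
      Ser.scale (unitalD F c) g + Ser.scale (F.unital.parityAut c) (L.m g) := by
  rw [totalDifferential, LinearMap.add_apply, extendScalars_scale]
  congr 1
  funext ν
  rw [coeffDifferential_apply, Ser.scale, map_smul, Ser.scale]

/-- On `c g` the squares vanish by `d_A² = 0` and `m² = 0`. The mixed terms cancel because `d_A`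
anticommutes with the parity automorphism. -/
theorem totalDifferential_mul_self : totalDifferential F L * totalDifferential F L = 0 := by
  refine ext_monomial (mul_mem (totalDifferential_mem_strong F L)
    (totalDifferential_mem_strong F L)) (zero_mem _) fun α t c hc => ?_
  rw [Module.End.mul_apply, Ser.monomial_eq_scale, totalDifferential_scale, map_add,
    totalDifferential_scale, totalDifferential_scale, unitalD_unitalD, unitalD_parityAut]
  have hm : L.m (L.m (Ser.monomial α 1)) = 0 := LinearMap.congr_fun L.square_zero _
  rw [hm]
  funext ν
  simp [Ser.scale]

/-- The absence of a constant term in `m` means that series vanishing at the origin are preserved.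
This keeps `CEbar` stable under the bracket with the total differential. -/
theorem totalDifferential_apply_one {f : Ser p (Unitization k R)} (hf : f (Mono.one p) = 0) :
    totalDifferential F L f (Mono.one p) = 0 := by
  obtain ⟨s, hs, -⟩ := L.exists_finset (Mono.one p)
  rw [totalDifferential, LinearMap.add_apply, Pi.add_apply, coeffDifferential_apply, hf, map_zero,
    zero_add, extendScalars_apply F L _ _ hs]
  refine sum_eq_zero fun α _ => ?_
  by_cases h : α = Mono.one p
  · rw [h, hf, map_zero, smul_zero]
  · rw [L.isDerivation.monomial_apply_one one_mem_groundCoeff_gr L.noConstantTerm h, zero_smul]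

theorem fst_parityAut {c : Unitization k R} (hc : c.fst = 0) :
    (F.unital.parityAut c).fst = 0 := by
  obtain ⟨x, hx, y, hy, rfl⟩ := F.unital.exists_add c
  have hy' := ((mem_unital_gr_one F).mp hy).1
  rw [Unitization.fst_add, hy', add_zero] at hc
  rw [map_add, Coeff.parityAut_of_mem _ hx, Coeff.parityAut_of_mem _ hy]
  simp [hc, hy']

theorem totalDifferential_mul_mem_valued_top {T : Op k R p} (hT : T ∈ valued p ⊤) :
    totalDifferential F L * T ∈ valued p ⊤ := fun f ν => by
  rw [Module.End.mul_apply, totalDifferential, LinearMap.add_apply, Pi.add_apply]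
  refine add_mem (mem_bar.mpr ⟨rfl, trivial⟩) ?_
  obtain ⟨s, hs, -⟩ := L.exists_finset ν
  rw [extendScalars_apply F L _ _ hs]
  refine sum_mem fun α _ => Submodule.smul_mem _ _ (mem_bar.mpr ⟨fst_parityAut F ?_, trivial⟩)
  exact (mem_bar.mp (hT f α)).1

end Differential

/-! ### Nilpotent filtration, exponentials of derivations, and the differential equation for
constant derivations. -/

section ConstantPath

variable {k R : Type*} [Field k] [NonUnitalRing R] [Module k R]
  [IsScalarTower k R R] [SMulCommClass k R R] {B : Type*} [LinearOrder B]
  (F : FormalCDGA k R) {p : B → ZMod 2}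

/-! ### The filtration by powers of the maximal ideal -/

/-- The sum of an open ideal with the `(j + 1)`-st power of `A₊`. -/
def powIdeal (I : Submodule k R) (j : ℕ) : Submodule k R :=
  Submodule.span k {r | ∃ l : List R, l.length = j ∧ ∃ s, l.foldr (· * ·) s = r} ⊔ I

theorem le_powIdeal (I : Submodule k R) (j : ℕ) : I ≤ powIdeal I j := le_sup_right

theorem powIdeal_zero (I : Submodule k R) : powIdeal I 0 = ⊤ := by
  rw [eq_top_iff]
  intro r _
  exact Submodule.mem_sup_left (Submodule.subset_span ⟨[], rfl, r, rfl⟩)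

theorem foldr_mul_mul (l : List R) (s r : R) :
    l.foldr (· * ·) s * r = l.foldr (· * ·) (s * r) := by
  induction l with
  | nil => rfl
  | cons a l ih => simp only [List.foldr_cons, mul_assoc, ih]

theorem powIdeal_antitone_succ (I : Submodule k R) (j : ℕ) : powIdeal I (j + 1) ≤ powIdeal I j := by
  refine sup_le_sup_right (Submodule.span_mono ?_) I
  rintro _ ⟨l, hl, s, rfl⟩
  have hne : l ≠ [] := by rintro rfl; simp at hl
  -- The last letter of the word is absorbed into the seed of the fold.
  refine ⟨l.dropLast, by simp [hl], l.getLast hne * s, ?_⟩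
  conv_rhs => rw [← List.dropLast_append_getLast hne]
  simp

variable {F}

theorem mul_mem_powIdeal {I : Submodule k R} (hI : I ∈ F.opens) {j : ℕ} (r : R) {s : R}
    (hs : s ∈ powIdeal I j) : r * s ∈ powIdeal I (j + 1) := by
  obtain ⟨a, ha, b, hb, rfl⟩ := Submodule.mem_sup.mp hs
  rw [mul_add]
  refine add_mem ?_ (le_powIdeal I _ (F.mul_mem_left I hI r b hb))
  refine Submodule.mem_sup_left ?_
  induction ha using Submodule.span_induction with
  | mem x hx =>
    obtain ⟨l, hl, t, rfl⟩ := hx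
    exact Submodule.subset_span ⟨r :: l, by simp [hl], t, rfl⟩
  | zero => rw [mul_zero]; exact zero_mem _
  | add x y _ _ hx hy =>
    rw [mul_add]
    exact add_mem (hx (Submodule.mem_sup.mpr ⟨x, by assumption, b, hb, rfl⟩))
      (hy (Submodule.mem_sup.mpr ⟨y, by assumption, b, hb, rfl⟩))
  | smul c x _ hx =>
    rw [mul_smul_comm]
    exact Submodule.smul_mem _ _ (hx (Submodule.mem_sup.mpr ⟨x, by assumption, b, hb, rfl⟩))

theorem powIdeal_mul_mem {I : Submodule k R} (hI : I ∈ F.opens) {j : ℕ} (r : R) {s : R}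
    (hs : s ∈ powIdeal I j) : s * r ∈ powIdeal I (j + 1) := by
  obtain ⟨a, ha, b, hb, rfl⟩ := Submodule.mem_sup.mp hs
  rw [add_mul]
  refine add_mem ?_ (le_powIdeal I _ (F.mul_mem_right I hI r b hb))
  refine Submodule.mem_sup_left ?_
  induction ha using Submodule.span_induction with
  | mem x hx =>
    obtain ⟨l, hl, t, rfl⟩ := hx
    exact Submodule.subset_span ⟨l ++ [t], by simp [hl], r, by simp [foldr_mul_mul]⟩
  | zero => rw [zero_mul]; exact zero_mem _
  | add x y _ _ hx hy =>
    rw [add_mul]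
    exact add_mem (hx (Submodule.mem_sup.mpr ⟨x, by assumption, b, hb, rfl⟩))
      (hy (Submodule.mem_sup.mpr ⟨y, by assumption, b, hb, rfl⟩))
  | smul c x _ hx =>
    rw [smul_mul_assoc]
    exact Submodule.smul_mem _ _ (hx (Submodule.mem_sup.mpr ⟨x, by assumption, b, hb, rfl⟩))

theorem exists_powIdeal_le {I : Submodule k R} (hI : I ∈ F.opens) : ∃ n, powIdeal I n ≤ I := by
  obtain ⟨n, hn⟩ := F.nilpotent_quotient I hI
  refine ⟨n, sup_le (Submodule.span_le.mpr ?_) le_rfl⟩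
  rintro _ ⟨l, hl, s, rfl⟩
  exact hn l hl s

/-! ### Spaces of derivations -/

theorem IsDerivation.add {s : ZMod 2} {D D' : Op k R p} (h : IsDerivation F.unital s D)
    (h' : IsDerivation F.unital s D') : IsDerivation F.unital s (D + D') where
  parity t f hf ν := add_mem (h.parity t f hf ν) (h'.parity t f hf ν)
  leibniz t f g hf := by
    simp only [LinearMap.add_apply]
    rw [h.leibniz t f g hf, h'.leibniz t f g hf, Ser.add_mul, Ser.mul_add, smul_add]
    abel
  linear t c hc f := by
    rw [LinearMap.add_apply, h.linear t c hc, h'.linear t c hc]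
    funext ν
    simp only [Pi.add_apply, Pi.smul_apply, LinearMap.add_apply, mul_add, smul_add]
  continuous := strong.isContinuousOp (add_mem h.mem_strong h'.mem_strong)

theorem IsDerivation.smul {s : ZMod 2} {D : Op k R p} (c : k) (h : IsDerivation F.unital s D) :
    IsDerivation F.unital s (c • D) where
  parity t f hf ν := Submodule.smul_mem _ c (h.parity t f hf ν)
  leibniz t f g hf := by
    simp only [LinearMap.smul_apply]
    rw [h.leibniz t f g hf, Ser.smul_mul, Ser.mul_smul, smul_add, smul_comm c]
  linear t a ha f := by
    rw [LinearMap.smul_apply, h.linear t a ha]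
    funext ν
    simp only [Pi.smul_apply, LinearMap.smul_apply, mul_smul_comm, smul_comm c]
  continuous := strong.isContinuousOp (Subalgebra.smul_mem _ h.mem_strong c)

theorem isDerivation_zero (s : ZMod 2) : IsDerivation F.unital s (0 : Op k R p) where
  parity t f hf ν := zero_mem _
  leibniz t f g hf := by
    simp only [LinearMap.zero_apply]
    rw [Ser.zero_mul, Ser.mul_zero, smul_zero, add_zero]
  linear t a ha f := by
    funext ν
    simp
  continuous := strong.isContinuousOp (zero_mem _)

variable (F p) in
/-- The parity `s` part of `CE(V,V) ⊗̂ A₊` as a subspace. -/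
def ceSpace (s : ZMod 2) : Submodule k (Op k R p) where
  carrier := CE F p s
  zero_mem' := ⟨isDerivation_zero s, fun _ _ => rfl⟩
  add_mem' h h' := ⟨h.1.add h'.1, fun f ν => by
    rw [LinearMap.add_apply, Pi.add_apply, Unitization.fst_add, h.2, h'.2, add_zero]⟩
  smul_mem' c _ h := ⟨h.1.smul c, fun f ν => by
    rw [LinearMap.smul_apply, Pi.smul_apply, Unitization.fst_smul, h.2, smul_zero]⟩

variable (F p) in
/-- The parity `s` part of the truncated complex as a subspace. -/
def ceBarSpace (s : ZMod 2) : Submodule k (Op k R p) where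
  carrier := CEbar F p s
  zero_mem' := ⟨(ceSpace F p s).zero_mem, fun _ => rfl⟩
  add_mem' h h' := ⟨(ceSpace F p s).add_mem h.1 h'.1, fun i => by
    rw [LinearMap.add_apply, Pi.add_apply, h.2, h'.2, add_zero]⟩
  smul_mem' c _ h := ⟨(ceSpace F p s).smul_mem c h.1, fun i => by
    rw [LinearMap.smul_apply, Pi.smul_apply, h.2, smul_zero]⟩

theorem mem_valued_top_of_mem_ceSpace {s : ZMod 2} {T : Op k R p} (h : T ∈ ceSpace F p s) :
    T ∈ valued p ⊤ := mem_valued_top.mpr h.2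

theorem commutator_mem_ceSpace {s : ZMod 2} {T U : Op k R p} (hT : T ∈ ceSpace F p s)
    (hU : U ∈ ceSpace F p 0) : T * U - U * T ∈ ceSpace F p s := by
  refine ⟨hT.1.isDifferential.commutator hU.1 (strong.isContinuousOp (sub_mem
    (mul_mem hT.1.mem_strong hU.1.mem_strong) (mul_mem hU.1.mem_strong hT.1.mem_strong))), ?_⟩
  exact mem_valued_top.mp (sub_mem (valued_mul_mem (mem_valued_top_of_mem_ceSpace hT))
    (valued_mul_mem (mem_valued_top_of_mem_ceSpace hU)))

theorem totalDifferential_commutator_mem_ceSpace (L : LInfinityStructure k p) {U : Op k R p}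
    (hU : U ∈ ceSpace F p 0) :
    totalDifferential F L * U - U * totalDifferential F L ∈ ceSpace F p 1 := by
  have hQ := totalDifferential_mem_strong F L
  refine ⟨(isDifferential_totalDifferential F L).commutator hU.1 (strong.isContinuousOp (sub_mem
    (mul_mem hQ hU.1.mem_strong) (mul_mem hU.1.mem_strong hQ))), ?_⟩
  exact mem_valued_top.mp (sub_mem
    (totalDifferential_mul_mem_valued_top F L (mem_valued_top_of_mem_ceSpace hU))
    (valued_mul_mem (mem_valued_top_of_mem_ceSpace hU)))

theorem constPart_mem_valued {I : Submodule k R} {T : Op k R p} (hT : T ∈ valued p I) :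
    constPart T ∈ valued p I := fun _ ν => hT _ ν

variable (F p) in
/-- The even constant derivations. -/
def constSpace : Submodule k (Op k R p) where
  carrier := {T | T ∈ ceSpace F p 0 ∧ constPart T = T}
  zero_mem' := ⟨zero_mem _, map_zero _⟩
  add_mem' h h' := ⟨add_mem h.1 h'.1, by rw [map_add, h.2, h'.2]⟩
  smul_mem' c _ h := ⟨Submodule.smul_mem _ c h.1, by rw [map_smul, h.2]⟩

theorem constPart_mem_constSpace {T : Op k R p} (hT : T ∈ ceSpace F p 0) :
    constPart T ∈ constSpace F p :=
  ⟨⟨hT.1.constPart, fun _ ν => hT.2 _ ν⟩, constPart_constPart T⟩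

theorem apply_eq_zero_of_mem_constSpace {T : Op k R p} (hT : T ∈ constSpace F p)
    {f : Ser p (Unitization k R)} (hf : ∀ ν, ν ≠ Mono.one p → f ν = 0) : T f = 0 := by
  funext ν
  rw [← hT.2, constPart_apply]
  have : Ser.component (k := k) (ν.1.degree + 1) f = 0 := by
    funext κ
    rw [Ser.component_apply]
    split_ifs with h
    · refine hf κ fun h0 => ?_
      rw [h0] at h
      simp [Mono.one] at h
    · rfl
  rw [this, map_zero]

theorem constSpace_apply_X {T : Op k R p} (hT : T ∈ constSpace F p) (i : B) :
    T (Ser.X _ i) = Ser.monomial (Mono.one p) (T (Ser.X _ i) (Mono.one p)) := by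
  funext ν
  by_cases h : ν = Mono.one p
  · subst h; rw [Ser.monomial, Pi.single_eq_same]
  · have e : (Ser.monomial (Mono.one p) (T (Ser.X _ i) (Mono.one p)) : Ser p _) ν = 0 :=
      Pi.single_eq_of_ne h _
    rw [e, ← hT.2, constPart_apply]
    have : Ser.component (k := k) (ν.1.degree + 1) (Ser.X (Unitization k R) i : Ser p _) = 0 := by
      funext κ
      rw [Ser.component_apply]
      split_ifs with hκ
      · refine Pi.single_eq_of_ne (fun h0 => h (Subtype.ext ?_)) _
        rw [h0] at hκ
        simp only [Mono.var, Finsupp.degree_single] at hκ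
        exact Finsupp.degree_eq_zero_iff _ |>.mp (by omega)
      · rfl
    rw [this, map_zero]; rfl

theorem constSpace_apply_one {T : Op k R p} (hT : T ∈ constSpace F p) (c : Unitization k R) :
    T (Ser.monomial (Mono.one p) c) = 0 :=
  apply_eq_zero_of_mem_constSpace hT fun _ h => Pi.single_eq_of_ne h _

/-- The commutator is a derivation, and it kills constants and every `x_i`: one operator sends `x_i`
to a constant, which the other annihilates. -/
theorem commute_of_mem_constSpace {T U : Op k R p} (hT : T ∈ constSpace F p)
    (hU : U ∈ constSpace F p) : Commute T U := by
  have hK := commutator_mem_ceSpace hT.1 hU.1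
  have h0 : T * U - U * T = 0 := by
    refine ext_monomial hK.1.mem_strong (zero_mem _) fun α t c hc => ?_
    rw [Ser.monomial_eq, hK.1.apply_mul, hK.1.monomial_eq_zero (one_mem_unital_gr F)]
    · funext ν; simp
    · intro i
      rw [LinearMap.sub_apply, Module.End.mul_apply, Module.End.mul_apply, constSpace_apply_X hU,
        constSpace_apply_X hT, constSpace_apply_one hT, constSpace_apply_one hU, sub_zero]
    · rw [LinearMap.sub_apply, Module.End.mul_apply, Module.End.mul_apply,
        constSpace_apply_one hT, constSpace_apply_one hU, map_zero, map_zero, sub_zero]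
  exact sub_eq_zero.mp h0

/-! ### Series of derivations -/

/-- Power series with coefficients in a subspace. -/
def coeffsIn (M : Submodule k (Op k R p)) : Submodule k (Op k R p)⟦X⟧ where
  carrier := {a | ∀ n, coeff n a ∈ M}
  zero_mem' n := by rw [map_zero]; exact zero_mem _
  add_mem' ha hb n := by rw [map_add]; exact add_mem (ha n) (hb n)
  smul_mem' c a ha n := by rw [coeff_smul']; exact Submodule.smul_mem _ c (ha n)

theorem mul_mem_coeffsIn {M N P : Submodule k (Op k R p)} (h : ∀ a ∈ M, ∀ b ∈ N, a * b ∈ P)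
    {a b : (Op k R p)⟦X⟧} (ha : a ∈ coeffsIn M) (hb : b ∈ coeffsIn N) : a * b ∈ coeffsIn P :=
  fun n => by
  rw [coeff_mul]
  exact sum_mem fun q _ => h _ (ha _) _ (hb _)

theorem coeff_commutator (a b : (Op k R p)⟦X⟧) (n : ℕ) :
    coeff n (a * b - b * a) = ∑ q ∈ HasAntidiagonal.antidiagonal n,
      (coeff q.1 a * coeff q.2 b - coeff q.2 b * coeff q.1 a) := by
  rw [map_sub, coeff_mul, coeff_mul, sum_sub_distrib]
  congr 1
  rw [← Finset.Nat.sum_antidiagonal_swap]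
  rfl

theorem ad_iterate_mem {D h : (Op k R p)⟦X⟧} (hD : D ∈ coeffsIn (ceSpace F p 0))
    (hh : h ∈ coeffsIn (ceSpace F p 0)) (a : ℕ) : (ad D)^[a] h ∈ coeffsIn (ceSpace F p 0) := by
  induction a with
  | zero => exact hh
  | succ a ih =>
    rw [Function.iterate_succ_apply']
    intro n
    rw [ad, coeff_commutator]
    exact sum_mem fun q _ => commutator_mem_ceSpace (hD _) (ih _)

theorem mul_mem_coeffsIn_powIdeal {I : Submodule k R} (hI : I ∈ F.opens) {j : ℕ}
    {a b : (Op k R p)⟦X⟧} (ha : a ∈ coeffsIn (ceSpace F p 0))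
    (hb : b ∈ coeffsIn (valued p (powIdeal I j))) :
    a * b ∈ coeffsIn (valued p (powIdeal I (j + 1))) :=
  mul_mem_coeffsIn (M := ceSpace F p 0) (fun _ hT _ hU => hT.1.mul_mem_valued hI (le_powIdeal I _)
    (mem_valued_top_of_mem_ceSpace hT) hU fun _ hs r _ => powIdeal_mul_mem hI r hs) ha hb

theorem powIdeal_mul_mem_coeffsIn {I : Submodule k R} (hI : I ∈ F.opens) {j : ℕ}
    {a b : (Op k R p)⟦X⟧} (ha : a ∈ coeffsIn (ceSpace F p 0))
    (ha' : a ∈ coeffsIn (valued p (powIdeal I j))) (hb : b ∈ coeffsIn (ceSpace F p 0)) :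
    a * b ∈ coeffsIn (valued p (powIdeal I (j + 1))) :=
  mul_mem_coeffsIn (M := ceSpace F p 0 ⊓ valued p (powIdeal I j))
    (fun _ hT _ hU => hT.1.1.mul_mem_valued hI (le_powIdeal I _) hT.2
      (mem_valued_top_of_mem_ceSpace hU) fun r _ _ hs => mul_mem_powIdeal hI r hs)
    (fun n => ⟨ha n, ha' n⟩) hb

theorem coeffsIn_mono {M N : Submodule k (Op k R p)} (h : M ≤ N) : coeffsIn M ≤ coeffsIn N :=
  fun _ ha n => h (ha n)

/-- Use `[D, y] - [D', y'] = [D - D', y] + [D', y - y']`, where each bracket with a derivation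
valued in `A₊` gains one power of `A₊`. Thus the discrepancy is one power smaller than `D - D'`,
which is what makes the Picard step contract. -/
theorem ad_iterate_sub_mem {I : Submodule k R} (hI : I ∈ F.opens) {j : ℕ}
    {D D' h : (Op k R p)⟦X⟧} (hD : D ∈ coeffsIn (ceSpace F p 0))
    (hD' : D' ∈ coeffsIn (ceSpace F p 0)) (hh : h ∈ coeffsIn (ceSpace F p 0))
    (hDD' : D - D' ∈ coeffsIn (valued p (powIdeal I j))) (a : ℕ) :
    (ad D)^[a] h - (ad D')^[a] h ∈ coeffsIn (valued p (powIdeal I (j + 1))) := by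
  induction a with
  | zero => rw [Function.iterate_zero, Function.iterate_zero, id, sub_self]; exact zero_mem _
  | succ a ih =>
    rw [Function.iterate_succ_apply', Function.iterate_succ_apply']
    have hy := ad_iterate_mem hD hh a
    have hy' := ad_iterate_mem hD' hh a
    set y := (ad D)^[a] h
    set y' := (ad D')^[a] h
    have e : ad D y - ad D' y' =
        ((D - D') * y - y * (D - D')) + (D' * (y - y') - (y - y') * D') := by
      simp only [ad, sub_mul, mul_sub]
      abel
    rw [e]
    have hle := coeffsIn_mono (valued_mono (p := p) (powIdeal_antitone_succ I (j + 1)))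
    exact add_mem (sub_mem (powIdeal_mul_mem_coeffsIn hI (sub_mem hD hD') hDD' hy)
      (mul_mem_coeffsIn_powIdeal hI hy hDD'))
      (hle (sub_mem (mul_mem_coeffsIn_powIdeal hI hD' ih)
        (powIdeal_mul_mem_coeffsIn hI (sub_mem hy hy') ih hD')))

theorem pow_succ_mem {I : Submodule k R} (hI : I ∈ F.opens) {D : (Op k R p)⟦X⟧}
    (hD : D ∈ coeffsIn (ceSpace F p 0)) (j : ℕ) :
    D ^ (j + 1) ∈ coeffsIn (valued p (powIdeal I j)) := by
  induction j with
  | zero =>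
    rw [zero_add, pow_one, powIdeal_zero]
    exact fun n => mem_valued_top_of_mem_ceSpace (hD n)
  | succ j ih =>
    rw [_root_.pow_succ']
    exact mul_mem_coeffsIn_powIdeal hI hD ih

/-! ### Exponentials -/

theorem powIdeal_antitone (I : Submodule k R) {i j : ℕ} (h : i ≤ j) :
    powIdeal I j ≤ powIdeal I i := by
  induction h with
  | refl => exact le_rfl
  | step _ ih => exact (powIdeal_antitone_succ I _).trans ih

/-- In contrast with `eqBelow_expS`, the truncation here is uniform in the degree in `z`: modulo `I`
high powers of `D` vanish since `A₊ / I` is nilpotent. -/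
theorem exists_expS_sub_mem {I : Submodule k R} (hI : I ∈ F.opens) {D : (Op k R p)⟦X⟧}
    (hD : D ∈ coeffsIn (ceSpace F p 0)) (hD0 : coeff 0 D = 0) : ∃ N, ∀ M ≥ N,
      expS k D - ∑ j ∈ range M, ((j.factorial : k)⁻¹ • D ^ j) ∈ coeffsIn (valued p I) := by
  obtain ⟨N, hN⟩ := exists_powIdeal_le hI
  refine ⟨N + 1, fun M hM n => ?_⟩
  rw [map_sub]
  rcases lt_or_ge n M with h | h
  · rw [eqBelow_expS k hD0 M n h, sub_self]; exact zero_mem _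
  · rw [expS, coeff_mk, ← map_sub, ← sum_Ico_eq_sub _ (by omega : M ≤ n + 1), map_sum]
    refine sum_mem fun j hj => ?_
    rw [coeff_smul']
    refine Submodule.smul_mem _ _ ?_
    obtain ⟨i, rfl⟩ : ∃ i, j = i + 1 := ⟨j - 1, by simp at hj; omega⟩
    refine valued_mono ((powIdeal_antitone I ?_).trans hN) (pow_succ_mem hI hD i n)
    simp at hj; omega

theorem expS_mem_good {D : (Op k R p)⟦X⟧} (hD : D ∈ coeffsIn (ceSpace F p 0))
    (hg : D ∈ good F p) (hD0 : coeff 0 D = 0) : expS k D ∈ good F p := by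
  have hpart : ∀ M, ∑ j ∈ range M, ((j.factorial : k)⁻¹ • D ^ j) ∈ good F p := fun M =>
    sum_mem fun j _ => Subalgebra.smul_mem _ (pow_mem hg j) _
  refine ⟨fun n => ?_, fun I hI => ?_⟩
  · rw [expS, coeff_mk]; exact (hpart _).1 n
  · obtain ⟨N, hN⟩ := exists_expS_sub_mem hI hD hD0
    obtain ⟨M, hM⟩ := (hpart N).2 I hI
    refine ⟨M, fun n hn => ?_⟩
    have h1 := hN N le_rfl n
    rw [map_sub] at h1
    have h2 := add_mem h1 (hM n hn)
    rw [sub_add_cancel] at h2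
    exact h2

theorem EvalsTo.pow {a : (Op k R p)⟦X⟧} {y : Op k R p} (ha : EvalsTo F a y)
    (hs : a ∈ good F p) (j : ℕ) : EvalsTo F (a ^ j) (y ^ j) := by
  induction j with
  | zero => simpa using evalsTo_one
  | succ j ih =>
    rw [_root_.pow_succ', _root_.pow_succ']
    exact ha.mul ih hs.1

/-- Modulo `I` the exponential series may be cut at a length independent of `z`; the remaining
polynomial in `D` is evaluated at `z = 1` term by term. -/
theorem isExponential_of_evalsTo {D : (Op k R p)⟦X⟧} (hD : D ∈ coeffsIn (ceSpace F p 0))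
    (hg : D ∈ good F p) (hD0 : coeff 0 D = 0) {d E : Op k R p} (hd : EvalsTo F D d)
    (hE : EvalsTo F (expS k D) E) : IsExponential F d E := by
  intro f ν I hI
  obtain ⟨N, hN⟩ := exists_expS_sub_mem hI hD hD0
  refine ⟨N, fun n hn => ?_⟩
  have h1 : EvalsTo F (∑ j ∈ range n, ((j.factorial : k)⁻¹ • D ^ j))
      (∑ j ∈ range n, ((j.factorial : k)⁻¹ • d ^ j)) :=
    EvalsTo.sum _ fun j => (hd.pow hg j).smul _
  obtain ⟨M₁, hM₁⟩ := h1 I hI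
  obtain ⟨M₂, hM₂⟩ := hE I hI
  have h2 := hM₁ (max M₁ M₂) (le_max_left _ _) f ν
  have h3 := hM₂ (max M₁ M₂) (le_max_right _ _) f ν
  have h4 : ∑ m ∈ range (max M₁ M₂), coeff m (expS k D) -
      ∑ m ∈ range (max M₁ M₂), coeff m (∑ j ∈ range n, ((j.factorial : k)⁻¹ • D ^ j)) ∈
        valued p I := by
    rw [← sum_sub_distrib]
    refine sum_mem fun m _ => ?_
    rw [← map_sub]
    exact hN n hn m
  have h5 := sub_mem (sub_mem h3 (h4 f ν)) h2
  have e : ∑ j ∈ range n, ((j.factorial : k)⁻¹ • (d ^ j) f ν) =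
      (∑ j ∈ range n, ((j.factorial : k)⁻¹ • d ^ j)) f ν := by
    simp
  rw [e]
  convert h5 using 1
  simp only [LinearMap.sub_apply, Pi.sub_apply]
  abel

variable [CharZero k]

/-- A product of operators is not visibly a derivation, but the conjugate is a sum of iterated
brackets of derivations. -/
theorem expS_conj_mem {D h : (Op k R p)⟦X⟧} (hD : D ∈ coeffsIn (ceSpace F p 0))
    (hD0 : coeff 0 D = 0) (hh : h ∈ coeffsIn (ceSpace F p 0)) :
    expS k D * h * expS k (-D) ∈ coeffsIn (ceSpace F p 0) := fun n => by
  rw [eqBelow_expS_conj k hD0 h (n + 1) n (Nat.lt_succ_self n), map_sum]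
  exact sum_mem fun j _ => by
    rw [coeff_smul']; exact Submodule.smul_mem _ _ (ad_iterate_mem hD hh j n)

theorem expS_conj_sub_mem {I : Submodule k R} (hI : I ∈ F.opens) {j : ℕ}
    {D D' h : (Op k R p)⟦X⟧} (hD : D ∈ coeffsIn (ceSpace F p 0))
    (hD' : D' ∈ coeffsIn (ceSpace F p 0)) (hD0 : coeff 0 D = 0) (hD0' : coeff 0 D' = 0)
    (hh : h ∈ coeffsIn (ceSpace F p 0)) (hDD' : D - D' ∈ coeffsIn (valued p (powIdeal I j))) :
    expS k D * h * expS k (-D) - expS k D' * h * expS k (-D') ∈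
      coeffsIn (valued p (powIdeal I (j + 1))) := fun n => by
  rw [map_sub, eqBelow_expS_conj k hD0 h (n + 1) n (Nat.lt_succ_self n),
    eqBelow_expS_conj k hD0' h (n + 1) n (Nat.lt_succ_self n), ← map_sub, ← sum_sub_distrib,
    map_sum]
  refine sum_mem fun a _ => ?_
  rw [← smul_sub, coeff_smul']
  exact Submodule.smul_mem _ _ (ad_iterate_sub_mem hI hD hD' hh hDD' a n)

/-! ### The Picard iteration -/

/-- The integral from `0` to `z` of the constant part of `e ^ D h e ^ (-D)`. -/
noncomputable def picardStep (h D : (Op k R p)⟦X⟧) : (Op k R p)⟦X⟧ :=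
  -- At `n = 0` the truncated index `n - 1` is harmless: the inverse of `0` is `0`, which gives the
  -- initial value zero.
  PowerSeries.mk fun n => (n : k)⁻¹ • constPart (coeff (n - 1) (expS k D * h * expS k (-D)))

theorem coeff_zero_picardStep (h D : (Op k R p)⟦X⟧) : coeff 0 (picardStep h D) = 0 := by
  rw [picardStep, coeff_mk]; simp

theorem coeff_succ_picardStep (h D : (Op k R p)⟦X⟧) (n : ℕ) : coeff (n + 1) (picardStep h D) =
    ((n + 1 : ℕ) : k)⁻¹ • constPart (coeff n (expS k D * h * expS k (-D))) := by
  rw [picardStep, coeff_mk]; rfl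

theorem coeffsIn_constSpace_le {D : (Op k R p)⟦X⟧} (hD : D ∈ coeffsIn (constSpace F p)) :
    D ∈ coeffsIn (ceSpace F p 0) := fun n => (hD n).1

theorem picardStep_mem {h D : (Op k R p)⟦X⟧} (hD : D ∈ coeffsIn (constSpace F p))
    (hD0 : coeff 0 D = 0) (hh : h ∈ coeffsIn (ceSpace F p 0)) :
    picardStep h D ∈ coeffsIn (constSpace F p) := fun n => by
  rw [picardStep, coeff_mk]
  exact Submodule.smul_mem _ _ (constPart_mem_constSpace
    (expS_conj_mem (coeffsIn_constSpace_le hD) hD0 hh _))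

theorem picardStep_mem_good {h D : (Op k R p)⟦X⟧} (hD : D ∈ coeffsIn (constSpace F p))
    (hg : D ∈ good F p) (hD0 : coeff 0 D = 0) (hh : h ∈ coeffsIn (ceSpace F p 0))
    (hhg : h ∈ good F p) : picardStep h D ∈ good F p := by
  have hD' := coeffsIn_constSpace_le hD
  refine ⟨fun n => (picardStep_mem hD hD0 hh n).1.1.mem_strong, fun I hI => ?_⟩
  have hW : expS k D * h * expS k (-D) ∈ good F p :=
    mul_mem (mul_mem (expS_mem_good hD' hg hD0) hhg)
      (expS_mem_good (neg_mem hD') (neg_mem hg) (by rw [map_neg, hD0, neg_zero]))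
  obtain ⟨N, hN⟩ := hW.2 I hI
  refine ⟨N + 1, fun n hn => ?_⟩
  change coeff n (picardStep h D) ∈ valued p I
  rw [picardStep, coeff_mk]
  exact Submodule.smul_mem _ _ (constPart_mem_valued (hN _ (by omega)))

/-- Contraction for the filtration by powers of `A₊`. -/
theorem picardStep_sub_mem {I : Submodule k R} (hI : I ∈ F.opens) {j : ℕ}
    {D D' h : (Op k R p)⟦X⟧} (hD : D ∈ coeffsIn (ceSpace F p 0))
    (hD' : D' ∈ coeffsIn (ceSpace F p 0)) (hD0 : coeff 0 D = 0) (hD0' : coeff 0 D' = 0)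
    (hh : h ∈ coeffsIn (ceSpace F p 0)) (hDD' : D - D' ∈ coeffsIn (valued p (powIdeal I j))) :
    picardStep h D - picardStep h D' ∈ coeffsIn (valued p (powIdeal I (j + 1))) := fun n => by
  have := expS_conj_sub_mem hI hD hD' hD0 hD0' hh hDD' (n - 1)
  rw [map_sub, picardStep, picardStep, coeff_mk, coeff_mk, ← LinearMap.smul_apply,
    ← LinearMap.smul_apply, ← map_sub, ← map_sub, LinearMap.smul_apply]
  exact Submodule.smul_mem _ _ (constPart_mem_valued this)

theorem EqBelow.expS {N : ℕ} {D D' : (Op k R p)⟦X⟧} (h : EqBelow N D D') :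
    EqBelow N (expS k D) (expS k D') := fun n hn => by
  have hp : ∀ j, EqBelow N (D ^ j) (D' ^ j) := fun j => by
    induction j with
    | zero => exact EqBelow.refl N _
    | succ j ih => rw [pow_succ, pow_succ]; exact ih.mul h
  simp only [CurvedLInf.expS, coeff_mk, map_sum, coeff_smul']
  exact sum_congr rfl fun j _ => by rw [hp j n hn]

/-- Contraction in the `z`-adic sense: integration gains one degree. -/
theorem EqBelow.picardStep {N : ℕ} (h : (Op k R p)⟦X⟧) {D D' : (Op k R p)⟦X⟧}
    (hD : EqBelow N D D') : EqBelow (N + 1) (picardStep h D) (picardStep h D') := fun n hn => by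
  cases n with
  | zero => rw [coeff_zero_picardStep, coeff_zero_picardStep]
  | succ n =>
    have hneg : EqBelow N (-D) (-D') := fun m hm => by rw [map_neg, map_neg, hD m hm]
    rw [coeff_succ_picardStep, coeff_succ_picardStep,
      ((hD.expS.mul (EqBelow.refl N h)).mul hneg.expS) n (by omega)]

/-- The Picard approximations. -/
noncomputable def picard (h : (Op k R p)⟦X⟧) (m : ℕ) : (Op k R p)⟦X⟧ := (picardStep h)^[m] 0

theorem picard_succ (h : (Op k R p)⟦X⟧) (m : ℕ) :
    picard h (m + 1) = picardStep h (picard h m) := Function.iterate_succ_apply' _ _ _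

theorem eqBelow_picard_succ (h : (Op k R p)⟦X⟧) (m : ℕ) :
    EqBelow m (picard h m) (picard h (m + 1)) := by
  induction m with
  | zero => exact fun n hn => absurd hn (by omega)
  | succ m ih => rw [picard_succ, picard_succ h (m + 1)]; exact ih.picardStep h

theorem eqBelow_picard (h : (Op k R p)⟦X⟧) {m n : ℕ} (hmn : m ≤ n) :
    EqBelow m (picard h m) (picard h n) := by
  induction n, hmn using Nat.le_induction with
  | base => exact EqBelow.refl _ _
  | succ n hmn ih => exact ih.trans fun i hi => eqBelow_picard_succ h n i (by omega)

theorem picard_mem {h : (Op k R p)⟦X⟧} (hh : h ∈ coeffsIn (ceSpace F p 0))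
    (hhg : h ∈ good F p) (m : ℕ) :
    picard h m ∈ coeffsIn (constSpace F p) ∧ picard h m ∈ good F p ∧
      coeff 0 (picard h m) = 0 := by
  induction m with
  | zero => exact ⟨zero_mem _, zero_mem _, map_zero _⟩
  | succ m ih =>
    rw [picard_succ]
    exact ⟨picardStep_mem ih.1 ih.2.2 hh, picardStep_mem_good ih.1 ih.2.1 ih.2.2 hh hhg,
      coeff_zero_picardStep _ _⟩

/-- The `z`-adic contraction yields a formal fixed point. Convergence at `z = 1` is a separate
matter and comes from the second contraction, along powers of `A₊`. -/
theorem exists_constant_path {h : (Op k R p)⟦X⟧} (hh : h ∈ coeffsIn (ceSpace F p 0))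
    (hhg : h ∈ good F p) : ∃ D : (Op k R p)⟦X⟧, D ∈ coeffsIn (constSpace F p) ∧ D ∈ good F p ∧
      coeff 0 D = 0 ∧
      ∀ n, coeff n (dz D) = constPart (coeff n (expS k D * h * expS k (-D))) := by
  -- The coefficient of degree `n` is stable from the iterate `n + 1` on.
  obtain ⟨D, hDdef⟩ : ∃ D : (Op k R p)⟦X⟧, ∀ n, coeff n D = coeff n (picard h (n + 1)) :=
    ⟨PowerSeries.mk fun n => coeff n (picard h (n + 1)), fun n => coeff_mk _ _⟩
  have hDm : ∀ m, EqBelow m D (picard h m) := fun m n hn => by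
    rw [hDdef]
    exact eqBelow_picard h hn n (Nat.lt_succ_self n)
  have hD : D ∈ coeffsIn (constSpace F p) := fun n => by
    rw [hDdef]; exact (picard_mem hh hhg _).1 n
  have hD0 : coeff 0 D = 0 := by
    rw [hDdef]; exact (picard_mem hh hhg _).2.2
  have hfix : picardStep h D = D := by
    ext n : 1
    rw [(hDm n).picardStep h n (Nat.lt_succ_self n), ← picard_succ, hDdef]
  have hclose : ∀ I ∈ F.opens, ∀ m, D - picard h m ∈ coeffsIn (valued p (powIdeal I m)) := by
    intro I hI m
    induction m with
    | zero =>
      rw [powIdeal_zero, picard, Function.iterate_zero, id, sub_zero]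
      exact fun n => mem_valued_top_of_mem_ceSpace (hD n).1
    | succ m ih =>
      have e : D - picard h (m + 1) = picardStep h D - picardStep h (picard h m) := by
        rw [hfix, picard_succ]
      rw [e]
      exact picardStep_sub_mem hI (coeffsIn_constSpace_le hD)
        (coeffsIn_constSpace_le (picard_mem hh hhg m).1) hD0 (picard_mem hh hhg m).2.2 hh ih
  refine ⟨D, hD, ⟨fun n => (hD n).1.1.mem_strong, fun I hI => ?_⟩, hD0, fun n => ?_⟩
  -- Modulo `I` the solution agrees in all degrees with the iterate `N`, which is polynomial there.
  · obtain ⟨N, hN⟩ := exists_powIdeal_le hI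
    obtain ⟨M, hM⟩ := (picard_mem hh hhg N).2.1.2 I hI
    refine ⟨M, fun n hn => ?_⟩
    have h1 := valued_mono hN (hclose I hI N n)
    rw [map_sub] at h1
    have h2 := add_mem h1 (hM n hn)
    rwa [sub_add_cancel] at h2
  · have h1 := congrArg (coeff (n + 1)) hfix.symm
    rw [coeff_succ_picardStep] at h1
    have hn : ((n + 1 : ℕ) : k) ≠ 0 := Nat.cast_ne_zero.mpr (Nat.succ_ne_zero n)
    rw [coeff_dz, h1, ← Nat.cast_smul_eq_nsmul k, smul_smul, mul_inv_cancel₀ hn, one_smul]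

end ConstantPath

/-! ### Truncated derivations, translations by constant derivations, and Maurer–Cartan points. -/

section Points

variable {k R : Type*} [Field k] [NonUnitalRing R] [Module k R]
  [IsScalarTower k R R] [SMulCommClass k R R] {B : Type*} [LinearOrder B]
  {F : FormalCDGA k R} {p : B → ZMod 2}

theorem Ser.mul_monomial_one {C : Type*} [Ring C] [Algebra k C] (S : Coeff k C)
    (h1 : (1 : C) ∈ S.gr 0) (f : Ser p C) :
    Ser.mul S f (Ser.monomial (Mono.one p) 1) = f := by
  funext ν
  unfold Ser.mul
  rw [sum_eq_single ⟨(ν.1, (0 : B →₀ ℕ)), by simp⟩]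
  · have : (Ser.monomial (Mono.one p) (1 : C)) ⟨0, ν.2.of_le (by simp)⟩ = 1 :=
      Pi.single_eq_same _ _
    simp [koszulExp, this, S.twist_one h1]
  · rintro ⟨⟨α, β⟩, hx⟩ _ hne
    have h0 : β ≠ 0 := by
      rintro rfl
      refine hne (Subtype.ext (Prod.ext ?_ rfl))
      simpa using hx
    have : (Ser.monomial (Mono.one p) (1 : C))
        ⟨β, ν.2.of_le (HasAntidiagonal.antidiagonal.snd_le hx)⟩ = 0 :=
      Pi.single_eq_of_ne (fun h => h0 (congrArg Subtype.val h)) _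
    simp [this]
  · intro h; exact absurd (mem_attach _ _) h

theorem LInfinityStructure.m_one (L : LInfinityStructure k p) :
    L.m (Ser.monomial (Mono.one p) 1) = 0 := by
  have hhom : Ser.IsHomogeneous (groundCoeff k) 0 (Ser.monomial (Mono.one p) (1 : k)) := by
    have := Ser.isHomogeneous_monomial (groundCoeff k) (Mono.one p) one_mem_groundCoeff_gr
    simpa [monoParity, Mono.one] using this
  have h := L.isDerivation.leibniz 0 _ (Ser.monomial (Mono.one p) 1) hhom
  have e : ∀ g : Ser p k, Ser.mul (groundCoeff k) (Ser.monomial (Mono.one p) 1) g = g := fun g => by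
    rw [Ser.monomial_one_mul]; funext ν; exact one_mul _
  rw [Ser.mul_monomial_one _ one_mem_groundCoeff_gr, Ser.mul_monomial_one _ one_mem_groundCoeff_gr,
    e] at h
  simpa using h

theorem apply_one_of_mem_CEbar {s : ZMod 2} {T : Op k R p} (hT : T ∈ CEbar F p s)
    {f : Ser p (Unitization k R)} (hf : f (Mono.one p) = 0) : T f (Mono.one p) = 0 := by
  refine eq_zero_of_mem_bar F fun I hI =>
    apply_mem_of_monomials hT.1.1.continuous hI le_rfl fun α => ?_
  by_cases h : α = Mono.one p
  · subst h
    have : (Ser.monomial (Mono.one p) (f (Mono.one p)) : Ser p (Unitization k R)) = 0 := by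
      rw [hf]; exact Pi.single_zero _
    rw [this, map_zero]; exact zero_mem _
  · refine hT.1.1.apply_monomial_mem α fun a _ b _ _ => ?_
    rw [hT.1.1.monomial_apply_one (one_mem_unital_gr F) hT.2 h, mul_zero, mul_zero]
    exact ⟨zero_mem _, zero_mem _⟩

theorem commutator_mem_ceBarSpace {s : ZMod 2} {T U : Op k R p} (hT : T ∈ ceBarSpace F p s)
    (hU : U ∈ ceBarSpace F p 0) : T * U - U * T ∈ ceBarSpace F p s := by
  refine ⟨commutator_mem_ceSpace hT.1 hU.1, fun i => ?_⟩
  rw [LinearMap.sub_apply, Pi.sub_apply, Module.End.mul_apply, Module.End.mul_apply,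
    apply_one_of_mem_CEbar hT (hU.2 i), apply_one_of_mem_CEbar hU (hT.2 i), sub_zero]

theorem totalDifferential_commutator_mem_ceBarSpace (L : LInfinityStructure k p) {U : Op k R p}
    (hU : U ∈ ceBarSpace F p 0) :
    totalDifferential F L * U - U * totalDifferential F L ∈ ceBarSpace F p 1 := by
  refine ⟨totalDifferential_commutator_mem_ceSpace L hU.1, fun i => ?_⟩
  rw [LinearMap.sub_apply, Pi.sub_apply, Module.End.mul_apply, Module.End.mul_apply,
    totalDifferential_apply_one F L (hU.2 i), apply_one_of_mem_CEbar hU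
      (totalDifferential_apply_one F L (Ser.X_apply_one i)), sub_zero]

theorem sub_constPart_mem_ceBarSpace {T : Op k R p} (hT : T ∈ ceSpace F p 0) :
    T - constPart T ∈ ceBarSpace F p 0 := by
  refine ⟨sub_mem hT (constPart_mem_constSpace hT).1, fun i => ?_⟩
  have e : Ser.component (k := k) 1 (Ser.X (Unitization k R) i : Ser p _) = Ser.X _ i := by
    funext ν
    rw [Ser.component_apply]
    split_ifs with h
    · rfl
    · have h1 : (Ser.X (Unitization k R) i : Ser p _) ν = 0 :=
        Pi.single_eq_of_ne (fun h0 => h (by rw [h0]; simp [Mono.var])) _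
      exact h1.symm
  rw [LinearMap.sub_apply, Pi.sub_apply, constPart_apply]
  have h0 : (Mono.one p).1.degree + 1 = 1 := by simp [Mono.one]
  rw [h0, e, sub_self]

/-! ### Translations -/

theorem IsExponential.apply_eq {D E : Op k R p} (h : IsExponential F D E)
    {f g : Ser p (Unitization k R)} {N : ℕ}
    (hN : ∀ n ≥ N, ∑ j ∈ range n, ((j.factorial : k)⁻¹ • (D ^ j) f) = g) : E f = g := by
  funext ν
  symm
  rw [← sub_eq_zero]
  refine eq_zero_of_mem_bar F fun I hI => ?_
  obtain ⟨M, hM⟩ := h f ν I hI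
  have h1 := hM (max M N) (le_max_left _ _)
  have h2 := congrFun (hN (max M N) (le_max_right _ _)) ν
  rw [Finset.sum_apply] at h2
  rw [← h2]
  exact h1

theorem pow_apply_eq_zero {D : Op k R p} {f : Ser p (Unitization k R)} {a : ℕ}
    (h : (D ^ a) f = 0) {j : ℕ} (hj : a ≤ j) : (D ^ j) f = 0 := by
  obtain ⟨b, rfl⟩ := Nat.exists_eq_add_of_le' hj
  rw [pow_add, Module.End.mul_apply, h, map_zero]

theorem IsExponential.apply_one {D E : Op k R p} (h : IsExponential F D E)
    (hD : D ∈ constSpace F p) (c : Unitization k R) :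
    E (Ser.monomial (Mono.one p) c) = Ser.monomial (Mono.one p) c := by
  refine h.apply_eq (N := 1) fun n hn => ?_
  rw [sum_eq_single 0]
  · simp
  · intro j _ hj
    rw [pow_apply_eq_zero (a := 1) (by rw [pow_one]; exact constSpace_apply_one hD c)
      (Nat.one_le_iff_ne_zero.mpr hj), smul_zero]
  · intro h; simp at h; omega

theorem IsExponential.apply_X {D E : Op k R p} (h : IsExponential F D E)
    (hD : D ∈ constSpace F p) (i : B) : E (Ser.X _ i) = Ser.X _ i + D (Ser.X _ i) := by
  have h2 : D (D (Ser.X _ i)) = 0 := by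
    rw [constSpace_apply_X hD i]; exact constSpace_apply_one hD _
  refine h.apply_eq (N := 2) fun n hn => ?_
  obtain ⟨m, rfl⟩ := Nat.exists_eq_add_of_le hn
  rw [sum_range_add, sum_eq_zero (s := range m) fun j _ => ?_]
  · simp [sum_range_succ]
  · rw [pow_apply_eq_zero (a := 2) (by rw [pow_two]; exact h2) (by omega), smul_zero]

/-- In the binomial expansion only two terms survive, as `D x_i` is a constant and `D² x_i = 0`. -/
theorem pow_succ_apply_X_mul {D : Op k R p} (hD : D ∈ constSpace F p) (i : B)
    (f : Ser p (Unitization k R)) (j : ℕ) :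
    (D ^ (j + 1)) (Ser.mul F.unital (Ser.X _ i) f) =
      Ser.mul F.unital (Ser.X _ i) ((D ^ (j + 1)) f) +
        (j + 1) • fun ν => D (Ser.X _ i) (Mono.one p) * (D ^ j) f ν := by
  have hstep : ∀ g : Ser p (Unitization k R), D (Ser.mul F.unital (Ser.X _ i) g) =
      Ser.mul F.unital (Ser.X _ i) (D g) +
        fun ν => D (Ser.X _ i) (Mono.one p) * g ν := fun g => by
    rw [hD.1.1.leibniz_even (Ser.isHomogeneous_X F.unital (one_mem_unital_gr F) i),
      constSpace_apply_X hD i, Ser.monomial_one_mul, add_comm]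
    congr 1
  induction j with
  | zero => simpa using hstep f
  | succ j ih =>
    have e : D ((D ^ j) f) = (D ^ (j + 1)) f := by rw [_root_.pow_succ', Module.End.mul_apply]
    rw [_root_.pow_succ', Module.End.mul_apply, ih, map_add, map_nsmul, hstep, hD.1.1.apply_mul,
      Module.End.mul_apply, succ_nsmul _ (j + 1), add_assoc, e, add_comm ((j + 1) • _)]

variable [CharZero k]

/-- `e^D` followed by restriction to the origin is evaluation at `ξ`. Multiplicativity is needed
only for a variable on the left, since monomials are built up that way. -/
theorem IsExponential.apply_X_mul_apply_one {D E : Op k R p} (h : IsExponential F D E)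
    (hD : D ∈ constSpace F p) (i : B) (f : Ser p (Unitization k R)) :
    E (Ser.mul F.unital (Ser.X _ i) f) (Mono.one p) =
      D (Ser.X _ i) (Mono.one p) * E f (Mono.one p) := by
  rw [← sub_eq_zero]
  refine eq_zero_of_mem_bar F fun I hI => ?_
  obtain ⟨N₁, hN₁⟩ := h (Ser.mul F.unital (Ser.X _ i) f) (Mono.one p) I hI
  obtain ⟨N₂, hN₂⟩ := h f (Mono.one p) I hI
  have h1 := hN₁ (max N₁ N₂ + 1) (by omega)
  have h2 := mul_mem_bar F hI (D (Ser.X _ i) (Mono.one p)) (hN₂ (max N₁ N₂) (le_max_right _ _))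
  -- The left sum has one more term: its term `j = 0` vanishes at the origin, and the factor `j + 1`
  -- turns `1/(j+1)!` into `1/j!`.
  have e : ∑ j ∈ range (max N₁ N₂ + 1), ((j.factorial : k)⁻¹ •
        (D ^ j) (Ser.mul F.unital (Ser.X _ i) f) (Mono.one p)) =
      D (Ser.X _ i) (Mono.one p) *
        ∑ j ∈ range (max N₁ N₂), ((j.factorial : k)⁻¹ • (D ^ j) f (Mono.one p)) := by
    rw [sum_range_succ', pow_zero, Module.End.one_apply, Ser.mul_apply_one, Ser.X_apply_one,
      zero_mul, smul_zero, add_zero, mul_sum]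
    refine sum_congr rfl fun j _ => ?_
    rw [pow_succ_apply_X_mul hD, Pi.add_apply, Ser.mul_apply_one, Ser.X_apply_one, zero_mul,
      zero_add, Pi.smul_apply, smul_comm, factorial_inv_smul_succ, mul_smul_comm]
  rw [e] at h1
  convert sub_mem h2 h1 using 1
  rw [mul_sub]
  abel

theorem evalMono_one (ξ : B → R) : evalMono (k := k) ξ (Mono.one p) = 1 := by
  simp [evalMono, Mono.one]

theorem evalMono_erase (ξ : B → R) {ν : Mono p} {i : B} (hi : i ∈ ν.1.support)
    (hmin : ∀ j ∈ ν.1.support, i ≤ j) :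
    evalMono ξ ν = (Unitization.inr (ξ i) : Unitization k R) * evalMono ξ (ν.erase i) := by
  classical
  -- The formula covers `ν` and `ν.erase i` at once, with `s` the support without `i`. The two
  -- alternatives for the support are needed because erasing may or may not remove the variable `i`
  -- altogether.
  have key : ∀ (μ : Mono p) (s : Finset B), i ∉ s → (∀ j ∈ s, i ≤ j) →
      (μ.1.support = s ∨ μ.1.support = insert i s) → (∀ j ∈ s, μ.1 j = ν.1 j) →
      evalMono ξ μ = (Unitization.inr (ξ i) : Unitization k R) ^ μ.1 i *
        ((s.sort (· ≤ ·)).map fun j => (Unitization.inr (ξ j) : Unitization k R) ^ ν.1 j).prod := by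
    intro μ s his hs hμ hj
    have e : ((s.sort (· ≤ ·)).map fun j => (Unitization.inr (ξ j) : Unitization k R) ^ ν.1 j) =
        ((s.sort (· ≤ ·)).map fun j => (Unitization.inr (ξ j) : Unitization k R) ^ μ.1 j) :=
      List.map_congr_left fun j h => by rw [hj j ((mem_sort _).mp h)]
    rw [e]
    rcases hμ with hμ | hμ
    · have h0 : μ.1 i = 0 := by
        rw [← hμ] at his; simpa using his
      rw [h0, pow_zero, one_mul, evalMono, hμ]
    · rw [evalMono, hμ, sort_insert _ hs his, List.map_cons, List.prod_cons]
  have hs : ∀ j ∈ ν.1.support.erase i, i ≤ j := fun j hj => hmin j (mem_of_mem_erase hj)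
  have hj : ∀ j ∈ ν.1.support.erase i, (ν.erase i).1 j = ν.1 j := fun j hj => by
    simp [Mono.erase, (ne_of_mem_erase hj).symm]
  have hi0 : ν.1 i ≠ 0 := Finsupp.mem_support_iff.mp hi
  have hei : (ν.erase i).1 i = ν.1 i - 1 := by simp [Mono.erase]
  rw [key ν _ (notMem_erase i _) hs (Or.inr (insert_erase hi).symm) fun _ _ => rfl,
    key (ν.erase i) _ (notMem_erase i _) hs ?_ hj, ← mul_assoc, ← pow_succ', hei,
    Nat.sub_add_cancel (Nat.one_le_iff_ne_zero.mpr hi0)]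
  by_cases h1 : ν.1 i = 1
  · left
    ext j
    by_cases hji : j = i
    · subst hji; simp [Mono.erase, h1]
    · simp [Mono.erase, hji]
  · right
    ext j
    by_cases hji : j = i
    · subst hji; simp [Mono.erase]; omega
    · simp [Mono.erase, hji]

/-- Taylor's formula: translating by `ξ` and restricting to the origin evaluates `x^ν` at `ξ`. -/
theorem IsExponential.apply_monomial_apply_one {D E : Op k R p} (h : IsExponential F D E)
    (hD : D ∈ constSpace F p) {ξ : B → R}
    (hξ : ∀ i, D (Ser.X _ i) (Mono.one p) = Unitization.inr (ξ i)) (ν : Mono p) :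
    E (Ser.monomial ν 1) (Mono.one p) = evalMono ξ ν := by
  induction ν using Mono.induction with
  | one =>
    rw [h.apply_one hD, evalMono_one]
    exact Pi.single_eq_same _ _
  | step ν i hi hmin ih =>
    rw [evalMono_erase ξ hi hmin, ← ih, ← hξ, ← h.apply_X_mul_apply_one hD,
      Ser.X_mul_monomial F.unital (one_mem_unital_gr F) hi hmin]

/-- A twisting without constant term comes from a Maurer-Cartan point. -/
theorem isMaurerCartanPoint_of_noConstantTerm (L : LInfinityStructure k p) {D E E' : Op k R p}
    {ξ : B → R} (hD : D ∈ constSpace F p)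
    (hξ : ∀ i, D (Ser.X _ i) (Mono.one p) = Unitization.inr (ξ i))
    (hE : IsExponential F D E) (hE' : IsExponential F (-D) E') (hEs : E ∈ strong F p)
    (hy : NoConstantTerm (E * totalDifferential F L * E' - totalDifferential F L)) :
    IsMaurerCartanPoint F L ξ := by
  refine ⟨fun i => ?_, fun i I hI => ?_⟩
  · have h1 := hD.1.1.parity _ _ (Ser.isHomogeneous_X F.unital (one_mem_unital_gr F) i)
      (Mono.one p)
    have h2 : monoParity p (Mono.one p).1 = 0 := by simp [monoParity, Mono.one]
    rw [hξ, h2, zero_add, add_zero] at h1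
    exact snd_mem_of_mem_unital_gr F h1
  · have hX : (Ser.X (Unitization k R) i : Ser p _) = Ser.scale 1 (Ser.X k i) :=
      Ser.monomial_eq_scale _ _
    have hQX : totalDifferential F L (Ser.X _ i) = Ser.scale 1 (L.m (Ser.X k i)) := by
      rw [hX, totalDifferential_scale, Coeff.parityAut_of_mem _ (one_mem_unital_gr F),
        unitalD_apply, Unitization.snd_one, map_zero]
      funext ν
      simp [Ser.scale]
    have hQc : ∀ c, totalDifferential F L (Ser.monomial (Mono.one p) c) =
        Ser.monomial (Mono.one p) (unitalD F c) := fun c => by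
      rw [Ser.monomial_eq_scale, totalDifferential_scale, L.m_one, Ser.monomial_eq_scale _
        (unitalD F c)]
      funext ν
      simp [Ser.scale]
    -- `e^{-ξ}` sends `x_i` to `x_i - ξ^i`, the differential sends this to `m(x_i) - d_A ξ^i`, and
    -- `e^ξ` at the origin gives `m^i(ξ) - d_A ξ^i`. The subtracted term has no constant term, so
    -- this difference is zero.
    have h1 := hy i
    rw [LinearMap.sub_apply, Pi.sub_apply, totalDifferential_apply_one F L (Ser.X_apply_one i),
      sub_zero, Module.End.mul_apply, Module.End.mul_apply, hE'.apply_X (neg_mem hD),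
      LinearMap.neg_apply, constSpace_apply_X hD i, hξ, map_add, map_neg, hQc, map_add, map_neg,
      hE.apply_one hD, hQX, Pi.add_apply, Pi.neg_apply, unitalD_apply, Unitization.snd_inr,
      Ser.monomial, Pi.single_eq_same] at h1
    -- Continuity of `E` makes the monomials outside `T₀` contribute only elements of `I`, so the
    -- partial sums of `m^i(ξ)` converge.
    obtain ⟨T₀, hT₀⟩ := hEs (Mono.one p) I hI
    refine ⟨T₀, fun T hT => ?_⟩
    have h2 := hT₀ (Ser.scale 1 (L.m (Ser.X k i)) -
      ∑ ν ∈ T, Ser.monomial ν (Ser.scale 1 (L.m (Ser.X k i)) ν)) fun α hα => by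
        rw [sub_sum_monomial_apply _ T (hT hα)]; exact zero_mem _
    have h3 : ∀ ν, E (Ser.monomial ν (Ser.scale 1 (L.m (Ser.X k i)) ν)) (Mono.one p) =
        L.m (Ser.X k i) ν • (evalMono ξ ν : Unitization k R) := fun ν => by
      have e : (Ser.monomial ν (Ser.scale (1 : Unitization k R) (L.m (Ser.X k i)) ν) : Ser p _) =
          L.m (Ser.X k i) ν • Ser.monomial ν 1 := Pi.single_smul _ _ _
      rw [e, map_smul, Pi.smul_apply, hE.apply_monomial_apply_one hD hξ]
    rw [map_sub, Pi.sub_apply, map_sum, Finset.sum_apply, sum_congr rfl fun ν _ => h3 ν] at h2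
    have h4 := neg_mem h2
    rw [neg_sub] at h4
    convert h4 using 2
    rw [eq_comm, ← sub_eq_zero, sub_eq_add_neg]
    exact h1

/-- Coordinates tending to zero define an element of the completed tensor product. -/
theorem exists_completedTensor {V : Type*} [AddCommGroup V] [Module k V]
    (b : Module.Basis B k V) (ξ : B → R) (hξ : ∀ I ∈ F.opens, {i | ξ i ∉ I}.Finite) :
    ∃ t : CompletedTensor F V, t.coord b = ξ := by
  classical
  have hsupp : ∀ I : F.opens, (Function.support fun i =>
      b i ⊗ₜ[k] (I.1.mkQ (ξ i))) ⊆ (hξ I.1 I.2).toFinset := fun I i hi => by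
    rw [Set.Finite.coe_toFinset]
    intro h
    refine hi ?_
    have : I.1.mkQ (ξ i) = 0 := (Submodule.Quotient.mk_eq_zero _).mpr h
    simp only [this, TensorProduct.tmul_zero]
  obtain ⟨t, ht⟩ : ∃ t : CompletedTensor F V, ∀ I : F.opens,
      t.val I = ∑ i ∈ (hξ I.1 I.2).toFinset, b i ⊗ₜ[k] (I.1.mkQ (ξ i)) := by
    refine ⟨⟨fun I => ∑ i ∈ (hξ I.1 I.2).toFinset, b i ⊗ₜ[k] (I.1.mkQ (ξ i)), fun I J h => ?_⟩,
      fun _ => rfl⟩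
    rw [map_sum, ← finsum_eq_sum_of_support_subset _ (hsupp J)]
    symm
    have hs : (Function.support fun i => b i ⊗ₜ[k] (J.1.mkQ (ξ i))) ⊆
        (hξ I.1 I.2).toFinset := fun i hi => by
      have := hsupp J hi
      rw [Set.Finite.coe_toFinset] at this ⊢
      exact fun h' => this (h h')
    rw [finsum_eq_sum_of_support_subset _ hs]
    refine sum_congr rfl fun i _ => ?_
    rw [LinearMap.lTensor_tmul]
    rfl
  refine ⟨t, ?_⟩
  funext i
  rw [← sub_eq_zero]
  refine F.separated _ fun I hI => ?_
  have h1 := (t.exists_coord b i).choose_spec ⟨I, hI⟩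
  rw [ht] at h1
  rw [← Submodule.Quotient.eq]
  refine Eq.trans h1 ?_
  simp only [map_sum, LinearMap.rTensor_tmul, TensorProduct.lid_tmul, Module.Basis.coord_apply,
    Module.Basis.repr_self]
  by_cases hi : ξ i ∈ I
  · rw [sum_eq_zero]
    · exact ((Submodule.Quotient.mk_eq_zero _).mpr hi).symm
    · intro j hj
      have hji : j ≠ i := by
        rintro rfl
        simp at hj; exact hj hi
      rw [Finsupp.single_eq_of_ne hji.symm, zero_smul]
  · rw [sum_eq_single i]
    · rw [Finsupp.single_eq_same, one_smul]; rfl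
    · intro j _ hji
      rw [Finsupp.single_eq_of_ne hji.symm, zero_smul]
    · intro h
      simp at h; exact absurd h hi

end Points

/-! ### The gauge transformation of the given path and its endpoint. -/

section Main

variable {k R : Type*} [Field k] [NonUnitalRing R] [Module k R]
  [IsScalarTower k R R] [SMulCommClass k R R] {B : Type*} [LinearOrder B]
  {F : FormalCDGA k R} {p : B → ZMod 2} (L : LInfinityStructure k p)

theorem coeff_curvature (X : (Op k R p)⟦X⟧) (n : ℕ) :
    coeff n ((C (totalDifferential F L) + X) * (C (totalDifferential F L) + X)) =
      totalDifferential F L * coeff n X + coeff n X * totalDifferential F L +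
        ∑ q ∈ HasAntidiagonal.antidiagonal n, coeff q.1 X * coeff q.2 X := by
  rw [add_mul, mul_add, mul_add, ← map_mul, totalDifferential_mul_self, map_zero, zero_add,
    map_add, map_add, coeff_C_mul, coeff_mul_C, coeff_mul]
  abel

theorem coeff_transport (X H : (Op k R p)⟦X⟧) (n : ℕ) :
    coeff n ((C (totalDifferential F L) + X) * H - H * (C (totalDifferential F L) + X)) =
      totalDifferential F L * coeff n H - coeff n H * totalDifferential F L +
        ∑ q ∈ HasAntidiagonal.antidiagonal n,
          (coeff q.1 X * coeff q.2 H - coeff q.2 H * coeff q.1 X) := by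
  have e : (C (totalDifferential F L) + X) * H - H * (C (totalDifferential F L) + X) =
      (C (totalDifferential F L) * H - H * C (totalDifferential F L)) + (X * H - H * X) := by
    rw [add_mul, mul_add]; abel
  rw [e, map_add, coeff_commutator X H, map_sub, coeff_C_mul, coeff_mul_C]

/-- Because `Q² = 0`, the coefficientwise equations become `(Q + X)² = 0` and `X' = [Q + X, H]`, a
form in which conjugation by exponentials is transparent. -/
theorem isMaurerCartanPath_iff {g : ZMod 2 → Set (Op k R p)} {X H : (Op k R p)⟦X⟧} :
    IsMaurerCartanPath F L g (fun n => coeff n X) (fun n => coeff n H) ↔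
      (∀ n, coeff n X ∈ g 1) ∧ (∀ n, coeff n H ∈ g 0) ∧ TendsToZero F (fun n => coeff n X) ∧
      TendsToZero F (fun n => coeff n H) ∧
      (C (totalDifferential F L) + X) * (C (totalDifferential F L) + X) = 0 ∧
      dz X = (C (totalDifferential F L) + X) * H - H * (C (totalDifferential F L) + X) := by
  have ht : ∀ n, (totalDifferential F L * coeff n H - coeff n H * totalDifferential F L -
      ((n : k) + 1) • coeff (n + 1) X + ∑ q ∈ HasAntidiagonal.antidiagonal n,
        (coeff q.1 X * coeff q.2 H - coeff q.2 H * coeff q.1 X) = 0) ↔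
      coeff n (dz X) =
        coeff n ((C (totalDifferential F L) + X) * H - H * (C (totalDifferential F L) + X)) := by
    intro n
    rw [coeff_transport, coeff_dz, ← Nat.cast_smul_eq_nsmul k, Nat.cast_succ, sub_add_eq_add_sub, sub_eq_zero,
      eq_comm]
  constructor
  · intro h
    refine ⟨h.odd, h.even, h.x_tendsto, h.h_tendsto, ?_, ?_⟩
    · ext n : 1
      rw [coeff_curvature, map_zero]; exact h.curvature n
    · ext n : 1
      exact (ht n).mp (h.transport n)
  · rintro ⟨h1, h2, h3, h4, h5, h6⟩
    exact ⟨h1, h2, h3, h4, fun n => by rw [← coeff_curvature, h5, map_zero],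
      fun n => (ht n).mpr (by rw [h6])⟩

variable [CharZero k]

/-- A path of curved deformations starting at an uncurved one is gauge equivalent, through constant
derivations, to a path of uncurved deformations. -/
theorem exists_twisting {x : Op k R p} (hx : IsMaurerCartan F L (CEbar F p) x)
    (htriv : GaugeEquivalent F L (CE F p) x 0) :
    ∃ ξ : B → R, (∀ I ∈ F.opens, {i | ξ i ∉ I}.Finite) ∧ IsMaurerCartanPoint F L ξ ∧
      ∃ y, IsTwistingDeformation F L ξ y ∧ IsMaurerCartan F L (CEbar F p) y ∧
        GaugeEquivalent F L (CEbar F p) x y := by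
  obtain ⟨x', h', hpath, hx0, hx1⟩ := htriv
  obtain ⟨X, rfl⟩ : ∃ X : (Op k R p)⟦X⟧, x' = fun n => coeff n X :=
    ⟨PowerSeries.mk x', funext fun n => (coeff_mk n x').symm⟩
  obtain ⟨H, rfl⟩ : ∃ H : (Op k R p)⟦X⟧, h' = fun n => coeff n H :=
    ⟨PowerSeries.mk h', funext fun n => (coeff_mk n h').symm⟩
  obtain ⟨hX, hH, hXt, hHt, hcurv, htrans⟩ := (isMaurerCartanPath_iff L).mp hpath
  have hXg : X ∈ good F p := ⟨fun n => (hX n).1.mem_strong, hXt⟩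
  have hHg : H ∈ good F p := ⟨fun n => (hH n).1.mem_strong, hHt⟩
  obtain ⟨D, hDc, hDg, hD0, hDeq⟩ := exists_constant_path (F := F) (h := H) hH hHg
  have hD := coeffsIn_constSpace_le hDc
  have hD0' : coeff 0 (-D) = 0 := by rw [map_neg, hD0, neg_zero]
  set Q := totalDifferential F L with hQdef
  have hQs : Q ∈ strong F p := totalDifferential_mem_strong F L
  set E := expS k D
  set E' := expS k (-D)
  have hEg : E ∈ good F p := expS_mem_good hD hDg hD0
  have hEg' : E' ∈ good F p := expS_mem_good (neg_mem hD) (neg_mem hDg) hD0'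
  have hEE' : E' * E = 1 := expS_neg_mul_expS k hD0
  have hcomm : Commute (dz D) D := by
    refine sub_eq_zero.mp ?_
    ext n : 1
    rw [coeff_commutator, map_zero]
    refine sum_eq_zero fun q _ => sub_eq_zero.mpr ?_
    rw [coeff_dz]
    exact (commute_of_mem_constSpace (nsmul_mem (hDc _) _) (hDc _))
  have hdE : dz E = dz D * E := dz_expS k hD0 hcomm
  have hdE' : dz E' = -(E' * dz D) := dz_expS_neg k hD0 hcomm
  set G := E * (C Q + X) * E' with hG
  set W := E * H * E' with hW
  have hGW : G * W = E * ((C Q + X) * H) * E' := by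
    calc G * W = E * (C Q + X) * (E' * E) * H * E' := by simp only [hG, hW, mul_assoc]
      _ = _ := by rw [hEE', mul_one]; simp only [mul_assoc]
  have hWG : W * G = E * (H * (C Q + X)) * E' := by
    calc W * G = E * H * (E' * E) * (C Q + X) * E' := by simp only [hG, hW, mul_assoc]
      _ = _ := by rw [hEE', mul_one]; simp only [mul_assoc]
  have hGG : G * G = 0 := by
    calc G * G = E * (C Q + X) * (E' * E) * (C Q + X) * E' := by simp only [hG, mul_assoc]
      _ = E * ((C Q + X) * (C Q + X)) * E' := by rw [hEE', mul_one]; simp only [mul_assoc]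
      _ = 0 := by rw [hcurv, mul_zero, zero_mul]
  -- The gauge-transformed `dz`-component is `W - D'`. The term `D'` comes from differentiating the
  -- exponentials.
  have hdG : dz G = G * (W - dz D) - (W - dz D) * G := by
    have h1 : dz (C Q + X) = (C Q + X) * H - H * (C Q + X) := by
      rw [map_add, dz_C, zero_add, htrans]
    have h2 : dz G = dz D * G + E * ((C Q + X) * H - H * (C Q + X)) * E' - G * dz D := by
      rw [hG, dz_conj hdE hdE', h1]
    rw [h2, mul_sub E, sub_mul _ _ E', ← hGW, ← hWG, mul_sub, sub_mul]
    abel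
  have hCG : C Q + (G - C Q) = G := by abel
  have hWs : W ∈ coeffsIn (ceSpace F p 0) := expS_conj_mem hD hD0 hH
  -- The differential equation for `D` is designed for this: `D'` is exactly the constant part of
  -- `W`.
  have hHt' : ∀ n, coeff n (W - dz D) ∈ ceBarSpace F p 0 := fun n => by
    rw [map_sub, hDeq n]
    exact sub_constPart_mem_ceBarSpace (hWs n)
  have hG0 : coeff 0 (G - C Q) = x := by
    have hE0 : constantCoeff E = 1 := by
      rw [← coeff_zero_eq_constantCoeff_apply]; exact coeff_zero_expS k D
    have hE0' : constantCoeff E' = 1 := by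
      rw [← coeff_zero_eq_constantCoeff_apply]; exact coeff_zero_expS k (-D)
    have hX0 : constantCoeff X = x := by
      rw [← coeff_zero_eq_constantCoeff_apply]; exact hx0
    rw [hG, coeff_zero_eq_constantCoeff, map_sub, map_mul, map_mul, map_add, constantCoeff_C, hE0,
      hE0', hX0, one_mul, mul_one, add_sub_cancel_left]
  have hdY : dz (G - C Q) = (C Q + (G - C Q)) * (W - dz D) - (W - dz D) * (C Q + (G - C Q)) := by
    rw [hCG, map_sub, dz_C, sub_zero, hdG]
  -- The Lax equation gives `n + 1` times the next coefficient as brackets of earlier ones, and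
  -- `CEbar` is closed under these brackets. The starting value is `x`.
  have hY : ∀ n, coeff n (G - C Q) ∈ ceBarSpace F p 1 := fun n => by
    induction n using Nat.strong_induction_on with
    | _ n ih =>
      cases n with
      | zero => rw [hG0]; exact hx.1
      | succ n =>
        have h1 := congrArg (coeff n) hdY
        rw [coeff_dz, coeff_transport, ← Nat.cast_smul_eq_nsmul k] at h1
        have hn : ((n + 1 : ℕ) : k) ≠ 0 := Nat.cast_ne_zero.mpr (Nat.succ_ne_zero n)
        rw [← Submodule.smul_mem_iff _ hn, h1]
        refine add_mem (totalDifferential_commutator_mem_ceBarSpace L (hHt' n))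
          (sum_mem fun q hq => ?_)
        have := HasAntidiagonal.mem_antidiagonal.mp hq
        exact commutator_mem_ceBarSpace (ih _ (by omega)) (hHt' _)
  have hCQg : C Q ∈ good F p := C_mem_good hQs
  have hGg : G ∈ good F p := mul_mem (mul_mem hEg (add_mem hCQg hXg)) hEg'
  have hYg : G - C Q ∈ good F p := sub_mem hGg hCQg
  have hWg : W - dz D ∈ good F p := sub_mem (mul_mem (mul_mem hEg hHg) hEg') (dz_mem_good hDg)
  have hpath' : IsMaurerCartanPath F L (CEbar F p) (fun n => coeff n (G - C Q))
      (fun n => coeff n (W - dz D)) :=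
    (isMaurerCartanPath_iff L).mpr ⟨hY, hHt', hYg.2, hWg.2, by rw [← hQdef, hCG, hGG], hdY⟩
  obtain ⟨d, hd⟩ := exists_sumsTo hDg.2
  obtain ⟨e, he⟩ := exists_sumsTo hEg.2
  obtain ⟨e', he'⟩ := exists_sumsTo hEg'.2
  -- Only here is the endpoint of the curved path used: `X` evaluates to `0` at `z = 1`.
  have hsG : EvalsTo F G (e * Q * e') := by
    have h1 : EvalsTo F (C Q + X) (Q + 0) := (evalsTo_C Q).add hx1
    rw [add_zero] at h1
    exact (EvalsTo.mul (EvalsTo.mul he h1 hEg.1) he'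
      (mul_mem hEg (add_mem hCQg hXg) : _ ∈ good F p).1)
  have hsY : EvalsTo F (G - C Q) (e * Q * e' - Q) := hsG.sub (evalsTo_C Q)
  have hee' : e' * e = 1 := by
    have h1 := EvalsTo.mul he' he hEg'.1
    rw [hEE'] at h1
    exact SumsTo.unique h1 evalsTo_one
  have hybar : e * Q * e' - Q ∈ CEbar F p 1 := Approx.mem_CEbar
    (SumsTo.approx hsY fun n => (sum_mem fun j _ => hY j : _ ∈ ceBarSpace F p 1))
  have hdc : d ∈ constSpace F p := by
    refine ⟨Approx.mem_CE (SumsTo.approx hd fun n =>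
      (sum_mem fun j _ => hD j : _ ∈ ceSpace F p 0)), ?_⟩
    refine eq_of_sub_mem_valued (F := F) fun I hI => ?_
    obtain ⟨N, hN⟩ := hd I hI
    have h1 : _ ∈ valued p I := hN N le_rfl
    have h2 := constPart_mem_valued h1
    have h3 : constPart (∑ j ∈ range N, coeff j D) = ∑ j ∈ range N, coeff j D :=
      (sum_mem fun j _ => hDc j : _ ∈ constSpace F p).2
    rw [map_sub, h3] at h2
    have h4 := sub_mem h1 h2
    rwa [sub_sub_sub_cancel_left] at h4
  have hnd : EvalsTo F (-D) (-d) := by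
    have := evalsTo_zero.sub hd
    rwa [zero_sub, zero_sub] at this
  have hexp : IsExponential F d e := isExponential_of_evalsTo hD hDg hD0 hd he
  have hexp' : IsExponential F (-d) e' :=
    isExponential_of_evalsTo (neg_mem hD) (neg_mem hDg) hD0' hnd he'
  have hξ : ∀ i, d (Ser.X _ i) (Mono.one p) =
      Unitization.inr (d (Ser.X _ i) (Mono.one p)).snd := fun i => by
    ext
    · exact hdc.1.2 _ _
    · rfl
  refine ⟨fun i => (d (Ser.X _ i) (Mono.one p)).snd, fun I hI => ?_,
    isMaurerCartanPoint_of_noConstantTerm L hdc hξ hexp hexp' (EvalsTo.mem_strong he hEg.1)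
      hybar.2, e * Q * e' - Q, ⟨d, e, e', ⟨hdc.1.1, fun i => ?_⟩, hexp, hexp', rfl⟩, ⟨hybar, ?_⟩,
    _, _, hpath', hG0, hsY⟩
  · classical
    -- Continuity of `d` at the constant coefficient involves finitely many monomials, hence all but
    -- finitely many `ξ^i` lie in `I`. This is what makes `ξ` an element of the completed tensor
    -- product.
    obtain ⟨T, hT⟩ := hdc.1.1.mem_strong (Mono.one p) I hI
    have hinj : Function.Injective (Mono.var p) := fun i j hij => by
      have h1 := DFunLike.congr_fun (congrArg Subtype.val hij) i
      by_contra hne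
      simp [Mono.var, Ne.symm hne] at h1
    refine (T.finite_toSet.preimage hinj.injOn).subset fun i hi => ?_
    by_contra hiT
    refine hi (mem_bar.mp (hT (Ser.X _ i) fun α hα => ?_)).2
    have : (Ser.X (Unitization k R) i : Ser p _) α = 0 :=
      Pi.single_eq_of_ne (fun h => hiT (by rw [Set.mem_preimage, ← h]; exact hα)) _
    rw [this]; exact zero_mem _
  · rw [← hξ]; exact constSpace_apply_X hdc i
  -- With `Q + y = e Q e'`, the Maurer–Cartan equation for `y` says that this conjugate squares to
  -- zero.
  · have h1 : (e * Q * e') * (e * Q * e') = 0 := by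
      calc (e * Q * e') * (e * Q * e') = e * Q * (e' * e) * Q * e' := by simp only [mul_assoc]
        _ = e * (Q * Q) * e' := by rw [hee', mul_one]; simp only [mul_assoc]
        _ = 0 := by rw [hQdef, totalDifferential_mul_self, mul_zero, zero_mul]
    have h2 : Q * Q = 0 := totalDifferential_mul_self F L
    simp only [mul_sub, sub_mul]
    rw [h1, h2]
    abel

end Main

end CurvedLInf

/-! ### The theorem for a graded vector space with an ordered homogeneous basis. -/

theorem mainTheorem6
    {k : Type*} [Field k] [CharZero k]
    {V : Type*} [AddCommGroup V] [Module k V]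
    (𝒱 : ZMod 2 → Submodule k V) (h𝒱 : IsCompl (𝒱 0) (𝒱 1))
    {B : Type*} [LinearOrder B] (b : Module.Basis B k V) (deg : B → ZMod 2)
    (hb : ∀ i, b i ∈ 𝒱 (deg i))
    (L : CurvedLInf.LInfinityStructure k (CurvedLInf.shiftedParity deg))
    {R : Type*} [NonUnitalRing R] [Module k R] [IsScalarTower k R R] [SMulCommClass k R R]
    (F : CurvedLInf.FormalCDGA k R)
    (x : CurvedLInf.Op k R (CurvedLInf.shiftedParity deg))
    (hx : CurvedLInf.IsMaurerCartan F L (CurvedLInf.CEbar F (CurvedLInf.shiftedParity deg)) x)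
    (htriv : CurvedLInf.GaugeEquivalent F L
      (CurvedLInf.CE F (CurvedLInf.shiftedParity deg)) x 0) :
    ∃ ξ : CurvedLInf.CompletedTensor F V,
      CurvedLInf.IsMaurerCartanPoint F L (ξ.coord b) ∧
      ∃ y : CurvedLInf.Op k R (CurvedLInf.shiftedParity deg),
        CurvedLInf.IsTwistingDeformation F L (ξ.coord b) y ∧
        CurvedLInf.IsMaurerCartan F L
          (CurvedLInf.CEbar F (CurvedLInf.shiftedParity deg)) y ∧
        CurvedLInf.GaugeEquivalent F L
          (CurvedLInf.CEbar F (CurvedLInf.shiftedParity deg)) x y := by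
  obtain ⟨ξ, hfin, hξ, hy⟩ := CurvedLInf.exists_twisting L hx htriv
  obtain ⟨t, rfl⟩ := CurvedLInf.exists_completedTensor b ξ hfin
  exact ⟨t, hξ, hy⟩
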